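/- Let $d\ge 0$ be an integer, $[d]=\{1,\dots,d\}$, $\mathcal X=[0,1]^d$, and let $I^{[0]},I^{[1]}\subseteq[d]$ (the variables with known left, respectively right, boundary) satisfy $I^{[0]}\cup I^{[1]}=[d]$. Let $\sigma>0$ and $\omega=(\omega_1,\dots,\omega_d)$ with all $\omega_j>0$. Write $s\wedge t=\min(s,t)$, $s\vee t=\max(s,t)$. Consider the following normed spaces of real functions on $\mathcal X$. 1. $\mathcal H_{k^{\rm BR}}$, the reproducing kernel Hilbert space (RKHS) of the Brownian kernel $k^{\rm BR}(\mathbf x,\mathbf y)=\prod_{j=1}^d k^{\rm BR}_j(x_j,y_j)$ on $\mathcal X$, where $k_j^{\rm BR}(s,t)$ is $(s\wedge t)(1-s\vee t)$ if $j\in I^{[0]}\cap I^{[1]}$, $s\wedge t$ if $j\in I^{[0]}\setminus I^{[1]}$, and $1-s\vee t$ if $j\in I^{[1]}\setminus I^{[0]}$. 2. $\mathcal H_{k^{\rm BM}_\omega}$, the RKHS of the BdryMatérn kernel $k^{\rm BM}_\omega(\mathbf x,\mathbf y)=\sigma^2\prod_{j=1}^d k^{\rm BM}_{\omega_j}(x_j,y_j)$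 on $\mathcal X$, where $k_{\omega_j}^{\rm BM}(s,t)$ is $\sinh[\omega_j(s\wedge t)]\sinh[\omega_j(1-s\vee t)]/\sinh(\omega_j)$ if $j\in I^{[0]}\cap I^{[1]}$, $\sinh[\omega_j(s\wedge t)]\,e^{-\omega_j(s\vee t)}$ if $j\in I^{[0]}\setminus I^{[1]}$, and $e^{\omega_j(s\wedge t)}\sinh[\omega_j(1-s\vee t)]$ if $j\in I^{[1]}\setminus I^{[0]}$. 3. The constrained mixed Sobolev space $\mathcal H^{1,c}_{mix}$. For $\Omega\subseteq\mathbb R^d$ open let $\mathcal H^1_{mix}(\Omega)$ be the space of functions whose weak derivatives $D^{\boldsymbol\alpha}f$ with $|\boldsymbol\alpha|_\infty\le1$ all lie in $L^2(\Omega)$, with $\|f\|^2=\sum_{|\boldsymbol\alpha|_\infty\le1}\|D^{\boldsymbol\alpha}f\|^2_{L^2(\Omega)}$; functions are identified with their continuous representatives. Two versions are considered: (3a) $\mathcal H^{1,c}_{mix}(\mathcal X)$: the continuous functions $f$ on $\mathcal X$ that lie in $\mathcal H^1_{mix}((0,1)^d)$ and satisfy $f(\mathbf x)=0$ whenever $x_i=0$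 for some $i\in I^{[0]}$ or $x_i=1$ for some $i\in I^{[1]}$, with the norm of $\mathcal H^1_{mix}((0,1)^d)$; (3b) the restrictions to $\mathcal X$ of the functions $F\in\mathcal H^1_{mix}(\mathbb R^d)$ with $F(\mathbf x)=0$ whenever $x_i\le0$ for some $i\in I^{[0]}$ or $x_i\ge1$ for some $i\in I^{[1]}$, with the quotient norm $\|f\|=\inf\{\|F\|_{\mathcal H^1_{mix}(\mathbb R^d)}:F|_{\mathcal X}=f\}$ over such $F$. 4. The limiting tensor FEM space $\mathcal V=\bigotimes_{j=1}^d\overline{\bigcup_{\alpha\in\mathbb N}\mathcal V^{(j)}_{\alpha}}$. Here $\mathcal V^{(j)}_\alpha$ is the span of the hat functions $\phi_{\alpha,\beta}(x)=\max\{1-|x-\beta2^{-\alpha}|/2^{-\alpha},0\}$ on $[0,1]$ with $\mathbf 1_{\{j\in I^{[0]}\}}\le\beta\le2^\alpha-\mathbf 1_{\{j\in I^{[1]}\}}$, the closure is taken in the Sobolev space $H^1(0,1)$ with $\langle f,g\rangle=\int_0^1fg+\int_0^1f'g'$, and $\bigotimes$ is the Hilbert space tensor product (the completion of the algebraic tensor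 product for the inner product with $\langle\bigotimes f_j,\bigotimes g_j\rangle=\prod_j\langle f_j,g_j\rangle$), realised as functions on $\mathcal X$ through $(\bigotimes f_j)(\mathbf x)=\prod_jf_j(x_j)$. Then all these spaces are pairwise equivalent: any two of them are equal as sets of functions on $\mathcal X$, and their norms are equivalent (each is bounded by a positive constant times the other, the constant not depending on the function). -/

import Mathlib

open MeasureTheory Filter Topology

noncomputable section

namespace BdryGP

/-! ### Function spaces and their equivalence -/

/-- A space of real functions on `X` (a set of functions) together with its norm; only the values of
`norm` on `carrier` are meaningful. -/
structure FnSpace (X : Type*) where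
  carrier : Set (X → ℝ)
  norm : (X → ℝ) → ℝ

/-- Equivalent function spaces: equal as sets of functions, with equivalent norms. -/
def FnSpace.Equivalent {X : Type*} (A B : FnSpace X) : Prop :=
  A.carrier = B.carrier ∧
    ∃ c C : ℝ, 0 < c ∧ 0 < C ∧
      ∀ f ∈ A.carrier, c * A.norm f ≤ B.norm f ∧ B.norm f ≤ C * A.norm f

/-- The input domain `[0,1]^d`. -/
abbrev Cube (d : ℕ) : Type := Fin d → unitInterval

/-! ### The reproducing kernel Hilbert space of a kernel -/

/-- A real kernel as a matrix of operators on `ℝ`. -/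
def kernelMatrix {X : Type*} (k : X → X → ℝ) : Matrix X X (ℝ →L[ℝ] ℝ) :=
  Matrix.of fun x y => k x y • ContinuousLinearMap.id ℝ ℝ

/-- The RKHS of the positive semidefinite kernel `k`: the functions represented by elements of the
completion of the span of the kernel sections, with the Hilbert norm of the (unique) representing
element. -/
def rkhs {X : Type*} (k : X → X → ℝ) (hk : (kernelMatrix k).PosSemidef) : FnSpace X :=
  haveI : Fact (kernelMatrix k).PosSemidef := ⟨hk⟩
  { carrier := Set.range fun h : RKHS.OfKernel (kernelMatrix k) => (⇑h : X → ℝ)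
    norm := fun f => sInf {r | ∃ h : RKHS.OfKernel (kernelMatrix k), ⇑h = f ∧ ‖h‖ = r} }

/-! ### The Brownian and the BdryMatérn kernels

`I₀` and `I₁` are the sets of variables whose left, respectively right, boundary is known. -/

/-- The one-dimensional Brownian kernel of the variable `j`. It is only used for `j ∈ I₀ ∪ I₁`, so
that the last case is `j ∈ I₁ \ I₀`. -/
def brownian1 {d : ℕ} (I₀ I₁ : Finset (Fin d)) (j : Fin d) (x y : ℝ) : ℝ :=
  if j ∈ I₀ ∧ j ∈ I₁ then min x y * (1 - max x y)
  else if j ∈ I₀ then min x y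
  else 1 - max x y

/-- The Brownian kernel on `[0,1]^d`. -/
def brownianKernel {d : ℕ} (I₀ I₁ : Finset (Fin d)) (x y : Cube d) : ℝ :=
  ∏ j, brownian1 I₀ I₁ j (x j) (y j)

/-- The one-dimensional BdryMatérn kernel of the variable `j` with wavelength `w`. -/
def bdryMatern1 {d : ℕ} (I₀ I₁ : Finset (Fin d)) (w : ℝ) (j : Fin d) (x y : ℝ) : ℝ :=
  if j ∈ I₀ ∧ j ∈ I₁ then
    Real.sinh (w * min x y) * Real.sinh (w * (1 - max x y)) / Real.sinh w
  else if j ∈ I₀ then Real.sinh (w * min x y) * Real.exp (w * (-max x y))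
  else if j ∈ I₁ then Real.exp (w * min x y) * Real.sinh (w * (1 - max x y))
  else Real.exp (-w * |x - y|)

/-- The BdryMatérn kernel on `[0,1]^d` with wavelengths `ω` and variance `σ ^ 2`. -/
def bdryMaternKernel {d : ℕ} (I₀ I₁ : Finset (Fin d)) (ω : Fin d → ℝ) (σ : ℝ)
    (x y : Cube d) : ℝ :=
  σ ^ 2 * ∏ j, bdryMatern1 I₀ I₁ (ω j) j (x j) (y j)

/-! Positive semidefiniteness of the two kernels: both are products of kernels of the form
`g x * g y * min (τ x) (τ y)` with `0 ≤ τ`. -/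

theorem min_eq_integral {a b : ℝ} (ha : 0 ≤ a) (hb : 0 ≤ b) :
    min a b = ∫ s : ℝ, (Set.Ioc 0 a).indicator 1 s * (Set.Ioc 0 b).indicator 1 s := by
  have h : ∀ s : ℝ, (Set.Ioc 0 a).indicator (1 : ℝ → ℝ) s * (Set.Ioc 0 b).indicator 1 s
      = (Set.Ioc 0 (min a b)).indicator 1 s := by
    intro s
    rw [← Set.inter_indicator_mul]
    simp [Set.Ioc_inter_Ioc, Set.indicator]
  simp_rw [h]
  rw [integral_indicator_one measurableSet_Ioc]
  simp [ha, hb]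

theorem posSemidef_kernelMatrix {X : Type*} {k : X → X → ℝ} (hs : ∀ x y, k x y = k y x)
    (hp : ∀ v : X →₀ ℝ, 0 ≤ v.sum fun x a => v.sum fun y b => a * b * k x y) :
    (kernelMatrix k).PosSemidef := by
  have h := (RKHS.posSemidef_tfae (K := kernelMatrix k)).out 0 2
  refine h.mpr ⟨?_, fun v => ?_⟩
  · have h1 : star (ContinuousLinearMap.id ℝ ℝ) = ContinuousLinearMap.id ℝ ℝ :=
      star_one (ℝ →L[ℝ] ℝ)
    ext x y
    simp [kernelMatrix, Matrix.conjTranspose_apply, hs x y, h1]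
  · convert hp v using 1
    simp only [kernelMatrix, Finsupp.sum, RCLike.re_to_real]
    refine Finset.sum_congr rfl fun x _ => Finset.sum_congr rfl fun y _ => ?_
    simp [hs x y]
    ring

theorem posSemidef_prod {d : ℕ} (g τ : Fin d → unitInterval → ℝ) (hτ : ∀ j t, 0 ≤ τ j t)
    (σ : ℝ) :
    (kernelMatrix fun x y : Cube d =>
      σ ^ 2 * ∏ j, (g j (x j) * g j (y j) * min (τ j (x j)) (τ j (y j)))).PosSemidef := by
  refine posSemidef_kernelMatrix (fun x y => ?_) (fun v => ?_)
  · congr 1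
    refine Finset.prod_congr rfl fun j _ => ?_
    rw [min_comm]; ring
  · let Φ : Cube d → (Fin d → ℝ) → ℝ := fun x s =>
      ∏ j, (g j (x j) * (Set.Ioc 0 (τ j (x j))).indicator 1 (s j))
    have hΦ : ∀ x y s, Φ x s * Φ y s = ∏ j, (g j (x j) * g j (y j) *
        ((Set.Ioc 0 (τ j (x j))).indicator 1 (s j) *
          (Set.Ioc 0 (τ j (y j))).indicator 1 (s j))) := by
      intro x y s
      simp only [Φ, ← Finset.prod_mul_distrib]
      exact Finset.prod_congr rfl fun j _ => by ring
    have hint : ∀ x y, Integrable fun s => Φ x s * Φ y s := by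
      intro x y
      simp_rw [hΦ]
      refine Integrable.fintype_prod (f := fun j t => g j (x j) * g j (y j) *
        ((Set.Ioc 0 (τ j (x j))).indicator 1 t * (Set.Ioc 0 (τ j (y j))).indicator 1 t))
        fun j => ?_
      refine Integrable.const_mul ?_ _
      simp_rw [← Set.inter_indicator_mul]
      refine IntegrableOn.integrable_indicator ?_ (by measurability)
      simp only [Pi.one_apply, mul_one]
      refine integrableOn_const (ne_of_lt ?_)
      exact lt_of_le_of_lt (measure_mono Set.inter_subset_left) (by simp)
    have hk : ∀ x y : Cube d, ∏ j, (g j (x j) * g j (y j) * min (τ j (x j)) (τ j (y j)))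
        = ∫ s, Φ x s * Φ y s := by
      intro x y
      simp_rw [hΦ]
      rw [integral_fintype_prod_volume_eq_prod (fun j t => g j (x j) * g j (y j) *
        ((Set.Ioc 0 (τ j (x j))).indicator 1 t * (Set.Ioc 0 (τ j (y j))).indicator 1 t))]
      refine Finset.prod_congr rfl fun j _ => ?_
      rw [integral_const_mul, ← min_eq_integral (hτ _ _) (hτ _ _)]
    have h1 : (v.sum fun x a => v.sum fun y b => a * b *
        (σ ^ 2 * ∏ j, (g j (x j) * g j (y j) * min (τ j (x j)) (τ j (y j)))))
        = σ ^ 2 * ∫ s, (∑ x ∈ v.support, v x * Φ x s) ^ 2 := by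
      have h2 : ∀ s, (∑ x ∈ v.support, v x * Φ x s) ^ 2
          = ∑ x ∈ v.support, ∑ y ∈ v.support, v x * v y * (Φ x s * Φ y s) := by
        intro s
        rw [sq, Finset.sum_mul_sum]
        exact Finset.sum_congr rfl fun x _ => Finset.sum_congr rfl fun y _ => by ring
      simp_rw [h2]
      rw [integral_finsetSum _ fun x _ => integrable_finsetSum _ fun y _ =>
        (hint x y).const_mul _]
      simp only [Finsupp.sum, Finset.mul_sum]
      refine Finset.sum_congr rfl fun x _ => ?_
      rw [integral_finsetSum _ fun y _ => (hint x y).const_mul _, Finset.mul_sum]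
      refine Finset.sum_congr rfl fun y _ => ?_
      rw [integral_const_mul, hk]
      ring
    rw [h1]
    exact mul_nonneg (sq_nonneg _) (integral_nonneg fun s => sq_nonneg _)

theorem brownianKernel_posSemidef {d : ℕ} (I₀ I₁ : Finset (Fin d)) :
    (kernelMatrix (brownianKernel I₀ I₁)).PosSemidef := by
  have key := posSemidef_prod (d := d)
    (fun j t => if j ∈ I₀ ∧ j ∈ I₁ then 1 - (t : ℝ) else 1)
    (fun j t => if j ∈ I₀ ∧ j ∈ I₁ then (t : ℝ) / (1 - t) else if j ∈ I₀ then (t : ℝ) else 1 - t)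
    (fun j t => by
      have h0 := t.2.1
      have h1 : (0 : ℝ) ≤ 1 - t := sub_nonneg.2 t.2.2
      split_ifs
      · exact div_nonneg h0 h1
      · exact h0
      · exact h1) 1
  convert key using 2
  funext x y
  simp only [one_pow, one_mul, brownianKernel]
  refine Finset.prod_congr rfl fun j _ => ?_
  generalize x j = s
  generalize y j = t
  unfold brownian1
  split_ifs
  · wlog hst : (s : ℝ) ≤ t generalizing s t
    · rw [min_comm, max_comm, this t s (le_of_not_ge hst), min_comm (_ / _)]; ring
    rw [min_eq_left hst, max_eq_right hst]
    rcases eq_or_lt_of_le t.2.2 with h | h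
    · simp [h]
    · have hs : 0 < 1 - (s : ℝ) := by linarith
      have ht : 0 < 1 - (t : ℝ) := by linarith
      rw [min_eq_left (by rw [div_le_div_iff₀ hs ht]; nlinarith)]
      field_simp
  · simp
  · rcases le_total (s : ℝ) t with h | h
    · rw [max_eq_right h, min_eq_right (by linarith)]; ring
    · rw [max_eq_left h, min_eq_left (by linarith)]; ring

theorem bdryMaternKernel_posSemidef {d : ℕ} (I₀ I₁ : Finset (Fin d)) (ω : Fin d → ℝ)
    (hω : ∀ j, 0 < ω j) (σ : ℝ) :
    (kernelMatrix (bdryMaternKernel I₀ I₁ ω σ)).PosSemidef := by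
  have key := posSemidef_prod (d := d)
    (fun j t => if j ∈ I₀ ∧ j ∈ I₁ then Real.sinh (ω j * (1 - t))
      else if j ∈ I₀ then Real.exp (-(ω j * t))
      else if j ∈ I₁ then Real.exp (ω j * t) else Real.exp (-(ω j * t)))
    (fun j t => if j ∈ I₀ ∧ j ∈ I₁ then
        Real.sinh (ω j * t) / (Real.sinh (ω j * (1 - t)) * Real.sinh (ω j))
      else if j ∈ I₀ then Real.sinh (ω j * t) * Real.exp (ω j * t)
      else if j ∈ I₁ then Real.sinh (ω j * (1 - t)) * Real.exp (-(ω j * t))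
      else Real.exp (ω j * t) * Real.exp (ω j * t))
    (fun j t => by
      have h0 := mul_nonneg (hω j).le t.2.1
      have h1 : 0 ≤ ω j * (1 - t) := mul_nonneg (hω j).le (sub_nonneg.2 t.2.2)
      have h0' := Real.sinh_nonneg_iff.2 h0
      have h1' := Real.sinh_nonneg_iff.2 h1
      have h2' := Real.sinh_nonneg_iff.2 (hω j).le
      split_ifs <;> positivity) σ
  convert key using 2
  funext x y
  unfold bdryMaternKernel
  congr 1
  refine Finset.prod_congr rfl fun j _ => ?_
  generalize x j = s
  generalize y j = t
  have hw := hω j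
  generalize ω j = w at hw
  have hmain : ∀ s t : unitInterval, (s : ℝ) ≤ t → bdryMatern1 I₀ I₁ w j s t =
      (if j ∈ I₀ ∧ j ∈ I₁ then Real.sinh (w * (1 - s))
      else if j ∈ I₀ then Real.exp (-(w * s))
      else if j ∈ I₁ then Real.exp (w * s) else Real.exp (-(w * s))) *
      (if j ∈ I₀ ∧ j ∈ I₁ then Real.sinh (w * (1 - t))
      else if j ∈ I₀ then Real.exp (-(w * t))
      else if j ∈ I₁ then Real.exp (w * t) else Real.exp (-(w * t))) *
      min (if j ∈ I₀ ∧ j ∈ I₁ then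
        Real.sinh (w * s) / (Real.sinh (w * (1 - s)) * Real.sinh w)
      else if j ∈ I₀ then Real.sinh (w * s) * Real.exp (w * s)
      else if j ∈ I₁ then Real.sinh (w * (1 - s)) * Real.exp (-(w * s))
      else Real.exp (w * s) * Real.exp (w * s))
      (if j ∈ I₀ ∧ j ∈ I₁ then
        Real.sinh (w * t) / (Real.sinh (w * (1 - t)) * Real.sinh w)
      else if j ∈ I₀ then Real.sinh (w * t) * Real.exp (w * t)
      else if j ∈ I₁ then Real.sinh (w * (1 - t)) * Real.exp (-(w * t))
      else Real.exp (w * t) * Real.exp (w * t)) := by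
    intro s t hst
    unfold bdryMatern1
    rw [min_eq_left hst, max_eq_right hst]
    have hmul : w * s ≤ w * t := mul_le_mul_of_nonneg_left hst hw.le
    have hmul' : w * (1 - t) ≤ w * (1 - s) := mul_le_mul_of_nonneg_left (by linarith) hw.le
    have hs0 : 0 ≤ Real.sinh (w * s) := Real.sinh_nonneg_iff.2 (mul_nonneg hw.le s.2.1)
    have ht0 : 0 ≤ Real.sinh (w * (1 - t)) :=
      Real.sinh_nonneg_iff.2 (mul_nonneg hw.le (sub_nonneg.2 t.2.2))
    have hsw : 0 < Real.sinh w := Real.sinh_pos_iff.2 hw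
    split_ifs
    · rcases eq_or_lt_of_le t.2.2 with h | h
      · simp [h]
      · have hB : 0 < Real.sinh (w * (1 - t)) := Real.sinh_pos_iff.2 (mul_pos hw (by linarith))
        have hA : 0 < Real.sinh (w * (1 - s)) :=
          hB.trans_le (Real.sinh_le_sinh.2 hmul')
        rw [min_eq_left]
        · field_simp
        · refine div_le_div₀ (hs0.trans (Real.sinh_le_sinh.2 hmul)) (Real.sinh_le_sinh.2 hmul)
            (mul_pos hB hsw) ?_
          exact mul_le_mul_of_nonneg_right (Real.sinh_le_sinh.2 hmul') hsw.le
    · rw [min_eq_left (mul_le_mul (Real.sinh_le_sinh.2 hmul) (Real.exp_le_exp.2 hmul)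
        (Real.exp_pos _).le (hs0.trans (Real.sinh_le_sinh.2 hmul)))]
      have : Real.exp (-(w * s)) * Real.exp (w * s) = 1 := by rw [← Real.exp_add]; simp
      rw [show w * (-(t : ℝ)) = -(w * t) by ring]
      linear_combination (-Real.sinh (w * s) * Real.exp (-(w * t))) * this
    · rw [min_eq_right (mul_le_mul (Real.sinh_le_sinh.2 hmul')
        (Real.exp_le_exp.2 (neg_le_neg hmul)) (Real.exp_pos _).le
        (ht0.trans (Real.sinh_le_sinh.2 hmul')))]
      have : Real.exp (w * t) * Real.exp (-(w * t)) = 1 := by rw [← Real.exp_add]; simp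
      linear_combination (-Real.exp (w * s) * Real.sinh (w * (1 - t))) * this
    · rw [min_eq_left (mul_le_mul (Real.exp_le_exp.2 hmul) (Real.exp_le_exp.2 hmul)
        (Real.exp_pos _).le (Real.exp_pos _).le), abs_of_nonpos (by linarith)]
      simp only [← Real.exp_add]
      congr 1
      ring
  rcases le_total (s : ℝ) t with h | h
  · exact hmain s t h
  · have hsymm : bdryMatern1 I₀ I₁ w j s t = bdryMatern1 I₀ I₁ w j t s := by
      unfold bdryMatern1
      rw [min_comm, max_comm, abs_sub_comm]
    rw [hsymm, hmain t s h, min_comm]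
    ring

/-- The RKHS of the Brownian kernel. -/
def brownianSpace {d : ℕ} (I₀ I₁ : Finset (Fin d)) : FnSpace (Cube d) :=
  rkhs (brownianKernel I₀ I₁) (brownianKernel_posSemidef I₀ I₁)

/-- The RKHS of the BdryMatérn kernel. -/
def bdryMaternSpace {d : ℕ} (I₀ I₁ : Finset (Fin d)) (ω : Fin d → ℝ) (hω : ∀ j, 0 < ω j)
    (σ : ℝ) : FnSpace (Cube d) :=
  rkhs (bdryMaternKernel I₀ I₁ ω σ) (bdryMaternKernel_posSemidef I₀ I₁ ω hω σ)

/-! ### Mixed Sobolev spaces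

A multi-index `α` with `|α|_∞ ≤ 1` is given by the set `S` of the `j` with `α j = 1`. -/

/-- The classical mixed partial derivative `∂^S φ`, the variables in `S` being used once each. -/
def mixedPartial {d : ℕ} (S : Finset (Fin d)) (φ : (Fin d → ℝ) → ℝ) (x : Fin d → ℝ) : ℝ :=
  iteratedFDeriv ℝ S.card φ x fun i => Pi.single (S.orderEmbOfFin rfl i) 1

open scoped ContDiff in
/-- `g` is a weak derivative `D^S F` on the open set `Ω`, and lies in `L²(Ω)`. -/
def IsWeakMixedDeriv {d : ℕ} (Ω : Set (Fin d → ℝ)) (S : Finset (Fin d))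
    (F g : (Fin d → ℝ) → ℝ) : Prop :=
  MemLp g 2 (volume.restrict Ω) ∧
    ∀ φ : (Fin d → ℝ) → ℝ, ContDiff ℝ ∞ φ → HasCompactSupport φ → tsupport φ ⊆ Ω →
      ∫ x in Ω, F x * mixedPartial S φ x = (-1) ^ S.card * ∫ x in Ω, g x * φ x

/-- `F ∈ H¹_mix(Ω)`. -/
def MemH1mix {d : ℕ} (Ω : Set (Fin d → ℝ)) (F : (Fin d → ℝ) → ℝ) : Prop :=
  MemLp F 2 (volume.restrict Ω) ∧ ∀ S : Finset (Fin d), ∃ g, IsWeakMixedDeriv Ω S F g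

open Classical in
/-- A choice of the (almost everywhere unique) weak derivative `D^S F` in `L²(Ω)`. -/
def weakMixedDeriv {d : ℕ} (Ω : Set (Fin d → ℝ)) (S : Finset (Fin d)) (F : (Fin d → ℝ) → ℝ) :
    (Fin d → ℝ) → ℝ :=
  if h : ∃ g, IsWeakMixedDeriv Ω S F g then h.choose else 0

/-- The norm of `H¹_mix(Ω)`. -/
def h1mixNorm {d : ℕ} (Ω : Set (Fin d → ℝ)) (F : (Fin d → ℝ) → ℝ) : ℝ :=
  √(∑ S : Finset (Fin d), ∫ x in Ω, weakMixedDeriv Ω S F x ^ 2)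

/-- A function on `[0,1]^d` as a function on `ℝ^d`; only the values on the cube are used. -/
def extendCube {d : ℕ} (f : Cube d → ℝ) (x : Fin d → ℝ) : ℝ :=
  f fun j => Set.projIcc 0 1 zero_le_one (x j)

/-- The open cube `(0,1)^d`. -/
def openCube (d : ℕ) : Set (Fin d → ℝ) := Set.univ.pi fun _ => Set.Ioo 0 1

/-- The constrained mixed Sobolev space on `[0,1]^d`; its elements are represented by continuous
functions, so that the boundary values are meaningful. -/
def sobolevCube {d : ℕ} (I₀ I₁ : Finset (Fin d)) : FnSpace (Cube d) where
  carrier := {f | Continuous f ∧ MemH1mix (openCube d) (extendCube f) ∧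
    ∀ x : Cube d, ((∃ i ∈ I₀, x i = 0) ∨ ∃ i ∈ I₁, x i = 1) → f x = 0}
  norm f := h1mixNorm (openCube d) (extendCube f)

/-- The (continuous representatives of the) elements of the constrained mixed Sobolev space on
`ℝ^d`. -/
def MemConstrained {d : ℕ} (I₀ I₁ : Finset (Fin d)) (F : (Fin d → ℝ) → ℝ) : Prop :=
  Continuous F ∧ MemH1mix Set.univ F ∧
    ∀ x : Fin d → ℝ, ((∃ i ∈ I₀, x i ≤ 0) ∨ ∃ i ∈ I₁, 1 ≤ x i) → F x = 0

/-- The restrictions to `[0,1]^d` of the elements of the constrained mixed Sobolev space on `ℝ^d`,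
with the quotient norm. -/
def sobolevRestrict {d : ℕ} (I₀ I₁ : Finset (Fin d)) : FnSpace (Cube d) where
  carrier := {f | ∃ F, MemConstrained I₀ I₁ F ∧ ∀ x : Cube d, F (fun j => (x j : ℝ)) = f x}
  norm f := sInf {r | ∃ F, MemConstrained I₀ I₁ F ∧
    (∀ x : Cube d, F (fun j => (x j : ℝ)) = f x) ∧ h1mixNorm Set.univ F = r}

/-! ### The limiting tensor FEM space -/

/-- `f` is absolutely continuous on `[0,1]` with derivative `g ∈ L²(0,1)`. -/
def IsDeriv1 (f : unitInterval → ℝ) (g : ℝ → ℝ) : Prop :=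
  MemLp g 2 (volume.restrict (Set.Ioo 0 1)) ∧
    ∀ x : unitInterval, f x = f 0 + ∫ t in (0 : ℝ)..x, g t

/-- `f ∈ H¹(0,1)`. -/
def MemH1 (f : unitInterval → ℝ) : Prop := ∃ g, IsDeriv1 f g

open Classical in
/-- A choice of the (almost everywhere unique) derivative of `f ∈ H¹(0,1)`. -/
def deriv1 (f : unitInterval → ℝ) : ℝ → ℝ := if h : MemH1 f then h.choose else 0

/-- The inner product of `H¹(0,1)`. -/
def h1Inner (f h : unitInterval → ℝ) : ℝ :=
  (∫ x : unitInterval, f x * h x) + ∫ t in (0 : ℝ)..1, deriv1 f t * deriv1 h t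

/-- The hat function of level `α` centred at the grid point `β 2^{-α}`. -/
def hat (α β : ℕ) (x : unitInterval) : ℝ := max (1 - |(x : ℝ) - β * (2 ^ α)⁻¹| / (2 ^ α)⁻¹) 0

/-- The one-dimensional FEM space of level `α` in the variable `j`: the span of the hat functions
centred at the grid points other than the known boundary points. -/
def femLevel {d : ℕ} (I₀ I₁ : Finset (Fin d)) (j : Fin d) (α : ℕ) :
    Submodule ℝ (unitInterval → ℝ) :=
  Submodule.span ℝ {φ | ∃ β ∈ Finset.Icc (if j ∈ I₀ then 1 else 0)
    (2 ^ α - if j ∈ I₁ then 1 else 0), hat α β = φ}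

/-- The limiting one-dimensional FEM space: the closure in `H¹(0,1)` of the union of the increasing
sequence of the FEM spaces of all levels. -/
def femLimit {d : ℕ} (I₀ I₁ : Finset (Fin d)) (j : Fin d) : Set (unitInterval → ℝ) :=
  {f | MemH1 f ∧ ∀ ε > 0, ∃ α, ∃ g ∈ femLevel I₀ I₁ j α, √(h1Inner (f - g) (f - g)) < ε}

/-- The function `x ↦ ∑ c_a ∏ a_j (x_j)` given by a formal linear combination of elementary tensors
`a_1 ⊗ ⋯ ⊗ a_d`. -/
def tensorEval {d : ℕ} (c : (Fin d → unitInterval → ℝ) →₀ ℝ) (x : Cube d) : ℝ :=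
  c.sum fun a z => z * ∏ j, a j (x j)

/-- The tensor product inner product, `⟨⊗ a_j, ⊗ b_j⟩ = ∏ ⟨a_j, b_j⟩` extended bilinearly. -/
def tensorInner {d : ℕ} (c c' : (Fin d → unitInterval → ℝ) →₀ ℝ) : ℝ :=
  c.sum fun a z => c'.sum fun b w => z * w * ∏ j, h1Inner (a j) (b j)

/-- `f` is the function represented by an element of norm `r` of the Hilbert space tensor product of
the subspaces `E j` of `H¹(0,1)`, that is, of the completion of the algebraic tensor product. -/
def IsTensorLimit {d : ℕ} (E : Fin d → Set (unitInterval → ℝ)) (f : Cube d → ℝ) (r : ℝ) : Prop :=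
  ∃ c : ℕ → (Fin d → unitInterval → ℝ) →₀ ℝ,
    (∀ n, ∀ a ∈ (c n).support, ∀ j, a j ∈ E j) ∧
    (∀ ε > 0, ∃ N, ∀ m ≥ N, ∀ n ≥ N, √(tensorInner (c m - c n) (c m - c n)) < ε) ∧
    (∀ x, Tendsto (fun n => tensorEval (c n) x) atTop (𝓝 (f x))) ∧
    Tendsto (fun n => √(tensorInner (c n) (c n))) atTop (𝓝 r)

/-- The limiting tensor FEM space: the Hilbert space tensor product of the limiting one-dimensional
FEM spaces, realised as a space of functions on `[0,1]^d`. -/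
def femSpace {d : ℕ} (I₀ I₁ : Finset (Fin d)) : FnSpace (Cube d) where
  carrier := {f | ∃ r, IsTensorLimit (femLimit I₀ I₁) f r}
  norm f := sInf {r | IsTensorLimit (femLimit I₀ I₁) f r}

end BdryGP

end

/-!
The five spaces are compared through the Brownian space. It is a reproducing kernel Hilbert space,
so that `f` lies in it with norm at most `M` exactly if `(∑ v x f x)² ≤ M² ∑ v x v y k(x, y)` for
all finitely supported `v` (`sum_mul_sq_le_norm`, `mem_rkhs_of_sum_mul_sq_le`). All the comparisons
become inequalities between positive semidefinite kernels, and these pass from one variable to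
products by the Schur product theorem (`isPSD_prod_sub_prod`, `kernelForm_prod_le`).

*BdryMatérn.* In one variable the BdryMatérn kernel with known left boundary is a bi-Lipschitz time
change of `min s t`, multiplied by a smooth non-vanishing factor, so that each of the two kernels is
dominated by a multiple of the other (`dominated_leftMatern_min`). Known right boundaries are
reduced to this by reflection, and two known boundaries by conditioning on the value at `1`, which
is monotone in the kernel (`Dominated.condKernel`). Aronszajn's comparison `rkhs_embeds_of_le`
concludes.

*Sobolev spaces.* The inclusions form a cycle. A function of the Brownian space is composed with a
product of retractions `ℝ → [0,1]` that are constant beyond known boundary points and reflect at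
unknown ones; the composition has compact support, vanishes where required, and its weak mixed
derivatives are bounded in `L²(ℝ^d)` (`brownianSpace_embeds_sobolevRestrict`). Restriction leads
from `ℝ^d` to the cube. On the cube, a constrained function is recovered from its top mixed
derivative `g`: `f x = ∫ g Φ_x` with `Φ_x` the product of the slopes of the sections of the
one-dimensional kernels (`eq_setIntegral_mul_cubeFeature`). Since `⟨Φ_x, Φ_y⟩ = k(x, y)`, this
bounds the Brownian norm of `f` by the `L²` norm of `g` (`sobolevCube_embeds_brownianSpace`).

*Finite elements.* On `H¹(0,1)` functions with the boundary conditions, `a y` is the inner product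
of `a'` with the slope of `k(·, y)`. A kernel on the disjoint union of functions and points joins
the inner product of `H¹(0,1)`, this pairing and the Brownian kernel, and Cauchy–Schwarz for its
`d`-fold product bounds the Brownian norm by the tensor norm (`femSpace_embeds_brownianSpace`).
Conversely, the sections of the one-dimensional Brownian kernels at dyadic points are finite
elements, all sections are limits of these (`brownianSection_mem_femLimit`), and their Gram kernel
in `H¹(0,1)` is at most twice the Brownian kernel in each variable
(`brownianSpace_embeds_femSpace`).
-/

noncomputable section

namespace BdryGP

/-! ### Positive semidefinite kernels -/

/-- The bilinear form `∑ v x * w y * k x y` of a kernel on finitely supported vectors. -/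
def kernelForm {X : Type*} (k : X → X → ℝ) (v w : X →₀ ℝ) : ℝ :=
  v.sum fun x a => w.sum fun y b => a * b * k x y

/-- Symmetric positive semidefinite real kernels. -/
def IsPSD {X : Type*} (k : X → X → ℝ) : Prop := (Matrix.of k).PosSemidef

section PSD

variable {X Y : Type*} {k m : X → X → ℝ}

theorem isPSD_iff : IsPSD k ↔ (∀ x y, k x y = k y x) ∧ ∀ v, 0 ≤ kernelForm k v v := by
  unfold IsPSD Matrix.PosSemidef
  refine and_congr ?_ (forall_congr' fun v => ?_)
  · rw [Matrix.IsHermitian.ext_iff]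
    simp only [Matrix.of_apply, star_trivial]
    exact ⟨fun h x y => h y x, fun h x y => h y x⟩
  · simp only [kernelForm, Matrix.of_apply, star_trivial]
    simp only [mul_right_comm]

theorem IsPSD.symm (hk : IsPSD k) (x y : X) : k x y = k y x := (isPSD_iff.1 hk).1 x y

theorem IsPSD.nonneg (hk : IsPSD k) (v : X →₀ ℝ) : 0 ≤ kernelForm k v v := (isPSD_iff.1 hk).2 v

theorem IsPSD.posSemidef (hk : IsPSD k) : (kernelMatrix k).PosSemidef :=
  posSemidef_kernelMatrix hk.symm hk.nonneg

theorem isPSD_congr (h : ∀ x y, k x y = m x y) : IsPSD k ↔ IsPSD m := by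
  rw [show k = m from funext fun x => funext fun y => h x y]

theorem IsPSD.add (hk : IsPSD k) (hm : IsPSD m) : IsPSD fun x y => k x y + m x y :=
  Matrix.PosSemidef.add hk hm

theorem IsPSD.mul (hk : IsPSD k) (hm : IsPSD m) : IsPSD fun x y => k x y * m x y :=
  Matrix.PosSemidef.hadamard hk hm

theorem IsPSD.smul (hk : IsPSD k) {c : ℝ} (hc : 0 ≤ c) : IsPSD fun x y => c * k x y :=
  Matrix.PosSemidef.smul hk hc

theorem IsPSD.comap (hk : IsPSD k) (f : Y → X) : IsPSD fun x y => k (f x) (f y) :=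
  Matrix.PosSemidef.submatrix hk f

theorem kernelForm_mul (g : X → ℝ) (v : X →₀ ℝ) :
    kernelForm (fun x y => g x * g y) v v = (v.sum fun x a => a * g x) ^ 2 := by
  simp only [kernelForm, Finsupp.sum, sq, Finset.sum_mul_sum]
  exact Finset.sum_congr rfl fun x _ => Finset.sum_congr rfl fun y _ => by ring

theorem isPSD_mul (g : X → ℝ) : IsPSD fun x y => g x * g y :=
  isPSD_iff.2 ⟨fun x y => mul_comm _ _, fun v => by rw [kernelForm_mul]; positivity⟩

theorem isPSD_one : IsPSD fun _ _ : X => (1 : ℝ) := by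
  simpa using isPSD_mul fun _ : X => (1 : ℝ)

theorem isPSD_zero : IsPSD fun _ _ : X => (0 : ℝ) := by
  simpa using isPSD_mul fun _ : X => (0 : ℝ)

theorem kernelForm_sub_kernel (v : X →₀ ℝ) :
    kernelForm (fun x y => m x y - k x y) v v = kernelForm m v v - kernelForm k v v := by
  simp only [kernelForm, Finsupp.sum, ← Finset.sum_sub_distrib, mul_sub]

theorem kernelForm_smul_kernel (c : ℝ) (v : X →₀ ℝ) :
    kernelForm (fun x y => c * k x y) v v = c * kernelForm k v v := by
  simp only [kernelForm, Finsupp.sum, Finset.mul_sum]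
  exact Finset.sum_congr rfl fun x _ => Finset.sum_congr rfl fun y _ => by ring

theorem isPSD_sub_iff (hk : IsPSD k) (hm : IsPSD m) {c : ℝ} :
    (IsPSD fun x y => c * m x y - k x y) ↔ ∀ v, kernelForm k v v ≤ c * kernelForm m v v := by
  have h : ∀ v, kernelForm (fun x y => c * m x y - k x y) v v
      = c * kernelForm m v v - kernelForm k v v := fun v => by
    rw [kernelForm_sub_kernel, kernelForm_smul_kernel]
  simp only [isPSD_iff, h, sub_nonneg]
  exact and_iff_right fun x y => by rw [hk.symm, hm.symm]

/-- The quadratic form of a kernel given by the features `F x ∈ L²(μ)`. -/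
theorem kernelForm_integral {α : Type*} [MeasurableSpace α] {μ : Measure α} {F : X → α → ℝ}
    (hF : ∀ x, MemLp (F x) 2 μ) (v : X →₀ ℝ) :
    kernelForm (fun x y => ∫ s, F x s * F y s ∂μ) v v
      = ∫ s, (v.sum fun x a => a * F x s) ^ 2 ∂μ := by
  have hint : ∀ x y, Integrable (fun s => F x s * F y s) μ := fun x y =>
    (hF x).integrable_mul (hF y)
  have h2 : ∀ s, (v.sum fun x a => a * F x s) ^ 2
      = ∑ x ∈ v.support, ∑ y ∈ v.support, v x * v y * (F x s * F y s) := by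
    intro s
    rw [Finsupp.sum, sq, Finset.sum_mul_sum]
    exact Finset.sum_congr rfl fun x _ => Finset.sum_congr rfl fun y _ => by ring
  simp_rw [h2]
  rw [integral_finsetSum _ fun x _ => integrable_finsetSum _ fun y _ => (hint x y).const_mul _]
  refine Finset.sum_congr rfl fun x _ => ?_
  rw [integral_finsetSum _ fun y _ => (hint x y).const_mul _]
  exact Finset.sum_congr rfl fun y _ => by rw [integral_const_mul]

theorem isPSD_integral {α : Type*} [MeasurableSpace α] {μ : Measure α} {F : X → α → ℝ}
    (hF : ∀ x, MemLp (F x) 2 μ) : IsPSD fun x y => ∫ s, F x s * F y s ∂μ :=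
  isPSD_iff.2 ⟨fun x y => by simp only [mul_comm], fun v => by
    rw [kernelForm_integral hF]
    exact integral_nonneg fun s => sq_nonneg _⟩

end PSD

section Prod

variable {d : ℕ} {Y : Fin d → Type*}

/-- Tensor products are monotone for the order of positive semidefinite kernels: by telescoping,
`∏ B - ∏ A` is a sum of Schur products of positive semidefinite kernels. -/
theorem isPSD_prod_sub_prod {A B : ∀ j, Y j → Y j → ℝ} (hA : ∀ j, IsPSD (A j))
    (hAB : ∀ j, IsPSD fun x y => B j x y - A j x y) :
    (IsPSD fun x y : ∀ j, Y j => ∏ j, A j (x j) (y j)) ∧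
      IsPSD fun x y : ∀ j, Y j => ∏ j, B j (x j) (y j) - ∏ j, A j (x j) (y j) := by
  suffices h : ∀ s : Finset (Fin d),
      (IsPSD fun x y : ∀ j, Y j => ∏ j ∈ s, A j (x j) (y j)) ∧
      IsPSD fun x y : ∀ j, Y j => ∏ j ∈ s, B j (x j) (y j) - ∏ j ∈ s, A j (x j) (y j) from
    h Finset.univ
  intro s
  induction s using Finset.induction_on with
  | empty => exact ⟨by simpa using isPSD_one, by simpa using isPSD_zero⟩
  | insert i s hi ih =>
    have hAi := (hA i).comap fun x : ∀ j, Y j => x i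
    have hDi := (hAB i).comap fun x : ∀ j, Y j => x i
    have hBi := hDi.add hAi
    refine ⟨(isPSD_congr fun x y => ?_).1 (hAi.mul ih.1),
      (isPSD_congr fun x y => ?_).1 ((hDi.mul ih.1).add (hBi.mul ih.2))⟩
    · rw [Finset.prod_insert hi]
    · rw [Finset.prod_insert hi, Finset.prod_insert hi]
      ring

theorem isPSD_prod {A : ∀ j, Y j → Y j → ℝ} (hA : ∀ j, IsPSD (A j)) :
    IsPSD fun x y : ∀ j, Y j => ∏ j, A j (x j) (y j) :=
  (isPSD_prod_sub_prod (B := A) hA fun j => by simpa using isPSD_zero).1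

theorem kernelForm_prod_le {A B : ∀ j, Y j → Y j → ℝ} {C : Fin d → ℝ} (hA : ∀ j, IsPSD (A j))
    (hB : ∀ j, IsPSD (B j)) (hAB : ∀ j, IsPSD fun x y => C j * B j x y - A j x y)
    (v : (∀ j, Y j) →₀ ℝ) :
    kernelForm (fun x y => ∏ j, A j (x j) (y j)) v v
      ≤ (∏ j, C j) * kernelForm (fun x y => ∏ j, B j (x j) (y j)) v v := by
  have h := isPSD_prod_sub_prod hA hAB
  refine (isPSD_sub_iff h.1 (isPSD_prod hB)).1 ((isPSD_congr fun x y => ?_).1 h.2) v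
  rw [Finset.prod_mul_distrib]

end Prod

/-! ### Reproducing kernel Hilbert spaces -/

section RKHS

open RealInnerProductSpace

variable {X : Type*} (k : X → X → ℝ) [Fact (kernelMatrix k).PosSemidef]

/-- The kernel section `k(·, x)` as an element of the RKHS of `k`. -/
def kerSection (x : X) : RKHS.OfKernel (kernelMatrix k) := RKHS.kerFun _ x (1 : ℝ)

/-- The linear combination `∑ v x k(·, x)` as an element of the RKHS of `k`. -/
def kerSum : (X →₀ ℝ) →ₗ[ℝ] RKHS.OfKernel (kernelMatrix k) :=
  Finsupp.linearCombination ℝ (kerSection k)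

variable {k}

theorem inner_kerSection (x : X) (h : RKHS.OfKernel (kernelMatrix k)) :
    ⟪kerSection k x, h⟫ = h x := by
  simp [kerSection]

theorem inner_kerSection_kerSection (x y : X) : ⟪kerSection k x, kerSection k y⟫ = k x y := by
  rw [inner_kerSection, kerSection, RKHS.kerFun_apply, RKHS.OfKernel.kernel_ofKernel]
  simp [kernelMatrix]

theorem inner_kerSum (v : X →₀ ℝ) (h : RKHS.OfKernel (kernelMatrix k)) :
    ⟪kerSum k v, h⟫ = v.sum fun x a => a * h x := by
  rw [kerSum, Finsupp.linearCombination_apply, Finsupp.sum_inner]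
  simp [inner_kerSection, inner_smul_left]

theorem kerSum_apply (v : X →₀ ℝ) (x : X) : kerSum k v x = v.sum fun y a => a * k x y := by
  rw [← inner_kerSection, real_inner_comm, kerSum, Finsupp.linearCombination_apply,
    Finsupp.sum_inner]
  refine Finset.sum_congr rfl fun y _ => ?_
  beta_reduce
  rw [inner_smul_left, real_inner_comm, inner_kerSection_kerSection]
  simp

theorem inner_kerSum_kerSum (v w : X →₀ ℝ) :
    ⟪kerSum k v, kerSum k w⟫ = kernelForm k v w := by
  rw [inner_kerSum, kernelForm]
  refine Finset.sum_congr rfl fun x _ => ?_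
  beta_reduce
  rw [kerSum_apply, Finsupp.mul_sum]
  exact Finset.sum_congr rfl fun y _ => by ring

theorem norm_kerSum_sq (v : X →₀ ℝ) : ‖kerSum k v‖ ^ 2 = kernelForm k v v := by
  rw [← real_inner_self_eq_norm_sq, inner_kerSum_kerSum]

theorem denseRange_kerSum : DenseRange (kerSum k) := by
  have h := RKHS.kerFun_dense (H := RKHS.OfKernel (kernelMatrix k))
  have h2 : Submodule.span ℝ {z | ∃ (x : X) (v : ℝ),
      RKHS.kerFun (RKHS.OfKernel (kernelMatrix k)) x v = z} ≤ LinearMap.range (kerSum k) := by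
    rw [Submodule.span_le]
    rintro _ ⟨x, v, rfl⟩
    refine ⟨Finsupp.single x v, ?_⟩
    rw [kerSum, Finsupp.linearCombination_single, kerSection, ← map_smul]
    simp
  have h3 : Dense (LinearMap.range (kerSum k) : Set (RKHS.OfKernel (kernelMatrix k))) := by
    refine Dense.mono h2 ?_
    rw [dense_iff_closure_eq]
    exact congrArg SetLike.coe h
  rwa [LinearMap.coe_range] at h3

/-- An element of the RKHS is bounded, as a functional on the span of the kernel sections, by its
norm. -/
theorem sum_mul_sq_le_norm (h : RKHS.OfKernel (kernelMatrix k)) (v : X →₀ ℝ) :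
    (v.sum fun x a => a * h x) ^ 2 ≤ ‖h‖ ^ 2 * kernelForm k v v := by
  rw [← inner_kerSum, ← norm_kerSum_sq, ← mul_pow, mul_comm]
  exact sq_le_sq' (neg_le_of_abs_le (abs_real_inner_le_norm _ _)) (real_inner_le_norm _ _)

/-- A function which is bounded as a functional on the span of the kernel sections lies in the RKHS:
extend the functional to the completion and take its Riesz representer. -/
theorem exists_rkhs_of_sum_mul_sq_le {f : X → ℝ} {M : ℝ} (hM : 0 ≤ M)
    (hf : ∀ v : X →₀ ℝ, (v.sum fun x a => a * f x) ^ 2 ≤ M ^ 2 * kernelForm k v v) :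
    ∃ h : RKHS.OfKernel (kernelMatrix k), ⇑h = f ∧ ‖h‖ ≤ M := by
  let l : (X →₀ ℝ) →ₗ[ℝ] ℝ := Finsupp.linearCombination ℝ f
  have hl : ∀ v, l v = v.sum fun x a => a * f x := fun v => by
    simp [l, Finsupp.linearCombination_apply]
  have hb : ∀ v, ‖l v‖ ≤ M * ‖kerSum k v‖ := fun v => by
    rw [hl, Real.norm_eq_abs]
    refine abs_le_of_sq_le_sq ?_ (by positivity)
    rw [mul_pow, norm_kerSum_sq]
    exact hf v
  let L : RKHS.OfKernel (kernelMatrix k) →L[ℝ] ℝ := l.extendOfNorm (kerSum k)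
  refine ⟨(InnerProductSpace.toDual ℝ _).symm L, ?_, ?_⟩
  · funext x
    rw [← inner_kerSection, real_inner_comm, InnerProductSpace.toDual_symm_apply]
    have h1 : kerSection k x = kerSum k (Finsupp.single x 1) := by simp [kerSum]
    rw [h1]
    have h2 : L (kerSum k (Finsupp.single x 1)) = l (Finsupp.single x 1) :=
      LinearMap.extendOfNorm_eq denseRange_kerSum ⟨M, hb⟩ _
    rw [h2]
    simp [l]
  · rw [LinearIsometryEquiv.norm_map]
    exact LinearMap.opNorm_extendOfNorm_le denseRange_kerSum hM hb

end RKHS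

section CauchySchwarz

variable {X : Type*} {k : X → X → ℝ}

/-- Cauchy–Schwarz for the form of a positive semidefinite kernel. -/
theorem kernelForm_sq_le (hk : IsPSD k) (v w : X →₀ ℝ) :
    kernelForm k v w ^ 2 ≤ kernelForm k v v * kernelForm k w w := by
  have : Fact (kernelMatrix k).PosSemidef := ⟨hk.posSemidef⟩
  rw [← inner_kerSum_kerSum, ← norm_kerSum_sq, ← norm_kerSum_sq, ← mul_pow]
  exact sq_le_sq' (neg_le_of_abs_le (abs_real_inner_le_norm _ _)) (real_inner_le_norm _ _)

theorem sum_mul_kernel_sq_le (hk : IsPSD k) (v : X →₀ ℝ) (z : X) :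
    (v.sum fun x a => a * k x z) ^ 2 ≤ kernelForm k v v * k z z := by
  have h := kernelForm_sq_le hk v (Finsupp.single z 1)
  simpa [kernelForm] using h

end CauchySchwarz

/-! ### Comparison of function spaces -/

section FnSpace

variable {X : Type*}

/-- Continuous inclusion of function spaces. -/
def FnSpace.Embeds (A B : FnSpace X) : Prop :=
  ∃ C : ℝ, 0 < C ∧ ∀ f ∈ A.carrier, f ∈ B.carrier ∧ B.norm f ≤ C * A.norm f

theorem FnSpace.Embeds.trans {A B D : FnSpace X} (h : A.Embeds B) (h' : B.Embeds D) :
    A.Embeds D := by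
  obtain ⟨C, hC, h⟩ := h
  obtain ⟨C', hC', h'⟩ := h'
  refine ⟨C' * C, by positivity, fun f hf => ⟨(h' f (h f hf).1).1, ?_⟩⟩
  calc D.norm f ≤ C' * B.norm f := (h' f (h f hf).1).2
    _ ≤ C' * (C * A.norm f) := mul_le_mul_of_nonneg_left (h f hf).2 hC'.le
    _ = C' * C * A.norm f := by ring

theorem FnSpace.Embeds.equivalent {A B : FnSpace X} (h : A.Embeds B) (h' : B.Embeds A) :
    A.Equivalent B := by
  obtain ⟨C, hC, h⟩ := h
  obtain ⟨C', hC', h'⟩ := h'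
  refine ⟨Set.Subset.antisymm (fun f hf => (h f hf).1) fun f hf => (h' f hf).1,
    C'⁻¹, C, by positivity, hC, fun f hf => ⟨?_, (h f hf).2⟩⟩
  rw [inv_mul_le_iff₀ hC']
  exact (h' f (h f hf).1).2

variable {k m : X → X → ℝ}

theorem rkhs_norm_coe [Fact (kernelMatrix k).PosSemidef] (hk : (kernelMatrix k).PosSemidef)
    (h : RKHS.OfKernel (kernelMatrix k)) : (rkhs k hk).norm ⇑h = ‖h‖ := by
  have : {r | ∃ h' : RKHS.OfKernel (kernelMatrix k), ⇑h' = ⇑h ∧ ‖h'‖ = r} = {‖h‖} := by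
    ext r
    simp only [Set.mem_ofPred_eq, Set.mem_singleton_iff]
    constructor
    · rintro ⟨h', h1, rfl⟩
      rw [DFunLike.coe_injective h1]
    · rintro rfl
      exact ⟨h, rfl, rfl⟩
  change sInf {r | ∃ h' : RKHS.OfKernel (kernelMatrix k), ⇑h' = ⇑h ∧ ‖h'‖ = r} = ‖h‖
  rw [this, csInf_singleton]

/-- Membership in an RKHS, with a bound for the norm, from a bound for the functional
`v ↦ ∑ v x f x` by the quadratic form of the kernel. -/
theorem mem_rkhs_of_sum_mul_sq_le (hk : (kernelMatrix k).PosSemidef) {f : X → ℝ} {M : ℝ}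
    (hM : 0 ≤ M)
    (hf : ∀ v : X →₀ ℝ, (v.sum fun x a => a * f x) ^ 2 ≤ M ^ 2 * kernelForm k v v) :
    f ∈ (rkhs k hk).carrier ∧ (rkhs k hk).norm f ≤ M := by
  have : Fact (kernelMatrix k).PosSemidef := ⟨hk⟩
  obtain ⟨h, rfl, hn⟩ := exists_rkhs_of_sum_mul_sq_le hM hf
  exact ⟨⟨h, rfl⟩, by rwa [rkhs_norm_coe]⟩

/-- Aronszajn's comparison: if `k ≤ C m` as positive semidefinite kernels, then the RKHS of `k` is
contained in that of `m`. -/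
theorem rkhs_embeds_of_le (hk : (kernelMatrix k).PosSemidef) (hm : (kernelMatrix m).PosSemidef)
    {C : ℝ} (hC : 0 < C) (hle : ∀ v, kernelForm k v v ≤ C * kernelForm m v v) :
    (rkhs k hk).Embeds (rkhs m hm) := by
  have : Fact (kernelMatrix k).PosSemidef := ⟨hk⟩
  refine ⟨√C, by positivity, ?_⟩
  rintro _ ⟨h, rfl⟩
  simp only [rkhs_norm_coe]
  refine mem_rkhs_of_sum_mul_sq_le hm (by positivity) fun v => ?_
  refine (sum_mul_sq_le_norm h v).trans ?_
  rw [mul_pow, Real.sq_sqrt hC.le]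
  nlinarith [hle v, sq_nonneg ‖h‖]

end FnSpace

/-! ### Domination of kernels -/

section Dominated

variable {X Y : Type*} {k m n : X → X → ℝ}

/-- `k ≤ C m` as positive semidefinite kernels, for some constant `C > 0`. -/
def Dominated (k m : X → X → ℝ) : Prop :=
  ∃ C : ℝ, 0 < C ∧ IsPSD fun x y => C * m x y - k x y

theorem Dominated.trans (h : Dominated k m) (h' : Dominated m n) : Dominated k n := by
  obtain ⟨C, hC, h⟩ := h
  obtain ⟨C', hC', h'⟩ := h'
  refine ⟨C * C', by positivity, (isPSD_congr fun x y => ?_).1 (h.add (h'.smul hC.le))⟩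
  ring

theorem Dominated.mul_left (h : Dominated k m) (hn : IsPSD n) :
    Dominated (fun x y => n x y * k x y) fun x y => n x y * m x y := by
  obtain ⟨C, hC, h⟩ := h
  refine ⟨C, hC, (isPSD_congr fun x y => ?_).1 (hn.mul h)⟩
  ring

theorem Dominated.comap (h : Dominated k m) (f : Y → X) :
    Dominated (fun x y => k (f x) (f y)) fun x y => m (f x) (f y) := by
  obtain ⟨C, hC, h⟩ := h
  exact ⟨C, hC, h.comap f⟩

theorem Dominated.smul (h : Dominated k m) {a b : ℝ} (ha : 0 < a) (hb : 0 < b) :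
    Dominated (fun x y => a * k x y) fun x y => b * m x y := by
  obtain ⟨C, hC, h⟩ := h
  refine ⟨a * C / b, by positivity, (isPSD_congr fun x y => ?_).1 (h.smul ha.le)⟩
  field_simp

theorem kernelForm_add_single (hk : IsPSD k) (v : X →₀ ℝ) (z : X) (a : ℝ) :
    kernelForm k (v + Finsupp.single z a) (v + Finsupp.single z a)
      = kernelForm k v v + 2 * a * (v.sum fun x b => b * k x z) + a ^ 2 * k z z := by
  have hadd : ∀ (u v w : X →₀ ℝ), kernelForm k (u + v) w = kernelForm k u w + kernelForm k v w := by
    intro u v w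
    unfold kernelForm
    rw [Finsupp.sum_add_index']
    · simp
    · intro x a b
      rw [← Finsupp.sum_add]
      exact Finset.sum_congr rfl fun y _ => by ring
  have hsymm : ∀ u v : X →₀ ℝ, kernelForm k u v = kernelForm k v u := by
    intro u v
    unfold kernelForm
    rw [Finsupp.sum_comm]
    refine Finset.sum_congr rfl fun x _ => Finset.sum_congr rfl fun y _ => ?_
    beta_reduce
    rw [hk.symm]
    ring
  have h1 : kernelForm k v (Finsupp.single z a) = a * (v.sum fun x b => b * k x z) := by
    simp only [kernelForm, Finsupp.mul_sum]
    refine Finset.sum_congr rfl fun x _ => ?_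
    simp
    ring
  have h2 : kernelForm k (Finsupp.single z a) (Finsupp.single z a) = a ^ 2 * k z z := by
    unfold kernelForm
    rw [Finsupp.sum_single_index (by simp), Finsupp.sum_single_index (by simp)]
    ring
  have hadd' : ∀ u v w : X →₀ ℝ, kernelForm k u (v + w) = kernelForm k u v + kernelForm k u w :=
    fun u v w => by rw [hsymm, hadd, hsymm v, hsymm w]
  rw [hadd, hadd', hadd', hsymm (Finsupp.single z a) v, h1, h2]
  ring

/-- The kernel `k` conditioned on the value at `z`. -/
def condKernel (k : X → X → ℝ) (z x y : X) : ℝ := k x y - k x z * k y z / k z z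

theorem kernelForm_condKernel (z : X) (v : X →₀ ℝ) :
    kernelForm (condKernel k z) v v
      = kernelForm k v v - (v.sum fun x b => b * k x z) ^ 2 / k z z := by
  unfold condKernel
  rw [kernelForm_sub_kernel, ← kernelForm_mul, div_eq_inv_mul, ← kernelForm_smul_kernel]
  simp only [div_eq_inv_mul]

/-- Conditioning is monotone: the quadratic form of the conditioned kernel at `v` is the minimum of
the quadratic form of `k` over the vectors `v + a δ_z`. -/
theorem Dominated.condKernel (h : Dominated k m) (hk : IsPSD k) (hm : IsPSD m) {z : X}
    (hkz : 0 < k z z) (hmz : 0 < m z z) : Dominated (condKernel k z) (condKernel m z) := by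
  obtain ⟨C, hC, h⟩ := h
  refine ⟨C, hC, isPSD_iff.2 ⟨fun x y => ?_, fun v => ?_⟩⟩
  · simp only [BdryGP.condKernel, hk.symm x y, hm.symm x y, mul_comm (k x z), mul_comm (m x z)]
  rw [kernelForm_sub_kernel, kernelForm_smul_kernel, kernelForm_condKernel, kernelForm_condKernel]
  have h1 := (isPSD_sub_iff hk hm).1 h
  set B := v.sum fun x b => b * k x z with hB
  set D := v.sum fun x b => b * m x z with hD
  -- the coefficient `-D / m z z` minimizes the quadratic form of `m`
  have h2 := h1 (v + Finsupp.single z (-D / m z z))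
  rw [kernelForm_add_single hk, kernelForm_add_single hm, ← hB, ← hD] at h2
  have h3 : kernelForm k v v - B ^ 2 / k z z ≤
      kernelForm k v v + 2 * (-D / m z z) * B + (-D / m z z) ^ 2 * k z z := by
    have : 0 ≤ (B + (-D / m z z) * k z z) ^ 2 / k z z := by positivity
    have h4 : (B + (-D / m z z) * k z z) ^ 2 / k z z
        = B ^ 2 / k z z + 2 * (-D / m z z) * B + (-D / m z z) ^ 2 * k z z := by
      field_simp
      ring
    linarith
  have h5 : kernelForm m v v + 2 * (-D / m z z) * D + (-D / m z z) ^ 2 * m z z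
      = kernelForm m v v - D ^ 2 / m z z := by
    field_simp
    ring
  rw [h5] at h2
  linarith

end Dominated

/-! ### The one-dimensional Brownian and BdryMatérn kernels -/

section OneDim

theorem memLp_indicator_Ioc (a b : ℝ) : MemLp ((Set.Ioc a b).indicator (1 : ℝ → ℝ)) 2 :=
  memLp_indicator_const 2 measurableSet_Ioc 1 (Or.inr (by simp))

theorem isPSD_min {X : Type*} {τ : X → ℝ} (hτ : ∀ x, 0 ≤ τ x) :
    IsPSD fun x y => min (τ x) (τ y) := by
  simp_rw [min_eq_integral (hτ _) (hτ _)]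
  exact isPSD_integral fun x => memLp_indicator_Ioc 0 (τ x)

/-- A time change with larger increments gives a larger kernel: the difference of the kernels
`min ∘ τ'` and `min ∘ τ` is `min ∘ (τ' - τ)`. -/
theorem isPSD_sub_min {τ τ' : unitInterval → ℝ} (hτ : Monotone τ)
    (hτ' : Monotone τ') (h0 : 0 ≤ τ' 0 - τ 0) (hmono : Monotone fun t => τ' t - τ t) :
    IsPSD fun s t => min (τ' s) (τ' t) - min (τ s) (τ t) := by
  refine (isPSD_congr fun s t => ?_).1
    (isPSD_min (τ := fun t => τ' t - τ t) fun t => h0.trans (hmono t.2.1))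
  rcases le_total s t with h | h
  · rw [min_eq_left (hτ h), min_eq_left (hτ' h), min_eq_left (hmono h)]
  · rw [min_eq_right (hτ h), min_eq_right (hτ' h), min_eq_right (hmono h)]

theorem kernelForm_mul_mul_min (g : ℝ → ℝ) (v : unitInterval →₀ ℝ) :
    kernelForm (fun s t : unitInterval => g s * g t * min (s : ℝ) t) v v
      = ∫ u in Set.Ioc (0 : ℝ) 1,
        (v.sum fun s a => a * (g s * (Set.Ioc 0 (s : ℝ)).indicator 1 u)) ^ 2 := by
  have hF : ∀ s : unitInterval, MemLp
      (fun u => g s * (Set.Ioc 0 (s : ℝ)).indicator 1 u) 2 (volume.restrict (Set.Ioc 0 1)) :=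
    fun s => ((memLp_indicator_Ioc 0 s).restrict _).const_mul (g s)
  rw [← kernelForm_integral hF]
  congr 1
  funext s t
  have h : ∀ u : ℝ, g s * (Set.Ioc 0 (s : ℝ)).indicator 1 u
      * (g t * (Set.Ioc 0 (t : ℝ)).indicator 1 u)
      = g s * g t * ((Set.Ioc 0 (s : ℝ)).indicator 1 u * (Set.Ioc 0 (t : ℝ)).indicator 1 u) :=
    fun u => by ring
  simp_rw [h]
  rw [integral_const_mul, min_eq_integral s.2.1 t.2.1,
    setIntegral_eq_integral_of_forall_compl_eq_zero]
  intro u hu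
  rw [Set.indicator_of_notMem, zero_mul]
  exact fun hu' => hu ⟨hu'.1, hu'.2.trans s.2.2⟩

/-- Multiplication by a `C¹` function is bounded for the kernel `min s t`: with
`V u = ∑ v s 1_{u ≤ s}`, partial summation gives
`∑ v s g s 1_{u ≤ s} = g u * V u + ∫_u^1 g' V`. -/
theorem dominated_mul_min {g g' : ℝ → ℝ} (hg : ∀ x, HasDerivAt g (g' x) x) (hg' : Continuous g') :
    Dominated (fun s t : unitInterval => g s * g t * min (s : ℝ) t)
      fun s t => min (s : ℝ) t := by
  have hgc : Continuous g := continuous_iff_continuousAt.2 fun x => (hg x).continuousAt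
  obtain ⟨M, hM⟩ := (isCompact_Icc (a := (0 : ℝ)) (b := 1)).exists_bound_of_continuousOn
    hgc.continuousOn
  obtain ⟨M', hM'⟩ := (isCompact_Icc (a := (0 : ℝ)) (b := 1)).exists_bound_of_continuousOn
    hg'.continuousOn
  have hmin : IsPSD fun s t : unitInterval => min (s : ℝ) t := isPSD_min fun s => s.2.1
  refine ⟨2 * M ^ 2 + 2 * M' ^ 2 + 1, by positivity, ?_⟩
  rw [isPSD_sub_iff ((isPSD_mul fun s : unitInterval => g s).mul hmin) hmin]
  intro v
  have h1 := kernelForm_mul_mul_min (fun _ => 1) v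
  simp only [one_mul] at h1
  rw [kernelForm_mul_mul_min, h1]
  set V : ℝ → ℝ := fun u => v.sum fun s a => a * (Set.Ioc 0 (s : ℝ)).indicator 1 u with hV
  set μ := (volume : Measure ℝ).restrict (Set.Ioc 0 1) with hμ
  have : IsProbabilityMeasure μ := ⟨by simp [hμ]⟩
  have hVL : MemLp V 2 μ :=
    memLp_finsetSum _ fun s _ => ((memLp_indicator_Ioc 0 (s : ℝ)).restrict _).const_mul (v s)
  have hVi : Integrable V μ := hVL.integrable (by norm_num)
  have hVi2 : Integrable (fun u => V u ^ 2) μ := hVL.integrable_sq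
  have hA : (∫ u, |V u| ∂μ) ^ 2 ≤ ∫ u, V u ^ 2 ∂μ := by
    set A := ∫ u, |V u| ∂μ with hA
    have h0 : 0 ≤ ∫ u, (|V u| - A) ^ 2 ∂μ := integral_nonneg fun u => sq_nonneg _
    have h2 : ∫ u, (|V u| - A) ^ 2 ∂μ = (∫ u, V u ^ 2 ∂μ) - A ^ 2 := by
      have : ∀ u, (|V u| - A) ^ 2 = V u ^ 2 - 2 * A * |V u| + A ^ 2 := fun u => by
        rw [sub_sq, sq_abs]; ring
      have hi : Integrable (fun u => V u ^ 2 - 2 * A * |V u|) μ := hVi2.sub (hVi.abs.const_mul _)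
      simp_rw [this]
      rw [integral_add hi (integrable_const _),
        integral_sub hVi2 (hVi.abs.const_mul _), integral_const_mul, ← hA]
      simp
      ring
    linarith
  have hgV : Integrable (fun r => g' r * V r) μ := by
    refine hVi.bdd_mul (c := M') hg'.aestronglyMeasurable ?_
    filter_upwards [ae_restrict_mem measurableSet_Ioc] with r hr
    exact hM' r ⟨hr.1.le, hr.2⟩
  have hrep : ∀ u ∈ Set.Ioc (0 : ℝ) 1,
      (v.sum fun s a => a * (g s * (Set.Ioc 0 (s : ℝ)).indicator 1 u))
        = g u * V u + ∫ r in u..1, g' r * V r := by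
    intro u hu
    have h2 : ∀ s : unitInterval, g s * (Set.Ioc 0 (s : ℝ)).indicator 1 u
        = g u * (Set.Ioc 0 (s : ℝ)).indicator 1 u
          + ∫ r in u..1, g' r * (Set.Ioc 0 (s : ℝ)).indicator 1 r := by
      intro s
      have h3 : ∀ a b : ℝ, ∫ r in a..b, g' r = g b - g a := fun a b =>
        intervalIntegral.integral_eq_sub_of_hasDerivAt (fun x _ => hg x)
          (hg'.intervalIntegrable _ _)
      by_cases hs : u ≤ s
      · have e1 : ∫ r in u..1, g' r * (Set.Ioc 0 (s : ℝ)).indicator 1 r = ∫ r in u..s, g' r := by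
          rw [intervalIntegral.integral_of_le hu.2, intervalIntegral.integral_of_le hs]
          have : ∀ r, g' r * (Set.Ioc 0 (s : ℝ)).indicator 1 r
              = (Set.Ioc 0 (s : ℝ)).indicator g' r := fun r => by
            simp [Set.indicator]
          simp_rw [this]
          rw [setIntegral_indicator measurableSet_Ioc, Set.Ioc_inter_Ioc,
            max_eq_left hu.1.le, min_eq_right s.2.2]
        rw [e1, h3, Set.indicator_of_mem (show u ∈ Set.Ioc 0 (s : ℝ) from ⟨hu.1, hs⟩)]
        simp
      · have e1 : ∫ r in u..1, g' r * (Set.Ioc 0 (s : ℝ)).indicator 1 r = 0 := by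
          rw [intervalIntegral.integral_of_le hu.2]
          refine setIntegral_eq_zero_of_forall_eq_zero fun r hr => ?_
          rw [Set.indicator_of_notMem, mul_zero]
          exact fun hr' => hs (hr.1.le.trans hr'.2)
        rw [e1, Set.indicator_of_notMem (fun hr' => hs hr'.2)]
        simp
    have h4 : ∫ r in u..1, g' r * V r
        = v.sum fun s a => a * ∫ r in u..1, g' r * (Set.Ioc 0 (s : ℝ)).indicator 1 r := by
      have : ∀ r, g' r * V r
          = ∑ s ∈ v.support, v s * (g' r * (Set.Ioc 0 (s : ℝ)).indicator 1 r) := fun r => by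
        simp only [hV, Finsupp.sum, Finset.mul_sum]
        exact Finset.sum_congr rfl fun s _ => by ring
      simp_rw [this]
      rw [intervalIntegral.integral_finsetSum]
      · simp only [Finsupp.sum, intervalIntegral.integral_const_mul]
      · intro s _
        refine IntervalIntegrable.const_mul ?_ _
        rw [intervalIntegrable_iff]
        have : IsFiniteMeasure (volume.restrict (Set.uIoc u 1)) := ⟨by simp [Set.uIoc]⟩
        have hi : Integrable ((Set.Ioc 0 (s : ℝ)).indicator (1 : ℝ → ℝ))
            (volume.restrict (Set.uIoc u 1)) :=
          ((memLp_indicator_Ioc 0 (s : ℝ)).restrict _).integrable (by norm_num)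
        refine hi.bdd_mul (c := M') hg'.aestronglyMeasurable ?_
        filter_upwards [ae_restrict_mem measurableSet_uIoc] with r hr
        rw [Set.uIoc_of_le hu.2] at hr
        exact hM' r ⟨hu.1.le.trans hr.1.le, hr.2⟩
    rw [h4]
    simp only [hV, Finsupp.sum, Finset.mul_sum, ← Finset.sum_add_distrib]
    refine Finset.sum_congr rfl fun s _ => ?_
    rw [h2]
    ring
  have hbound : ∀ u ∈ Set.Ioc (0 : ℝ) 1,
      (v.sum fun s a => a * (g s * (Set.Ioc 0 (s : ℝ)).indicator 1 u)) ^ 2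
        ≤ 2 * M ^ 2 * V u ^ 2 + 2 * M' ^ 2 * ∫ r, V r ^ 2 ∂μ := by
    intro u hu
    rw [hrep u hu]
    have h5 : |∫ r in u..1, g' r * V r| ≤ M' * ∫ r, |V r| ∂μ := by
      rw [intervalIntegral.integral_of_le hu.2]
      calc |∫ r in Set.Ioc u 1, g' r * V r| ≤ ∫ r in Set.Ioc u 1, |g' r * V r| :=
            abs_integral_le_integral_abs
        _ ≤ ∫ r, |g' r * V r| ∂μ :=
            setIntegral_mono_set hgV.abs (Eventually.of_forall fun r => abs_nonneg _)
              (Set.Ioc_subset_Ioc_left hu.1.le).eventuallyLE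
        _ ≤ ∫ r, M' * |V r| ∂μ := by
            refine integral_mono_ae hgV.abs (hVi.abs.const_mul _) ?_
            filter_upwards [ae_restrict_mem measurableSet_Ioc] with r hr
            rw [abs_mul]
            exact mul_le_mul_of_nonneg_right (hM' r ⟨hr.1.le, hr.2⟩) (abs_nonneg _)
        _ = M' * ∫ r, |V r| ∂μ := integral_const_mul _ _
    have h6 : (∫ r in u..1, g' r * V r) ^ 2 ≤ M' ^ 2 * ∫ r, V r ^ 2 ∂μ :=
      calc (∫ r in u..1, g' r * V r) ^ 2 ≤ (M' * ∫ r, |V r| ∂μ) ^ 2 := sq_le_sq' (by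
            linarith [neg_le_of_abs_le h5]) (le_of_abs_le h5)
        _ = M' ^ 2 * (∫ r, |V r| ∂μ) ^ 2 := by ring
        _ ≤ _ := mul_le_mul_of_nonneg_left hA (sq_nonneg _)
    have h7 : g u ^ 2 ≤ M ^ 2 := sq_le_sq' (neg_le_of_abs_le (hM u ⟨hu.1.le, hu.2⟩))
      (le_of_abs_le (hM u ⟨hu.1.le, hu.2⟩))
    nlinarith [sq_nonneg (g u * V u - ∫ r in u..1, g' r * V r),
      mul_le_mul_of_nonneg_right h7 (sq_nonneg (V u))]
  calc _ ≤ ∫ u, (2 * M ^ 2 * V u ^ 2 + 2 * M' ^ 2 * ∫ r, V r ^ 2 ∂μ) ∂μ := by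
        refine integral_mono_of_nonneg (Eventually.of_forall fun u => sq_nonneg _)
          ((hVi2.const_mul _).add (integrable_const _)) ?_
        filter_upwards [ae_restrict_mem measurableSet_Ioc] with u hu using hbound u hu
    _ = (2 * M ^ 2 + 2 * M' ^ 2) * ∫ r, V r ^ 2 ∂μ := by
        rw [integral_add (hVi2.const_mul _) (integrable_const _), integral_const_mul]
        simp
        ring
    _ ≤ _ := by
        have : 0 ≤ ∫ r, V r ^ 2 ∂μ := integral_nonneg fun r => sq_nonneg _
        nlinarith

/-- The BdryMatérn kernel with known left boundary. -/
def leftMatern (w : ℝ) (s t : unitInterval) : ℝ :=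
  Real.sinh (w * min (s : ℝ) t) * Real.exp (w * (-max (s : ℝ) t))

/-- `e^{2wt} - 1` is a time change: it turns the left BdryMatérn kernel into a rescaled Brownian
kernel. -/
theorem leftMatern_eq {w : ℝ} (hw : 0 < w) (s t : unitInterval) :
    leftMatern w s t = Real.exp (-w * s) * Real.exp (-w * t)
      * min ((Real.exp (2 * w * s) - 1) / 2) ((Real.exp (2 * w * t) - 1) / 2) := by
  have key : ∀ s t : unitInterval, s ≤ t → leftMatern w s t = Real.exp (-w * s) * Real.exp (-w * t)
      * min ((Real.exp (2 * w * s) - 1) / 2) ((Real.exp (2 * w * t) - 1) / 2) := by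
    intro s t h
    have h' : (s : ℝ) ≤ t := h
    have hexp : Real.exp (2 * w * s) ≤ Real.exp (2 * w * t) := Real.exp_le_exp.2 (by nlinarith)
    rw [leftMatern, min_eq_left h', max_eq_right h', min_eq_left (by linarith), Real.sinh_eq]
    have h1 : Real.exp (2 * w * s) = Real.exp (w * s) * Real.exp (w * s) := by
      rw [← Real.exp_add]; ring_nf
    have h2 : Real.exp (-w * s) * Real.exp (w * s) = 1 := by
      rw [← Real.exp_add]; simp
    rw [h1, show w * -(t : ℝ) = -w * t by ring, show -(w * (s : ℝ)) = -w * s by ring]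
    linear_combination (-Real.exp (-w * t) * Real.exp (w * s) / 2) * h2
  rcases le_total s t with h | h
  · exact key s t h
  · have hsymm : leftMatern w s t = leftMatern w t s := by
      rw [leftMatern, leftMatern, min_comm, max_comm]
    rw [hsymm, key t s h, min_comm]
    ring

theorem isPSD_leftMatern {w : ℝ} (hw : 0 < w) : IsPSD (leftMatern w) := by
  refine (isPSD_congr (leftMatern_eq hw)).2 ((isPSD_mul _).mul (isPSD_min fun t => ?_))
  have : 1 ≤ Real.exp (2 * w * t) := Real.one_le_exp (by have := t.2.1; positivity)
  linarith

theorem exp_sub_exp_bounds {w : ℝ} (hw : 0 < w) {s t : ℝ} (hs : 0 ≤ s) (hst : s ≤ t)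
    (ht : t ≤ 1) : w * (t - s) ≤ (Real.exp (2 * w * t) - Real.exp (2 * w * s)) / 2 ∧
      (Real.exp (2 * w * t) - Real.exp (2 * w * s)) / 2 ≤ w * Real.exp (2 * w) * (t - s) := by
  have hd : 0 ≤ 2 * w * (t - s) := by have := sub_nonneg.2 hst; positivity
  constructor
  · have h1 : Real.exp (2 * w * t) = Real.exp (2 * w * s) * Real.exp (2 * w * (t - s)) := by
      rw [← Real.exp_add]; ring_nf
    have h2 : 1 ≤ Real.exp (2 * w * s) := Real.one_le_exp (by positivity)
    have h3 := Real.add_one_le_exp (2 * w * (t - s))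
    rw [h1]
    nlinarith
  · have h1 : Real.exp (2 * w * s) = Real.exp (2 * w * t) * Real.exp (-(2 * w * (t - s))) := by
      rw [← Real.exp_add]; ring_nf
    have h2 : Real.exp (2 * w * t) ≤ Real.exp (2 * w) := Real.exp_le_exp.2 (by nlinarith)
    have h3 := Real.add_one_le_exp (-(2 * w * (t - s)))
    have h4 := Real.exp_pos (2 * w * t)
    rw [h1]
    nlinarith [mul_le_mul_of_nonneg_right h2 hd]

/-- The time change `τ` of `leftMatern_eq` is bi-Lipschitz on `[0,1]`, so that `min (τ s) (τ t)` is
comparable to `min s t`; the rescaling by `e^{-ws}` and its inverse `e^{ws}` are handled by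
`dominated_mul_min`. -/
theorem dominated_leftMatern_min {w : ℝ} (hw : 0 < w) :
    Dominated (leftMatern w) (fun s t : unitInterval => min (s : ℝ) t) ∧
      Dominated (fun s t : unitInterval => min (s : ℝ) t) (leftMatern w) := by
  set τ : unitInterval → ℝ := fun t => (Real.exp (2 * w * t) - 1) / 2 with hτ
  have hbd : ∀ s t : unitInterval, s ≤ t → w * ((t : ℝ) - s) ≤ τ t - τ s ∧
      τ t - τ s ≤ w * Real.exp (2 * w) * ((t : ℝ) - s) := by
    intro s t h
    have := exp_sub_exp_bounds hw s.2.1 h t.2.2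
    have e : τ t - τ s = (Real.exp (2 * w * t) - Real.exp (2 * w * s)) / 2 := by
      simp only [hτ]; ring
    rwa [e]
  have hτm : Monotone τ := fun s t h => by
    have h1 := (hbd s t h).1
    have h2 : (0 : ℝ) ≤ (t : ℝ) - s := sub_nonneg.2 h
    nlinarith
  have hmul : ∀ c : ℝ, 0 ≤ c → Monotone fun t : unitInterval => c * (t : ℝ) := fun c hc s t h =>
    mul_le_mul_of_nonneg_left h hc
  have hmin : ∀ c : ℝ, 0 ≤ c → ∀ s t : unitInterval,
      min (c * (s : ℝ)) (c * t) = c * min (s : ℝ) t := fun c hc s t =>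
    (mul_min_of_nonneg _ _ hc).symm
  have hder : ∀ a x : ℝ, HasDerivAt (fun x => Real.exp (a * x)) (Real.exp (a * x) * a) x :=
    fun a x => by
      simpa using ((hasDerivAt_id x).const_mul a).exp
  have hg : ∀ a : ℝ, Dominated
      (fun s t : unitInterval => Real.exp (a * s) * Real.exp (a * t) * min (s : ℝ) t)
      fun s t => min (s : ℝ) t := fun a =>
    dominated_mul_min (hder a) (by fun_prop)
  have hc : 0 < w * Real.exp (2 * w) := by positivity
  have hpsd := isPSD_mul fun s : unitInterval => Real.exp (-w * s)
  have hup : Dominated (fun s t => min (τ s) (τ t)) fun s t : unitInterval => min (s : ℝ) t := by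
    refine ⟨w * Real.exp (2 * w), hc, (isPSD_congr fun s t => ?_).1
      (isPSD_sub_min hτm (hmul _ hc.le) (by simp [hτ]) fun s t h => ?_)⟩
    · rw [hmin _ hc.le]
    · have := (hbd s t h).2
      simp only
      linarith
  have hlow : Dominated (fun s t : unitInterval => min (s : ℝ) t) fun s t => min (τ s) (τ t) := by
    have h1 : IsPSD fun s t => min (τ s) (τ t) - min (w * (s : ℝ)) (w * t) :=
      isPSD_sub_min (hmul _ hw.le) hτm (by simp [hτ]) fun s t h => by
        have := (hbd s t h).1
        simp only
        linarith
    refine ⟨w⁻¹, by positivity, (isPSD_congr fun s t => ?_).1 (h1.smul (c := w⁻¹) (by positivity))⟩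
    rw [hmin w hw.le]
    field_simp
  have heq : leftMatern w = fun s t : unitInterval => Real.exp (-w * (s : ℝ)) * Real.exp (-w * t)
      * min (τ s) (τ t) :=
    funext fun s => funext fun t => leftMatern_eq hw s t
  rw [heq]
  refine ⟨(hup.mul_left hpsd).trans (hg (-w)), ?_⟩
  have h2 := ((hg w).mul_left hpsd).trans (hlow.mul_left hpsd)
  convert h2 using 3 with s t
  have e1 : ∀ x : ℝ, Real.exp (-w * x) * Real.exp (w * x) = 1 := fun x => by
    rw [← Real.exp_add]; simp
  linear_combination (-min (s : ℝ) t) * e1 s - min (s : ℝ) t * Real.exp (-w * s)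
    * Real.exp (w * s) * e1 t

variable {d : ℕ} (I₀ I₁ : Finset (Fin d)) (j : Fin d)

/-- The kernel of the Brownian bridge is the kernel `min` of Brownian motion conditioned on the
value at `1`. -/
theorem brownian1_both (h : j ∈ I₀ ∧ j ∈ I₁) :
    (fun s t : unitInterval => brownian1 I₀ I₁ j s t)
      = condKernel (fun s t : unitInterval => min (s : ℝ) t) 1 := by
  funext s t
  rw [brownian1, if_pos h, condKernel]
  simp only [Set.Icc.coe_one, min_self, div_one, min_eq_left s.2.2, min_eq_left t.2.2]
  rw [← min_mul_max (s : ℝ) t]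
  ring

/-- The BdryMatérn kernel with two known boundary points is `leftMatern` conditioned on the value at
`1`. -/
theorem bdryMatern1_both {w : ℝ} (hw : 0 < w) (h : j ∈ I₀ ∧ j ∈ I₁) :
    (fun s t : unitInterval => bdryMatern1 I₀ I₁ w j s t) = condKernel (leftMatern w) 1 := by
  have hs := Real.sinh_pos_iff.2 hw
  have key : ∀ a b : ℝ, Real.sinh (w * a) * Real.sinh (w * (1 - b)) / Real.sinh w
      = Real.sinh (w * a) * Real.exp (w * -b) - (Real.sinh (w * a) * Real.exp (w * -1)) *
        (Real.sinh (w * b) * Real.exp (w * -1)) / (Real.sinh (w * 1) * Real.exp (w * -1)) := by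
    intro a b
    have he := Real.exp_pos (w * -1)
    rw [mul_one]
    field_simp
    rw [show w * (1 - b) = w - w * b by ring, Real.sinh_sub, ← Real.cosh_sub_sinh,
      ← Real.cosh_sub_sinh]
    ring
  funext s t
  rw [bdryMatern1, if_pos h, condKernel]
  simp only [leftMatern, Set.Icc.coe_one, min_self, max_self, min_eq_left s.2.2,
    min_eq_left t.2.2, max_eq_right s.2.2, max_eq_right t.2.2]
  rw [key]
  congr 2
  rcases le_total (s : ℝ) t with h | h
  · rw [min_eq_left h, max_eq_right h]
  · rw [min_eq_right h, max_eq_left h]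
    ring

theorem brownian1_right (h₀ : j ∉ I₀) :
    (fun s t : unitInterval => brownian1 I₀ I₁ j s t)
      = fun s t => min (unitInterval.symm s : ℝ) (unitInterval.symm t) := by
  funext s t
  rw [brownian1, if_neg (fun h => h₀ h.1), if_neg h₀, unitInterval.coe_symm_eq,
    unitInterval.coe_symm_eq]
  exact (min_sub_sub_left 1 (s : ℝ) t).symm

/-- Reflection turns the BdryMatérn kernel with known right boundary into `leftMatern`, up to the
factor `e^w`. -/
theorem bdryMatern1_right {w : ℝ} (h₀ : j ∉ I₀) (h₁ : j ∈ I₁) :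
    (fun s t : unitInterval => bdryMatern1 I₀ I₁ w j s t)
      = fun s t => Real.exp w * leftMatern w (unitInterval.symm s) (unitInterval.symm t) := by
  funext s t
  rw [bdryMatern1, if_neg (fun h => h₀ h.1), if_neg h₀, if_pos h₁, leftMatern,
    unitInterval.coe_symm_eq, unitInterval.coe_symm_eq, min_sub_sub_left, max_sub_sub_left,
    mul_left_comm, ← Real.exp_add, mul_comm]
  ring_nf

theorem isPSD_brownian1 : IsPSD fun s t : unitInterval => brownian1 I₀ I₁ j s t := by
  by_cases hb : j ∈ I₀ ∧ j ∈ I₁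
  · refine isPSD_iff.2 ⟨fun s t => by simp only [brownian1, min_comm, max_comm], fun v => ?_⟩
    rw [brownian1_both I₀ I₁ j hb, kernelForm_condKernel]
    have h := sum_mul_kernel_sq_le (isPSD_min (X := unitInterval) fun s => s.2.1) v 1
    simpa using h
  · by_cases h0 : j ∈ I₀
    · have : (fun s t : unitInterval => brownian1 I₀ I₁ j s t)
          = fun s t : unitInterval => min (s : ℝ) t := by
        funext s t
        rw [brownian1, if_neg hb, if_pos h0]
      rw [this]
      exact isPSD_min fun s => s.2.1
    · rw [brownian1_right I₀ I₁ j h0]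
      exact isPSD_min fun s => (unitInterval.symm s).2.1

theorem isPSD_bdryMatern1 {w : ℝ} (hw : 0 < w) (hj : j ∈ I₀ ∨ j ∈ I₁) :
    IsPSD fun s t : unitInterval => bdryMatern1 I₀ I₁ w j s t := by
  have h1 : 0 < leftMatern w 1 1 := by
    have := Real.sinh_pos_iff.2 hw
    simp only [leftMatern, Set.Icc.coe_one, min_self, mul_one]
    positivity
  by_cases hb : j ∈ I₀ ∧ j ∈ I₁
  · refine isPSD_iff.2 ⟨fun s t => ?_, fun v => ?_⟩
    · rw [show bdryMatern1 I₀ I₁ w j s t = bdryMatern1 I₀ I₁ w j t s by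
        simp only [bdryMatern1, min_comm, max_comm, abs_sub_comm]]
    rw [bdryMatern1_both I₀ I₁ j hw hb, kernelForm_condKernel]
    have h := sum_mul_kernel_sq_le (isPSD_leftMatern hw) v 1
    rw [sub_nonneg, div_le_iff₀ h1]
    exact h
  · by_cases h0 : j ∈ I₀
    · have : (fun s t : unitInterval => bdryMatern1 I₀ I₁ w j s t) = leftMatern w := by
        funext s t
        rw [bdryMatern1, if_neg hb, if_pos h0, leftMatern]
      rw [this]
      exact isPSD_leftMatern hw
    · rw [bdryMatern1_right I₀ I₁ j h0 (hj.resolve_left h0)]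
      exact ((isPSD_leftMatern hw).comap _).smul (Real.exp_pos w).le

theorem dominated_bdryMatern1_brownian1 {w : ℝ} (hw : 0 < w) (hj : j ∈ I₀ ∨ j ∈ I₁) :
    Dominated (fun s t : unitInterval => bdryMatern1 I₀ I₁ w j s t)
        (fun s t : unitInterval => brownian1 I₀ I₁ j s t) ∧
      Dominated (fun s t : unitInterval => brownian1 I₀ I₁ j s t)
        fun s t : unitInterval => bdryMatern1 I₀ I₁ w j s t := by
  obtain ⟨hup, hlow⟩ := dominated_leftMatern_min hw
  have hmin : IsPSD fun s t : unitInterval => min (s : ℝ) t := isPSD_min fun s => s.2.1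
  have hM := isPSD_leftMatern hw
  have h1 : 0 < leftMatern w 1 1 := by
    have := Real.sinh_pos_iff.2 hw
    simp only [leftMatern, Set.Icc.coe_one, min_self, mul_one]
    positivity
  have h1' : (0 : ℝ) < min ((1 : unitInterval) : ℝ) (1 : unitInterval) := by simp
  by_cases hb : j ∈ I₀ ∧ j ∈ I₁
  · rw [brownian1_both I₀ I₁ j hb, bdryMatern1_both I₀ I₁ j hw hb]
    exact ⟨hup.condKernel hM hmin h1 h1', hlow.condKernel hmin hM h1' h1⟩
  · by_cases h0 : j ∈ I₀
    · have e1 : (fun s t : unitInterval => bdryMatern1 I₀ I₁ w j s t) = leftMatern w := by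
        funext s t
        rw [bdryMatern1, if_neg hb, if_pos h0, leftMatern]
      have e2 : (fun s t : unitInterval => brownian1 I₀ I₁ j s t)
          = fun s t : unitInterval => min (s : ℝ) t := by
        funext s t
        rw [brownian1, if_neg hb, if_pos h0]
      rw [e1, e2]
      exact ⟨hup, hlow⟩
    · rw [brownian1_right I₀ I₁ j h0, bdryMatern1_right I₀ I₁ j h0 (hj.resolve_left h0)]
      constructor
      · simpa using (hup.comap unitInterval.symm).smul (Real.exp_pos w) one_pos
      · simpa using (hlow.comap unitInterval.symm).smul one_pos (Real.exp_pos w)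

end OneDim

/-! ### The Brownian and the BdryMatérn spaces -/

section BrownianMatern

variable {d : ℕ} (I₀ I₁ : Finset (Fin d))

theorem kernelForm_prod_le_of_dominated {Y : Fin d → Type*} {A B : ∀ j, Y j → Y j → ℝ}
    (hA : ∀ j, IsPSD (A j)) (hB : ∀ j, IsPSD (B j)) (hAB : ∀ j, Dominated (A j) (B j)) :
    ∃ C : ℝ, 0 < C ∧ ∀ v : (∀ j, Y j) →₀ ℝ,
      kernelForm (fun x y => ∏ j, A j (x j) (y j)) v v
        ≤ C * kernelForm (fun x y => ∏ j, B j (x j) (y j)) v v := by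
  choose C hC h using hAB
  exact ⟨∏ j, C j, Finset.prod_pos fun j _ => hC j, kernelForm_prod_le hA hB h⟩

theorem bdryMaternSpace_brownianSpace_embeds (hI : I₀ ∪ I₁ = Finset.univ) (ω : Fin d → ℝ)
    (hω : ∀ j, 0 < ω j) (σ : ℝ) (hσ : 0 < σ) :
    (bdryMaternSpace I₀ I₁ ω hω σ).Embeds (brownianSpace I₀ I₁) ∧
      (brownianSpace I₀ I₁).Embeds (bdryMaternSpace I₀ I₁ ω hω σ) := by
  have hj : ∀ j, j ∈ I₀ ∨ j ∈ I₁ := fun j => Finset.mem_union.1 (hI ▸ Finset.mem_univ j)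
  have hB := fun j => isPSD_brownian1 I₀ I₁ j
  have hM := fun j => isPSD_bdryMatern1 I₀ I₁ j (hω j) (hj j)
  have hd := fun j => dominated_bdryMatern1_brownian1 I₀ I₁ j (hω j) (hj j)
  obtain ⟨C, hC, h⟩ := kernelForm_prod_le_of_dominated hM hB fun j => (hd j).1
  obtain ⟨C', hC', h'⟩ := kernelForm_prod_le_of_dominated hB hM fun j => (hd j).2
  constructor
  · refine rkhs_embeds_of_le _ _ (C := σ ^ 2 * C) (by positivity) fun v => ?_
    unfold bdryMaternKernel
    rw [kernelForm_smul_kernel, mul_assoc]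
    exact mul_le_mul_of_nonneg_left (h v) (sq_nonneg σ)
  · refine rkhs_embeds_of_le _ _ (C := C' / σ ^ 2) (by positivity) fun v => ?_
    unfold bdryMaternKernel
    rw [kernelForm_smul_kernel, ← mul_assoc, div_mul_cancel₀ _ (by positivity)]
    exact h' v

end BrownianMatern

/-! ### Sections of the one-dimensional Brownian kernels on the real line -/

section Ramp

/-- The function with slope `1` on `[a, b)` and constant elsewhere. -/
def ramp (a b x : ℝ) : ℝ := max a (min b x)

theorem hasDerivWithinAt_ramp {a b : ℝ} (hab : a ≤ b) (x : ℝ) :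
    HasDerivWithinAt (ramp a b) ((Set.Ico a b).indicator 1 x) (Set.Ioi x) x := by
  unfold ramp
  rcases lt_or_ge x a with h | h
  · rw [Set.indicator_of_notMem (fun hx => absurd hx.1 (not_le.2 h))]
    refine ((hasDerivAt_const x a).congr_of_eventuallyEq ?_).hasDerivWithinAt
    filter_upwards [Iio_mem_nhds h] with t ht
    exact max_eq_left (min_le_of_right_le (le_of_lt ht))
  · rcases lt_or_ge x b with h' | h'
    · rw [Set.indicator_of_mem (show x ∈ Set.Ico a b from ⟨h, h'⟩)]
      refine (hasDerivWithinAt_id x _).congr_of_eventuallyEq ?_ ?_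
      · filter_upwards [self_mem_nhdsWithin, mem_nhdsWithin_of_mem_nhds (Iio_mem_nhds h')]
          with t ht ht'
        rw [min_eq_right (le_of_lt ht'), max_eq_right (h.trans (le_of_lt ht)), id]
      · rw [min_eq_right h'.le, max_eq_right h, id]
    · rw [Set.indicator_of_notMem (fun hx => absurd hx.2 (not_lt.2 h'))]
      refine (hasDerivWithinAt_const x _ b).congr_of_eventuallyEq ?_ ?_
      · filter_upwards [self_mem_nhdsWithin] with t ht
        rw [min_eq_left (h'.trans (le_of_lt ht)), max_eq_right hab]
      · rw [min_eq_left h', max_eq_right hab]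

theorem setIntegral_indicator_mul_indicator (a b c d e f : ℝ) :
    ∫ x in Set.Ico e f, (Set.Ico a b).indicator (1 : ℝ → ℝ) x * (Set.Ico c d).indicator 1 x
      = max (min (min b d) f - max (max a c) e) 0 := by
  have h : ∀ x, (Set.Ico a b).indicator (1 : ℝ → ℝ) x * (Set.Ico c d).indicator 1 x
      = (Set.Ico (max a c) (min b d)).indicator 1 x := by
    intro x
    rw [← Set.inter_indicator_mul]
    simp [Set.Ico_inter_Ico, Set.indicator]
  simp_rw [h]
  rw [integral_indicator_one measurableSet_Ico, measureReal_restrict_apply measurableSet_Ico,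
    Set.Ico_inter_Ico, Real.volume_real_Ico]

end Ramp

section Extension

variable {d : ℕ} (I₀ I₁ : Finset (Fin d)) (j : Fin d)

/-- A retraction `ℝ → [0,1]`: constant beyond a known boundary point, reflection at an unknown one
(continued to the mirror image of the known boundary point, and constant from there on). -/
def fold (x : ℝ) : unitInterval :=
  if j ∈ I₀ ∧ j ∈ I₁ then Set.projIcc 0 1 zero_le_one x
  else if j ∈ I₀ then Set.projIcc 0 1 zero_le_one (1 - |x - 1|)
  else Set.projIcc 0 1 zero_le_one |x|

/-- The section `k(·, y)` of the one-dimensional Brownian kernel, extended to the real line. -/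
def extSection (y : unitInterval) (x : ℝ) : ℝ := brownian1 I₀ I₁ j (fold I₀ I₁ j x) y

/-- The right derivative of `extSection`. In the second and third case the second, respectively the
first, indicator is the mirror image of the other one under the reflection of `fold`. -/
def extSlope (y : unitInterval) (x : ℝ) : ℝ :=
  if j ∈ I₀ ∧ j ∈ I₁ then (Set.Ico 0 (y : ℝ)).indicator 1 x - y * (Set.Ico 0 1).indicator 1 x
  else if j ∈ I₀ then (Set.Ico 0 (y : ℝ)).indicator 1 x - (Set.Ico (2 - (y : ℝ)) 2).indicator 1 x
  else (Set.Ico (-1) (-(y : ℝ))).indicator 1 x - (Set.Ico (y : ℝ) 1).indicator 1 x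

theorem continuous_fold : Continuous (fold I₀ I₁ j) := by
  unfold fold
  split_ifs
  · exact continuous_projIcc
  · exact continuous_projIcc.comp (by fun_prop)
  · exact continuous_projIcc.comp (by fun_prop)

theorem fold_coe (y : unitInterval) : fold I₀ I₁ j y = y := by
  have h0 := y.2.1
  have h1 := y.2.2
  unfold fold
  split_ifs
  · exact Set.projIcc_val _ y
  · rw [abs_of_nonpos (by linarith), show 1 - -((y : ℝ) - 1) = y by ring]
    exact Set.projIcc_val _ y
  · rw [abs_of_nonneg h0]
    exact Set.projIcc_val _ y

theorem fold_eq_zero (h : j ∈ I₀) {x : ℝ} (hx : x ≤ 0) : fold I₀ I₁ j x = 0 := by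
  unfold fold
  split_ifs
  · exact Set.projIcc_of_le_left _ hx
  · refine Set.projIcc_of_le_left _ ?_
    rw [abs_of_nonpos (by linarith)]
    linarith

theorem fold_eq_one (h : j ∈ I₁) {x : ℝ} (hx : 1 ≤ x) : fold I₀ I₁ j x = 1 := by
  unfold fold
  split_ifs with hb h0
  · exact Set.projIcc_of_right_le _ hx
  · exact absurd ⟨h0, h⟩ hb
  · exact Set.projIcc_of_right_le _ (hx.trans (le_abs_self x))

theorem brownian1_zero (h : j ∈ I₀) {s : ℝ} (hs : 0 ≤ s) : brownian1 I₀ I₁ j 0 s = 0 := by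
  unfold brownian1
  split_ifs <;> simp [hs]

theorem brownian1_one (h : j ∈ I₁) {s : ℝ} (hs : s ≤ 1) : brownian1 I₀ I₁ j 1 s = 0 := by
  unfold brownian1
  split_ifs with hb h0
  · simp [hs]
  · exact absurd ⟨h0, h⟩ hb
  · simp [hs]

theorem brownian1_self_mem (s : unitInterval) :
    0 ≤ brownian1 I₀ I₁ j s s ∧ brownian1 I₀ I₁ j s s ≤ 1 := by
  have h0 := s.2.1
  have h1 := s.2.2
  unfold brownian1
  split_ifs <;> simp only [min_self, max_self] <;> constructor <;> nlinarith

theorem extSection_coe (x y : unitInterval) :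
    extSection I₀ I₁ j y x = brownian1 I₀ I₁ j x y := by
  rw [extSection, fold_coe]

theorem extSection_eq_zero (y : unitInterval) {x : ℝ} (hx : x ∉ Set.Icc (-1 : ℝ) 2) :
    extSection I₀ I₁ j y x = 0 := by
  unfold extSection
  by_cases hb : j ∈ I₀ ∧ j ∈ I₁
  · rcases lt_or_ge x 0 with h | h
    · rw [fold_eq_zero _ _ _ hb.1 h.le]
      exact brownian1_zero I₀ I₁ j hb.1 y.2.1
    · rw [fold_eq_one _ _ _ hb.2 (by by_contra! h'; exact hx ⟨by linarith, by linarith⟩)]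
      exact brownian1_one I₀ I₁ j hb.2 y.2.2
  · by_cases h0 : j ∈ I₀
    · have : fold I₀ I₁ j x = 0 := by
        rcases lt_or_ge x 0 with h | h
        · exact fold_eq_zero _ _ _ h0 h.le
        · have h2 : 2 < x := by by_contra! h'; exact hx ⟨by linarith, h'⟩
          rw [fold, if_neg hb, if_pos h0]
          refine Set.projIcc_of_le_left _ ?_
          rw [abs_of_nonneg (by linarith)]
          linarith
      rw [this]
      exact brownian1_zero I₀ I₁ j h0 y.2.1
    · have : fold I₀ I₁ j x = 1 := by
        rw [fold, if_neg hb, if_neg h0]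
        refine Set.projIcc_of_right_le _ ?_
        by_contra! h'
        rw [abs_lt] at h'
        exact hx ⟨by linarith, by linarith⟩
      rw [this, brownian1, if_neg hb, if_neg h0]
      simp [y.2.2]

theorem continuous_extSection (y : unitInterval) : Continuous (extSection I₀ I₁ j y) := by
  have := continuous_fold I₀ I₁ j
  unfold extSection brownian1
  split_ifs <;> fun_prop

theorem hasCompactSupport_extSection (y : unitInterval) :
    HasCompactSupport (extSection I₀ I₁ j y) :=
  HasCompactSupport.intro isCompact_Icc fun _ hx => extSection_eq_zero I₀ I₁ j y hx

theorem hasDerivWithinAt_extSection (y : unitInterval) (x : ℝ) :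
    HasDerivWithinAt (extSection I₀ I₁ j y) (extSlope I₀ I₁ j y x) (Set.Ioi x) x := by
  have h0 := y.2.1
  have h1 := y.2.2
  by_cases hb : j ∈ I₀ ∧ j ∈ I₁
  · have e : extSection I₀ I₁ j y = fun x => ramp 0 y x - y * ramp 0 1 x := by
      funext x
      simp only [extSection, brownian1, fold, if_pos hb, Set.coe_projIcc, ramp]
      rcases le_total (1 : ℝ) x with h2 | h2
      · rw [min_eq_left h2, max_eq_right zero_le_one, min_eq_right h1, max_eq_left h1,
          min_eq_left (h1.trans h2), max_eq_right h0]
        ring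
      · rw [min_eq_right h2]
        rcases le_total (0 : ℝ) x with h3 | h3
        · rw [max_eq_right h3]
          rcases le_total (y : ℝ) x with h4 | h4
          · rw [min_eq_right h4, max_eq_left h4, min_eq_left h4, max_eq_right h0]; ring
          · rw [min_eq_left h4, max_eq_right h4, min_eq_right h4, max_eq_right h3]; ring
        · rw [max_eq_left h3, min_eq_left h0, max_eq_left (min_le_of_right_le h3)]; ring
    rw [e, extSlope, if_pos hb]
    exact (hasDerivWithinAt_ramp h0 x).sub ((hasDerivWithinAt_ramp zero_le_one x).const_mul _)
  · by_cases hj : j ∈ I₀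
    · have e : extSection I₀ I₁ j y = fun x => ramp 0 y x - (ramp (2 - y) 2 x - (2 - y)) := by
        funext x
        simp only [extSection, brownian1, fold, if_neg hb, if_pos hj, Set.coe_projIcc, ramp]
        rcases le_total (1 : ℝ) x with h2 | h2
        · rw [abs_of_nonneg (by linarith), min_eq_left (h1.trans h2), max_eq_right h0,
            min_eq_right (by linarith : 1 - (x - 1) ≤ 1)]
          rcases le_total (2 : ℝ) x with h3 | h3
          · rw [max_eq_left (by linarith), min_eq_left h0, min_eq_left h3,
              max_eq_right (by linarith)]
            ring
          · rw [max_eq_right (by linarith), min_eq_right h3]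
            rcases le_total (2 - (y : ℝ)) x with h4 | h4
            · rw [max_eq_right h4, min_eq_left (by linarith)]; ring
            · rw [max_eq_left h4, min_eq_right (by linarith)]; ring
        · rw [abs_of_nonpos (by linarith), min_eq_right (by linarith : 1 - -(x - 1) ≤ 1),
            min_eq_right (by linarith : x ≤ 2), max_eq_left (by linarith : x ≤ 2 - y),
            show 1 - -(x - 1) = x by ring, max_min_distrib_left, max_eq_right h0, min_comm]
          ring
      rw [e, extSlope, if_neg hb, if_pos hj]
      exact (hasDerivWithinAt_ramp h0 x).sub
        ((hasDerivWithinAt_ramp (by linarith) x).sub_const _)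
    · have e : extSection I₀ I₁ j y = fun x => (ramp (-1) (-y) x + 1) - (ramp y 1 x - y) := by
        funext x
        simp only [extSection, brownian1, fold, if_neg hb, if_neg hj, Set.coe_projIcc, ramp]
        rw [max_eq_right (le_min zero_le_one (abs_nonneg x))]
        rcases le_total (0 : ℝ) x with h2 | h2
        · rw [abs_of_nonneg h2, min_eq_left (by linarith : -(y : ℝ) ≤ x),
            max_eq_right (by linarith : (-1 : ℝ) ≤ -y), max_comm]
          ring
        · rw [abs_of_nonpos h2, min_eq_right (by linarith : x ≤ 1),
            max_eq_left (by linarith : x ≤ (y : ℝ))]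
          rcases le_total (-1) x with h3 | h3
          · rw [min_eq_right (by linarith : -x ≤ 1)]
            rcases le_total (-(y : ℝ)) x with h4 | h4
            · rw [min_eq_left h4, max_eq_right (by linarith), max_eq_right (by linarith)]; ring
            · rw [min_eq_right h4, max_eq_left (by linarith), max_eq_right (by linarith)]; ring
          · rw [min_eq_left (by linarith : 1 ≤ -x), max_eq_left h1,
              max_eq_left (min_le_of_right_le h3)]
            ring
      rw [e, extSlope, if_neg hb, if_neg hj]
      exact ((hasDerivWithinAt_ramp (by linarith) x).add_const _).sub
        ((hasDerivWithinAt_ramp h1 x).sub_const _)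

theorem extSlope_eq_zero (y : unitInterval) {x : ℝ} (hx : x ∉ Set.Ico (-1 : ℝ) 2) :
    extSlope I₀ I₁ j y x = 0 := by
  have h0 := y.2.1
  have h1 := y.2.2
  have h : ∀ a b : ℝ, -1 ≤ a → b ≤ 2 → (Set.Ico a b).indicator (1 : ℝ → ℝ) x = 0 :=
    fun a b ha hb => Set.indicator_of_notMem
      (fun hx' => hx ⟨ha.trans hx'.1, hx'.2.trans_le hb⟩) _
  unfold extSlope
  rw [h 0 y (by linarith) (by linarith), h 0 1 (by linarith) (by linarith),
    h (2 - y) 2 (by linarith) (by linarith), h (-1) (-y) (by linarith) (by linarith),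
    h y 1 (by linarith) (by linarith)]
  simp

theorem measurable_extSlope (y : unitInterval) : Measurable (extSlope I₀ I₁ j y) := by
  have h : ∀ a b : ℝ, Measurable ((Set.Ico a b).indicator (1 : ℝ → ℝ)) := fun a b =>
    measurable_one.indicator measurableSet_Ico
  unfold extSlope
  split_ifs
  · exact (h _ _).sub ((h _ _).const_mul _)
  · exact (h _ _).sub (h _ _)
  · exact (h _ _).sub (h _ _)

theorem abs_extSlope_le (y : unitInterval) (x : ℝ) : |extSlope I₀ I₁ j y x| ≤ 1 := by
  have h0 := y.2.1
  have h1 := y.2.2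
  have h : ∀ a b : ℝ, 0 ≤ (Set.Ico a b).indicator (1 : ℝ → ℝ) x ∧
      (Set.Ico a b).indicator (1 : ℝ → ℝ) x ≤ 1 := fun a b => by
    by_cases hx : x ∈ Set.Ico a b <;> simp [hx]
  unfold extSlope
  split_ifs
  · obtain ⟨h2, h3⟩ := h 0 y
    obtain ⟨h4, h5⟩ := h 0 1
    rw [abs_le]; constructor <;> nlinarith
  · obtain ⟨h2, h3⟩ := h 0 y
    obtain ⟨h4, h5⟩ := h (2 - y) 2
    rw [abs_le]; constructor <;> linarith
  · obtain ⟨h2, h3⟩ := h (-1) (-y)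
    obtain ⟨h4, h5⟩ := h y 1
    rw [abs_le]; constructor <;> linarith

theorem memLp_extSlope (y : unitInterval) : MemLp (extSlope I₀ I₁ j y) 2 := by
  have h : ∀ a b : ℝ, MemLp ((Set.Ico a b).indicator (1 : ℝ → ℝ)) 2 := fun a b =>
    memLp_indicator_const 2 measurableSet_Ico 1 (Or.inr (by simp))
  unfold extSlope
  split_ifs
  · exact (h _ _).sub ((h _ _).const_mul _)
  · exact (h _ _).sub (h _ _)
  · exact (h _ _).sub (h _ _)

theorem memLp_extSection (y : unitInterval) : MemLp (extSection I₀ I₁ j y) 2 :=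
  (continuous_extSection I₀ I₁ j y).memLp_of_hasCompactSupport
    (hasCompactSupport_extSection I₀ I₁ j y)

/-- The inner product of two slopes over an interval, as an expression in minima and maxima. -/
theorem setIntegral_step_mul_step (c c' a₁ b₁ a₂ b₂ a₃ b₃ a₄ b₄ e f : ℝ) :
    ∫ x in Set.Ico e f, ((Set.Ico a₁ b₁).indicator (1 : ℝ → ℝ) x
        - c * (Set.Ico a₂ b₂).indicator (1 : ℝ → ℝ) x)
        * ((Set.Ico a₃ b₃).indicator (1 : ℝ → ℝ) x - c' * (Set.Ico a₄ b₄).indicator (1 : ℝ → ℝ) x)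
      = max (min (min b₁ b₃) f - max (max a₁ a₃) e) 0
        - c' * max (min (min b₁ b₄) f - max (max a₁ a₄) e) 0
        - c * max (min (min b₂ b₃) f - max (max a₂ a₃) e) 0
        + c * c' * max (min (min b₂ b₄) f - max (max a₂ a₄) e) 0 := by
  have h : ∀ a b : ℝ, MemLp ((Set.Ico a b).indicator (1 : ℝ → ℝ)) 2
      (volume.restrict (Set.Ico e f)) := fun a b =>
    (memLp_indicator_const 2 measurableSet_Ico 1 (Or.inr (by simp))).restrict _
  have hi : ∀ a b a' b' : ℝ, Integrable (fun x => (Set.Ico a b).indicator (1 : ℝ → ℝ) x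
      * (Set.Ico a' b').indicator 1 x) (volume.restrict (Set.Ico e f)) := fun a b a' b' =>
    (h a b).integrable_mul (h a' b')
  have e1 : ∀ x, ((Set.Ico a₁ b₁).indicator (1 : ℝ → ℝ) x - c * (Set.Ico a₂ b₂).indicator 1 x)
        * ((Set.Ico a₃ b₃).indicator 1 x - c' * (Set.Ico a₄ b₄).indicator 1 x)
      = (Set.Ico a₁ b₁).indicator 1 x * (Set.Ico a₃ b₃).indicator 1 x
        + -c' * ((Set.Ico a₁ b₁).indicator 1 x * (Set.Ico a₄ b₄).indicator 1 x)
        + -c * ((Set.Ico a₂ b₂).indicator 1 x * (Set.Ico a₃ b₃).indicator 1 x)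
        + c * c' * ((Set.Ico a₂ b₂).indicator 1 x * (Set.Ico a₄ b₄).indicator 1 x) := by
    intro x; ring
  simp_rw [e1]
  have i2 := (hi a₁ b₁ a₄ b₄).const_mul (-c')
  have i3 := (hi a₂ b₂ a₃ b₃).const_mul (-c)
  have i12 : Integrable (fun x => (Set.Ico a₁ b₁).indicator (1 : ℝ → ℝ) x
      * (Set.Ico a₃ b₃).indicator 1 x + -c' * ((Set.Ico a₁ b₁).indicator 1 x
      * (Set.Ico a₄ b₄).indicator 1 x)) (volume.restrict (Set.Ico e f)) := (hi _ _ _ _).add i2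
  rw [integral_add, integral_add i12 i3, integral_add (hi _ _ _ _) i2]
  · simp only [integral_const_mul, setIntegral_indicator_mul_indicator]
    ring
  · exact i12.add i3
  · exact (hi _ _ _ _).const_mul _

/-- On `(0,1)` the slopes are features of the Brownian kernel. -/
theorem setIntegral_extSlope_mul (y z : unitInterval) :
    ∫ x in Set.Ioo 0 1, extSlope I₀ I₁ j y x * extSlope I₀ I₁ j z x = brownian1 I₀ I₁ j y z := by
  rw [setIntegral_congr_set Ioo_ae_eq_Ico]
  have hy0 := y.2.1
  have hy1 := y.2.2
  have hz0 := z.2.1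
  have hz1 := z.2.2
  unfold extSlope brownian1
  split_ifs
  · rw [setIntegral_step_mul_step]
    simp only [max_self, min_self, min_eq_left hy1, min_eq_left hz1, min_eq_right hz1,
      min_eq_left (min_le_of_left_le hy1 : min (y : ℝ) z ≤ 1), sub_zero, max_eq_left hy0,
      max_eq_left hz0, max_eq_left (le_min hy0 hz0), max_eq_left zero_le_one]
    rcases le_total (y : ℝ) z with h | h
    · rw [min_eq_left h, max_eq_right h]; ring
    · rw [min_eq_right h, max_eq_left h]; ring
  · have := setIntegral_step_mul_step 1 1 0 y (2 - y) 2 0 z (2 - z) 2 0 1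
    simp only [one_mul] at this
    rw [this]
    rw [max_eq_left (by linarith : (0 : ℝ) ≤ 2 - y), max_eq_right (by linarith : (0 : ℝ) ≤ 2 - z),
      max_eq_left (by linarith : (0 : ℝ) ≤ 2 - z), max_self, max_self, min_self,
      min_eq_left (min_le_of_left_le hy1 : min (y : ℝ) z ≤ 1),
      min_eq_right (by norm_num : (1 : ℝ) ≤ 2), sub_zero, max_eq_left (le_min hy0 hz0),
      max_eq_left (by linarith : (0 : ℝ) ≤ 2 - y),
      max_eq_left (le_max_of_le_left (by linarith) : (0 : ℝ) ≤ max (2 - (y : ℝ)) (2 - z)),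
      min_eq_left (by linarith : (y : ℝ) ≤ 2), min_eq_right (by linarith : (z : ℝ) ≤ 2),
      min_eq_left hy1, min_eq_left hz1, max_eq_right (by linarith : (y : ℝ) - (2 - z) ≤ 0),
      max_eq_right (by linarith : (z : ℝ) - (2 - y) ≤ 0),
      max_eq_right (by linarith [le_max_left (2 - (y : ℝ)) (2 - z)] :
        1 - max (2 - (y : ℝ)) (2 - z) ≤ 0)]
    ring
  · have := setIntegral_step_mul_step 1 1 (-1) (-y) y 1 (-1) (-z) z 1 0 1
    simp only [one_mul] at this
    rw [this]
    have hm : min (-(y : ℝ)) (-z) ≤ 0 := min_le_of_left_le (by linarith)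
    have hm1 : max (y : ℝ) z ≤ 1 := max_le hy1 hz1
    rw [max_self, max_eq_right (by norm_num : (-1 : ℝ) ≤ 0), sub_zero,
      max_eq_right (min_le_of_left_le hm), min_eq_left (by linarith : -(y : ℝ) ≤ 1),
      min_eq_right (by linarith : -(z : ℝ) ≤ 1), min_eq_left (by linarith : -(y : ℝ) ≤ 1),
      min_eq_left (by linarith : -(z : ℝ) ≤ 1), max_eq_right (by linarith : (-1 : ℝ) ≤ z),
      max_eq_left (by linarith : (-1 : ℝ) ≤ y), max_eq_left hy0, max_eq_left hz0,
      max_eq_right (by linarith : -(y : ℝ) - z ≤ 0), max_eq_right (by linarith : -(z : ℝ) - y ≤ 0),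
      min_self, min_self, max_eq_left (le_max_of_le_left hy0),
      max_eq_left (by linarith : 0 ≤ 1 - max (y : ℝ) z)]
    ring

/-- On the whole line the inner products of the slopes are the Brownian kernel, doubled in the case
of a reflection. -/
theorem integral_extSlope_mul (y z : unitInterval) :
    ∫ x, extSlope I₀ I₁ j y x * extSlope I₀ I₁ j z x
      = (if j ∈ I₀ ∧ j ∈ I₁ then 1 else 2) * brownian1 I₀ I₁ j y z := by
  rw [← setIntegral_eq_integral_of_forall_compl_eq_zero (s := Set.Ico (-1) 2) (fun x hx => by
    rw [extSlope_eq_zero I₀ I₁ j y hx, zero_mul])]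
  have hy0 := y.2.1
  have hy1 := y.2.2
  have hz0 := z.2.1
  have hz1 := z.2.2
  unfold extSlope brownian1
  split_ifs
  · rw [setIntegral_step_mul_step]
    simp only [max_self, min_self, min_eq_left hy1, min_eq_right hz1,
      min_eq_left (min_le_of_left_le (by linarith) : min (y : ℝ) z ≤ 2),
      min_eq_left (by linarith : (y : ℝ) ≤ 2), min_eq_left (by linarith : (z : ℝ) ≤ 2),
      max_eq_left (by norm_num : (-1 : ℝ) ≤ 0), min_eq_left (by norm_num : (1 : ℝ) ≤ 2),
      sub_zero, max_eq_left hy0,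
      max_eq_left hz0, max_eq_left (le_min hy0 hz0), max_eq_left zero_le_one]
    rcases le_total (y : ℝ) z with h | h
    · rw [min_eq_left h, max_eq_right h]; ring
    · rw [min_eq_right h, max_eq_left h]; ring
  · have := setIntegral_step_mul_step 1 1 0 y (2 - y) 2 0 z (2 - z) 2 (-1) 2
    simp only [one_mul] at this
    rw [this]
    rw [max_eq_left (by linarith : (0 : ℝ) ≤ 2 - y), max_eq_right (by linarith : (0 : ℝ) ≤ 2 - z),
      max_self, max_eq_left (by norm_num : (-1 : ℝ) ≤ 0), min_self, min_self,
      min_eq_left (min_le_of_left_le (by linarith) : min (y : ℝ) z ≤ 2),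
      sub_zero, max_eq_left (le_min hy0 hz0),
      max_eq_left (by linarith : (-1 : ℝ) ≤ 2 - y), max_eq_left (by linarith : (-1 : ℝ) ≤ 2 - z),
      max_eq_left (le_max_of_le_left (by linarith) : (-1 : ℝ) ≤ max (2 - (y : ℝ)) (2 - z)),
      min_eq_left (by linarith : (y : ℝ) ≤ 2), min_eq_right (by linarith : (z : ℝ) ≤ 2),
      min_eq_left (by linarith : (y : ℝ) ≤ 2), min_eq_left (by linarith : (z : ℝ) ≤ 2),
      max_eq_right (by linarith : (y : ℝ) - (2 - z) ≤ 0),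
      max_eq_right (by linarith : (z : ℝ) - (2 - y) ≤ 0), max_sub_sub_left,
      max_eq_left (by linarith [le_min hy0 hz0] : 0 ≤ 2 - (2 - min (y : ℝ) z))]
    ring
  · have := setIntegral_step_mul_step 1 1 (-1) (-y) y 1 (-1) (-z) z 1 (-1) 2
    simp only [one_mul] at this
    rw [this]
    have hm1 : max (y : ℝ) z ≤ 1 := max_le hy1 hz1
    have hm0 : 0 ≤ max (y : ℝ) z := le_max_of_le_left hy0
    rw [max_self, max_self, min_neg_neg, min_eq_left (by linarith : -max (y : ℝ) z ≤ 2),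
      min_eq_left (by linarith : -(y : ℝ) ≤ 1),
      min_eq_right (by linarith : -(z : ℝ) ≤ 1), min_eq_left (by linarith : -(y : ℝ) ≤ 2),
      min_eq_left (by linarith : -(z : ℝ) ≤ 2), max_eq_right (by linarith : (-1 : ℝ) ≤ z),
      max_eq_left (by linarith : (-1 : ℝ) ≤ y), max_eq_left (by linarith : (-1 : ℝ) ≤ y),
      max_eq_left (by linarith : (-1 : ℝ) ≤ z),
      max_eq_right (by linarith : -(y : ℝ) - z ≤ 0), max_eq_right (by linarith : -(z : ℝ) - y ≤ 0),
      min_self, min_eq_left (by norm_num : (1 : ℝ) ≤ 2),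
      max_eq_left (by linarith : (-1 : ℝ) ≤ max (y : ℝ) z),
      max_eq_left (by linarith : 0 ≤ 1 - max (y : ℝ) z),
      max_eq_left (by linarith : 0 ≤ -max (y : ℝ) z - -1)]
    ring

/-- The inner products of functions obtained by sampling sections of a kernel with bounded diagonal
over a finite measure are dominated by the kernel, by Cauchy–Schwarz. -/
theorem isPSD_sub_integral_sections {X α : Type*} [MeasurableSpace α] {μ : Measure α}
    [IsFiniteMeasure μ] {k : X → X → ℝ} (hk : IsPSD k) (p : α → X) (hp : ∀ s, k (p s) (p s) ≤ 1)
    (hL : ∀ y, MemLp (fun s => k (p s) y) 2 μ) :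
    IsPSD fun y z => μ.real Set.univ * k y z - ∫ s, k (p s) y * k (p s) z ∂μ := by
  rw [isPSD_sub_iff (isPSD_integral hL) hk]
  intro v
  rw [kernelForm_integral hL]
  have h : ∀ s, (v.sum fun x a => a * k (p s) x) ^ 2 ≤ kernelForm k v v := by
    intro s
    have h1 := sum_mul_kernel_sq_le hk v (p s)
    simp only [hk.symm _ (p s)] at h1
    exact h1.trans (mul_le_of_le_one_right (hk.nonneg v) (hp s))
  calc _ ≤ ∫ _, kernelForm k v v ∂μ :=
        integral_mono_of_nonneg (Eventually.of_forall fun s => sq_nonneg _) (integrable_const _)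
          (Eventually.of_forall h)
    _ = _ := by simp

/-- The constant `3` is the length of `[-1,2]`, outside which the extended sections vanish. -/
theorem isPSD_sub_integral_extSection :
    IsPSD fun y z : unitInterval => 3 * brownian1 I₀ I₁ j y z
      - ∫ x, extSection I₀ I₁ j y x * extSection I₀ I₁ j z x := by
  have h := isPSD_sub_integral_sections (μ := volume.restrict (Set.Icc (-1 : ℝ) 2))
    (isPSD_brownian1 I₀ I₁ j) (fold I₀ I₁ j) (fun s => (brownian1_self_mem I₀ I₁ j _).2)
    (fun y => (memLp_extSection I₀ I₁ j y).restrict _)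
  refine (isPSD_congr fun y z => ?_).1 h
  have e : ∫ x in Set.Icc (-1) 2, extSection I₀ I₁ j y x * extSection I₀ I₁ j z x
      = ∫ x, extSection I₀ I₁ j y x * extSection I₀ I₁ j z x :=
    setIntegral_eq_integral_of_forall_compl_eq_zero fun x hx => by
      rw [extSection_eq_zero I₀ I₁ j y hx, zero_mul]
  rw [← e]
  simp only [extSection, measureReal_restrict_apply_univ, Real.volume_real_Icc]
  norm_num

theorem isPSD_sub_integral_extSlope :
    IsPSD fun y z : unitInterval => 3 * brownian1 I₀ I₁ j y z
      - ∫ x, extSlope I₀ I₁ j y x * extSlope I₀ I₁ j z x := by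
  refine (isPSD_congr fun y z => ?_).1 ((isPSD_brownian1 I₀ I₁ j).smul
    (c := 3 - if j ∈ I₀ ∧ j ∈ I₁ then 1 else 2) (by split_ifs <;> norm_num))
  rw [integral_extSlope_mul]
  ring

end Extension

/-! ### Mixed partial derivatives -/

open scoped ContDiff

section MixedPartial

variable {d : ℕ}

/-- The partial derivative `∂_j φ`. -/
def partialDeriv (j : Fin d) (φ : (Fin d → ℝ) → ℝ) (x : Fin d → ℝ) : ℝ :=
  fderiv ℝ φ x (Pi.single j 1)

theorem contDiff_partialDeriv (j : Fin d) {φ : (Fin d → ℝ) → ℝ} (hφ : ContDiff ℝ ∞ φ) :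
    ContDiff ℝ ∞ (partialDeriv j φ) :=
  (hφ.fderiv_right (m := ∞) (by simp)).clm_apply contDiff_const

theorem tsupport_partialDeriv_subset (j : Fin d) (φ : (Fin d → ℝ) → ℝ) :
    tsupport (partialDeriv j φ) ⊆ tsupport φ :=
  tsupport_fderiv_apply_subset ℝ _

theorem hasCompactSupport_partialDeriv (j : Fin d) {φ : (Fin d → ℝ) → ℝ}
    (hφ : HasCompactSupport φ) : HasCompactSupport (partialDeriv j φ) :=
  hφ.fderiv_apply ℝ _

theorem mixedPartial_empty (φ : (Fin d → ℝ) → ℝ) : mixedPartial ∅ φ = φ := by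
  funext x
  change iteratedFDeriv ℝ 0 φ x _ = φ x
  exact iteratedFDeriv_zero_apply _

/-- The variable `j` is larger than those in `S`, hence last in the enumeration of `insert j S`; the
iterated derivative applies its last argument first. -/
theorem mixedPartial_insert {S : Finset (Fin d)} {j : Fin d} (hj : ∀ i ∈ S, i < j)
    {φ : (Fin d → ℝ) → ℝ} (hφ : ContDiff ℝ ∞ φ) :
    mixedPartial (insert j S) φ = mixedPartial S (partialDeriv j φ) := by
  have hjS : j ∉ S := fun h => lt_irrefl j (hj j h)
  have hcard : (insert j S).card = S.card + 1 := Finset.card_insert_of_notMem hjS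
  have hgen : ∀ (n : ℕ) (h : (insert j S).card = n) (x : Fin d → ℝ),
      mixedPartial (insert j S) φ x = iteratedFDeriv ℝ n φ x
        fun i => Pi.single ((insert j S).orderEmbOfFin h i) 1 := by
    intro n h x
    subst h
    rfl
  funext x
  rw [hgen _ hcard]
  have hsnoc : (Fin.snoc (S.orderEmbOfFin rfl) j : Fin (S.card + 1) → Fin d)
      = (insert j S).orderEmbOfFin hcard := by
    refine Finset.orderEmbOfFin_unique hcard (fun i => ?_) ?_
    · refine Fin.lastCases ?_ (fun i => ?_) i
      · simp
      · rw [Fin.snoc_castSucc]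
        exact Finset.mem_insert_of_mem (Finset.orderEmbOfFin_mem _ _ _)
    · intro i i'
      refine Fin.lastCases ?_ (fun i' => ?_) i'
      · refine Fin.lastCases (fun h => absurd h (lt_irrefl _)) (fun i _ => ?_) i
        rw [Fin.snoc_last, Fin.snoc_castSucc]
        exact hj _ (Finset.orderEmbOfFin_mem _ _ _)
      · refine Fin.lastCases (fun h => absurd h (not_lt.2 (Fin.le_last _))) (fun i h => ?_) i
        rw [Fin.snoc_castSucc, Fin.snoc_castSucc]
        exact (S.orderEmbOfFin rfl).strictMono (Fin.castSucc_lt_castSucc_iff.1 h)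
  rw [iteratedFDeriv_succ_apply_right, ← hsnoc]
  have hinit : (Fin.init fun i : Fin (S.card + 1) =>
      (Pi.single ((Fin.snoc (S.orderEmbOfFin rfl) j : Fin (S.card + 1) → Fin d) i) 1
        : Fin d → ℝ)) = fun i => Pi.single (S.orderEmbOfFin rfl i) 1 := by
    funext i
    simp [Fin.init]
  rw [hinit]
  simp only [Fin.snoc_last]
  have hcomp := (ContinuousLinearMap.apply ℝ ℝ (Pi.single j 1 : Fin d → ℝ)).iteratedFDeriv_comp_left
    (f := fderiv ℝ φ) (x := x) (n := ∞)
    ((hφ.fderiv_right (m := ∞) (by simp)).contDiffAt) (i := S.card) (by exact_mod_cast le_top)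
  have hfun : (ContinuousLinearMap.apply ℝ ℝ (Pi.single j 1 : Fin d → ℝ)) ∘ fderiv ℝ φ
      = partialDeriv j φ := by
    funext y
    simp [partialDeriv]
  rw [hfun] at hcomp
  rw [mixedPartial, hcomp]
  simp

theorem contDiff_mixedPartial (S : Finset (Fin d)) {φ : (Fin d → ℝ) → ℝ} (hφ : ContDiff ℝ ∞ φ) :
    ContDiff ℝ ∞ (mixedPartial S φ) := by
  induction S using Finset.induction_on_max generalizing φ with
  | empty => rwa [mixedPartial_empty]
  | insert j S hj ih =>
    rw [mixedPartial_insert hj hφ]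
    exact ih (contDiff_partialDeriv j hφ)

theorem tsupport_mixedPartial_subset (S : Finset (Fin d)) {φ : (Fin d → ℝ) → ℝ}
    (hφ : ContDiff ℝ ∞ φ) : tsupport (mixedPartial S φ) ⊆ tsupport φ := by
  induction S using Finset.induction_on_max generalizing φ with
  | empty => rw [mixedPartial_empty]
  | insert j S hj ih =>
    rw [mixedPartial_insert hj hφ]
    exact (ih (contDiff_partialDeriv j hφ)).trans (tsupport_partialDeriv_subset j φ)

theorem hasCompactSupport_mixedPartial (S : Finset (Fin d)) {φ : (Fin d → ℝ) → ℝ}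
    (hφ : ContDiff ℝ ∞ φ) (hc : HasCompactSupport φ) : HasCompactSupport (mixedPartial S φ) :=
  hc.of_isClosed_subset (isClosed_tsupport _) (tsupport_mixedPartial_subset S hφ)

/-- Mixed partial derivatives of a product of functions of one variable each. -/
theorem mixedPartial_prod (S : Finset (Fin d)) {ψ : Fin d → ℝ → ℝ}
    (hψ : ∀ i, ContDiff ℝ ∞ (ψ i)) :
    mixedPartial S (fun x => ∏ i, ψ i (x i))
      = fun x => ∏ i, if i ∈ S then deriv (ψ i) (x i) else ψ i (x i) := by
  induction S using Finset.induction_on_max generalizing ψ with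
  | empty => simp [mixedPartial_empty]
  | insert j S hj ih =>
    have hsmooth : ContDiff ℝ ∞ fun x : Fin d → ℝ => ∏ i, ψ i (x i) :=
      contDiff_prod fun i _ => (hψ i).comp (contDiff_apply ℝ ℝ i)
    have hψ' : ∀ i, ContDiff ℝ ∞ (Function.update ψ j (deriv (ψ j)) i) := by
      intro i
      rcases eq_or_ne i j with rfl | h
      · rw [Function.update_self]
        exact (contDiff_infty_iff_deriv.1 (hψ i)).2
      · rw [Function.update_of_ne h]
        exact hψ i
    have hpart : partialDeriv j (fun x : Fin d → ℝ => ∏ i, ψ i (x i))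
        = fun x => ∏ i, Function.update ψ j (deriv (ψ j)) i (x i) := by
      funext x
      have h1 : HasDerivAt (fun t => ∏ i, ψ i (Function.update x j t i))
          (fderiv ℝ (fun x : Fin d → ℝ => ∏ i, ψ i (x i)) x (Pi.single j 1)) (x j) := by
        have h2 := hasDerivAt_update x j (x j)
        have h3 := (hsmooth.differentiable (by simp) (Function.update x j (x j))).hasFDerivAt
        have h4 := h3.comp_hasDerivAt (x j) h2
        rwa [Function.update_eq_self] at h4
      have h5 : HasDerivAt (fun t => ∏ i, ψ i (Function.update x j t i))
          (deriv (ψ j) (x j) * ∏ i ∈ Finset.univ.erase j, ψ i (x i)) (x j) := by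
        have h6 : (fun t => ∏ i, ψ i (Function.update x j t i))
            = fun t => ψ j t * ∏ i ∈ Finset.univ.erase j, ψ i (x i) := by
          funext t
          rw [← Finset.mul_prod_erase _ _ (Finset.mem_univ j), Function.update_self]
          congr 1
          refine Finset.prod_congr rfl fun i hi => ?_
          rw [Function.update_of_ne (Finset.ne_of_mem_erase hi)]
        rw [h6]
        exact (((hψ j).differentiable (by simp) (x j)).hasDerivAt).mul_const _
      rw [partialDeriv, h1.unique h5, ← Finset.mul_prod_erase _ _ (Finset.mem_univ j),
        Function.update_self]
      congr 1
      refine Finset.prod_congr rfl fun i hi => ?_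
      rw [Function.update_of_ne (Finset.ne_of_mem_erase hi)]
    rw [mixedPartial_insert hj hsmooth, hpart, ih hψ']
    funext x
    refine Finset.prod_congr rfl fun i _ => ?_
    have hjS : j ∉ S := fun h => lt_irrefl j (hj j h)
    rcases eq_or_ne i j with rfl | h
    · rw [if_neg hjS, if_pos (Finset.mem_insert_self _ _), Function.update_self]
    · simp [Finset.mem_insert, h]

end MixedPartial

/-! ### Weak mixed derivatives -/

section Weak

variable {d : ℕ}

/-- Weak mixed derivatives are unique almost everywhere, by the fundamental lemma of the calculus of
variations. -/
theorem isWeakMixedDeriv_ae_unique {Ω : Set (Fin d → ℝ)} (hΩ : IsOpen Ω) {S : Finset (Fin d)}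
    {F g g' : (Fin d → ℝ) → ℝ} (h : IsWeakMixedDeriv Ω S F g) (h' : IsWeakMixedDeriv Ω S F g') :
    g =ᵐ[volume.restrict Ω] g' := by
  have hL : MemLp (Ω.indicator fun x => g x - g' x) 2 :=
    (memLp_indicator_iff_restrict hΩ.measurableSet).2 (h.1.sub h'.1)
  have hloc : LocallyIntegrable (Ω.indicator fun x => g x - g' x) volume :=
    hL.locallyIntegrable (by norm_num)
  have key := hΩ.ae_eq_zero_of_integral_contDiff_smul_eq_zero (hloc.locallyIntegrableOn Ω)
    fun φ hφ hc hs => by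
      have hcont : Continuous φ := hφ.continuous
      have hφL : MemLp φ 2 (volume.restrict Ω) := (hcont.memLp_of_hasCompactSupport hc).restrict _
      have e1 : ∀ x, φ x • Ω.indicator (fun x => g x - g' x) x
          = Ω.indicator (fun x => g x * φ x - g' x * φ x) x := by
        intro x
        by_cases hx : x ∈ Ω <;> simp [hx]
        ring
      simp_rw [e1]
      have i1 : Integrable (fun x => g x * φ x) (volume.restrict Ω) := h.1.integrable_mul hφL
      have i2 : Integrable (fun x => g' x * φ x) (volume.restrict Ω) := h'.1.integrable_mul hφL
      rw [integral_indicator hΩ.measurableSet, integral_sub i1 i2]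
      have h1 := h.2 φ hφ hc hs
      rw [h'.2 φ hφ hc hs] at h1
      have h2 := mul_left_cancel₀ (pow_ne_zero _ (by norm_num : (-1 : ℝ) ≠ 0)) h1
      rw [h2, sub_self]
  rw [Filter.EventuallyEq, ae_restrict_iff' hΩ.measurableSet]
  filter_upwards [key] with x hx hxΩ
  have := hx hxΩ
  rw [Set.indicator_of_mem hxΩ] at this
  linarith

theorem isWeakMixedDeriv_weakMixedDeriv {Ω : Set (Fin d → ℝ)} {S : Finset (Fin d)}
    {F : (Fin d → ℝ) → ℝ} (h : ∃ g, IsWeakMixedDeriv Ω S F g) :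
    IsWeakMixedDeriv Ω S F (weakMixedDeriv Ω S F) := by
  rw [weakMixedDeriv, dif_pos h]
  exact h.choose_spec

theorem integral_weakMixedDeriv_sq {Ω : Set (Fin d → ℝ)} (hΩ : IsOpen Ω) {S : Finset (Fin d)}
    {F g : (Fin d → ℝ) → ℝ} (h : IsWeakMixedDeriv Ω S F g) :
    ∫ x in Ω, weakMixedDeriv Ω S F x ^ 2 = ∫ x in Ω, g x ^ 2 := by
  refine integral_congr_ae ?_
  filter_upwards [isWeakMixedDeriv_ae_unique hΩ (isWeakMixedDeriv_weakMixedDeriv ⟨g, h⟩) h]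
    with x hx
  rw [hx]

theorem integrable_mul_of_bounded {W ψ : (Fin d → ℝ) → ℝ} (hW : Measurable W)
    (hb : ∃ C, ∀ x, |W x| ≤ C) (hψ : Continuous ψ) (hc : HasCompactSupport ψ) :
    Integrable fun x => W x * ψ x := by
  obtain ⟨C, hC⟩ := hb
  exact (hψ.integrable_of_hasCompactSupport hc).bdd_mul (c := C) hW.aestronglyMeasurable
    (Eventually.of_forall hC)

theorem exists_bound_prod {a : Fin d → ℝ → ℝ} (hb : ∀ i, ∃ C, ∀ x, |a i x| ≤ C) :
    ∃ C, ∀ x : Fin d → ℝ, |∏ i, a i (x i)| ≤ C := by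
  choose C hC using hb
  refine ⟨∏ i, C i, fun x => ?_⟩
  rw [Finset.abs_prod]
  exact Finset.prod_le_prod (fun i _ => abs_nonneg _) fun i _ => hC i _

/-- Integration by parts on the line for a function `u` vanishing off `[-1,2]` that is only
differentiable from the right; the boundary points `-2` and `3` lie outside its support. -/
theorem integral_mul_deriv_of_support {u w φ φ' : ℝ → ℝ} (hu : Continuous u) (hw : Measurable w)
    (hb : ∃ C, ∀ x, |w x| ≤ C) (hd : ∀ x, HasDerivWithinAt u (w x) (Set.Ioi x) x)
    (hu0 : ∀ x ∉ Set.Icc (-1 : ℝ) 2, u x = 0) (hw0 : ∀ x ∉ Set.Icc (-1 : ℝ) 2, w x = 0)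
    (hφ : ∀ x, HasDerivAt φ (φ' x) x) (hφ' : Continuous φ') :
    ∫ x, u x * φ' x = -∫ x, w x * φ x := by
  obtain ⟨C, hC⟩ := hb
  have hφc : Continuous φ := continuous_iff_continuousAt.2 fun x => (hφ x).continuousAt
  have hset : ∀ f : ℝ → ℝ, (∀ x ∉ Set.Icc (-1 : ℝ) 2, f x = 0) →
      ∫ x, f x = ∫ x in (-2 : ℝ)..3, f x := by
    intro f hf
    rw [intervalIntegral.integral_of_le (by norm_num)]
    refine (setIntegral_eq_integral_of_forall_compl_eq_zero fun x hx => hf x fun hx' => hx ?_).symm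
    exact ⟨by linarith [hx'.1], by linarith [hx'.2]⟩
  rw [hset _ fun x hx => by rw [hu0 x hx, zero_mul], hset _ fun x hx => by rw [hw0 x hx, zero_mul],
    intervalIntegral.integral_mul_deriv_eq_deriv_mul_of_hasDeriv_right hu.continuousOn
      hφc.continuousOn (fun x _ => hd x) (fun x _ => (hφ x).hasDerivWithinAt) ?_
      (hφ'.intervalIntegrable _ _), hu0 3 (by norm_num), hu0 (-2) (by norm_num)]
  · ring
  · refine (intervalIntegrable_const (c := C)).mono_fun hw.aestronglyMeasurable
      (Eventually.of_forall fun x => ?_)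
    simp only [Real.norm_eq_abs]
    exact (hC x).trans (le_abs_self C)

/-- Integration by parts in one variable against a product of functions of one variable. -/
theorem integral_prod_mul_partialDeriv {a : Fin d → ℝ → ℝ} {w : ℝ → ℝ} (j : Fin d)
    (ha : ∀ i, Measurable (a i)) (hab : ∀ i, ∃ C, ∀ x, |a i x| ≤ C)
    (hu : Continuous (a j)) (hw : Measurable w) (hwb : ∃ C, ∀ x, |w x| ≤ C)
    (hd : ∀ x, HasDerivWithinAt (a j) (w x) (Set.Ioi x) x)
    (hu0 : ∀ x ∉ Set.Icc (-1 : ℝ) 2, a j x = 0) (hw0 : ∀ x ∉ Set.Icc (-1 : ℝ) 2, w x = 0)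
    {φ : (Fin d → ℝ) → ℝ} (hφ : ContDiff ℝ ∞ φ) (hc : HasCompactSupport φ) :
    ∫ x : Fin d → ℝ, (∏ i, a i (x i)) * partialDeriv j φ x
      = -∫ x : Fin d → ℝ, (∏ i, Function.update a j w i (x i)) * φ x := by
  rcases d with _ | n
  · exact j.elim0
  have hmeas : ∀ b : Fin (n + 1) → ℝ → ℝ, (∀ i, Measurable (b i)) →
      Measurable fun x : Fin (n + 1) → ℝ => ∏ i, b i (x i) := fun b hb =>
    Finset.measurable_prod _ fun i _ => (hb i).comp (measurable_pi_apply i)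
  have ha' : ∀ i, Measurable (Function.update a j w i) := fun i => by
    rcases eq_or_ne i j with rfl | h
    · rwa [Function.update_self]
    · rw [Function.update_of_ne h]; exact ha i
  have hab' : ∀ i, ∃ C, ∀ x, |Function.update a j w i x| ≤ C := fun i => by
    rcases eq_or_ne i j with rfl | h
    · rwa [Function.update_self]
    · rw [Function.update_of_ne h]; exact hab i
  have hi1 := integrable_mul_of_bounded (hmeas a ha) (exists_bound_prod hab)
    (contDiff_partialDeriv j hφ).continuous (hasCompactSupport_partialDeriv j hc)
  have hi2 := integrable_mul_of_bounded (hmeas _ ha') (exists_bound_prod hab') hφ.continuous hc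
  have mp := (volume_preserving_piFinSuccAbove (fun _ : Fin (n + 1) => ℝ) j).symm
  rw [← mp.integral_comp', ← mp.integral_comp', ← integral_neg]
  have hi1' := (mp.integrable_comp_emb (MeasurableEquiv.measurableEmbedding _)).2 hi1
  have hi2' := (mp.integrable_comp_emb (MeasurableEquiv.measurableEmbedding _)).2 hi2
  rw [integral_neg]
  simp only [Function.comp_def] at hi1' hi2'
  change ∫ z, _ ∂(volume.prod volume) = -∫ z, _ ∂(volume.prod volume)
  rw [integral_prod_symm _ hi1', integral_prod_symm _ hi2', ← integral_neg]
  congr 1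
  funext y
  have hsymm : ∀ t, (MeasurableEquiv.piFinSuccAbove (fun _ : Fin (n + 1) => ℝ) j).symm (t, y)
      = j.insertNth t y := fun t => rfl
  simp only [hsymm, Fin.prod_univ_succAbove _ j, Fin.insertNth_apply_same,
    Fin.insertNth_apply_succAbove, Function.update_self,
    Function.update_of_ne (Fin.succAbove_ne j _)]
  have hcurve : ∀ t, HasDerivAt (fun t => φ (j.insertNth t y))
      (partialDeriv j φ (j.insertNth t y)) t := by
    intro t
    have h2 := hasDerivAt_update (j.insertNth 0 y : Fin (n + 1) → ℝ) j t
    have h3 := (hφ.differentiable (by simp)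
      (Function.update (j.insertNth 0 y : Fin (n + 1) → ℝ) j t)).hasFDerivAt
    have h4 := h3.comp_hasDerivAt t h2
    simpa [Function.comp_def, partialDeriv] using h4
  have hins : Continuous fun t => (j.insertNth t y : Fin (n + 1) → ℝ) :=
    Continuous.finInsertNth (A := fun _ => ℝ) j continuous_id continuous_const
  have hcont : Continuous fun t => partialDeriv j φ (j.insertNth t y) :=
    (contDiff_partialDeriv j hφ).continuous.comp hins
  have key := integral_mul_deriv_of_support hu hw hwb hd hu0 hw0 hcurve hcont
  have e1 : ∀ t, (a j t * ∏ i, a (j.succAbove i) (y i)) * partialDeriv j φ (j.insertNth t y)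
      = (∏ i, a (j.succAbove i) (y i)) * (a j t * partialDeriv j φ (j.insertNth t y)) :=
    fun t => by ring
  have e2 : ∀ t, (w t * ∏ i, a (j.succAbove i) (y i)) * φ (j.insertNth t y)
      = (∏ i, a (j.succAbove i) (y i)) * (w t * φ (j.insertNth t y)) := fun t => by ring
  simp_rw [e1, e2]
  rw [integral_const_mul, integral_const_mul, key, mul_neg]

/-- The product of functions `u i` of one variable each has the weak mixed derivatives in which the
factors of the variables in `S` are differentiated. -/
theorem integral_prod_mul_mixedPartial {u w : Fin d → ℝ → ℝ} (S : Finset (Fin d))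
    (hu : ∀ i, Continuous (u i)) (hub : ∀ i, ∃ C, ∀ x, |u i x| ≤ C)
    (hw : ∀ i, Measurable (w i)) (hwb : ∀ i, ∃ C, ∀ x, |w i x| ≤ C)
    (hd : ∀ i x, HasDerivWithinAt (u i) (w i x) (Set.Ioi x) x)
    (hu0 : ∀ i, ∀ x ∉ Set.Icc (-1 : ℝ) 2, u i x = 0)
    (hw0 : ∀ i, ∀ x ∉ Set.Icc (-1 : ℝ) 2, w i x = 0)
    {φ : (Fin d → ℝ) → ℝ} (hφ : ContDiff ℝ ∞ φ) (hc : HasCompactSupport φ) :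
    ∫ x : Fin d → ℝ, (∏ i, u i (x i)) * mixedPartial S φ x
      = (-1) ^ S.card * ∫ x : Fin d → ℝ, (∏ i, (if i ∈ S then w i else u i) (x i)) * φ x := by
  induction S using Finset.induction_on_max generalizing φ with
  | empty => simp [mixedPartial_empty]
  | insert j S hj ih =>
    have hjS : j ∉ S := fun h => lt_irrefl j (hj j h)
    rw [mixedPartial_insert hj hφ, ih (contDiff_partialDeriv j hφ)
      (hasCompactSupport_partialDeriv j hc),
      integral_prod_mul_partialDeriv (w := w j) j ?_ ?_ ?_ (hw j) (hwb j) ?_ ?_ (hw0 j) hφ hc,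
      Finset.card_insert_of_notMem hjS, pow_succ]
    · rw [mul_assoc, neg_one_mul]
      congr 4
      funext x
      congr 1
      refine Finset.prod_congr rfl fun i _ => ?_
      rcases eq_or_ne i j with rfl | h
      · simp
      · simp [Finset.mem_insert, h]
    · intro i
      split_ifs
      exacts [hw i, (hu i).measurable]
    · intro i
      split_ifs
      exacts [hwb i, hub i]
    · rw [if_neg hjS]; exact hu j
    · rw [if_neg hjS]; exact hd j
    · rw [if_neg hjS]; exact hu0 j

end Weak

/-! ### Pointwise properties of the functions of an RKHS -/

open scoped RealInnerProductSpace

section Pointwise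

theorem rkhs_continuous {X : Type*} [TopologicalSpace X] {k : X → X → ℝ}
    [Fact (kernelMatrix k).PosSemidef] (hk : Continuous fun p : X × X => k p.1 p.2)
    (h : RKHS.OfKernel (kernelMatrix k)) : Continuous h := by
  have hsec : Continuous (kerSection k) := by
    refine continuous_iff_continuousAt.2 fun x => ?_
    rw [ContinuousAt, tendsto_iff_norm_sub_tendsto_zero]
    have e : ∀ y, ‖kerSection k y - kerSection k x‖ = √(k y y - 2 * k y x + k x x) := fun y => by
      rw [← Real.sqrt_sq (norm_nonneg (kerSection k y - kerSection k x)), norm_sub_sq_real,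
        ← real_inner_self_eq_norm_sq, ← real_inner_self_eq_norm_sq,
        inner_kerSection_kerSection, inner_kerSection_kerSection, inner_kerSection_kerSection]
    simp_rw [e]
    have h1 : Continuous fun y => √(k y y - 2 * k y x + k x x) := by
      have c1 : Continuous fun y => k y y := hk.comp (continuous_id.prodMk continuous_id)
      have c2 : Continuous fun y => k y x := hk.comp (continuous_id.prodMk continuous_const)
      fun_prop
    convert h1.tendsto x using 2
    rw [show k x x - 2 * k x x + k x x = 0 by ring, Real.sqrt_zero]
  have e : (h : X → ℝ) = fun x => ⟪kerSection k x, h⟫ := funext fun x => (inner_kerSection x h).symm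
  rw [e]
  exact hsec.inner continuous_const

theorem rkhs_abs_apply_le {X : Type*} {k : X → X → ℝ} [Fact (kernelMatrix k).PosSemidef]
    (h : RKHS.OfKernel (kernelMatrix k)) (x : X) : |h x| ≤ √(k x x) * ‖h‖ := by
  rw [← inner_kerSection]
  refine (abs_real_inner_le_norm _ _).trans_eq ?_
  rw [← inner_kerSection_kerSection (k := k), real_inner_self_eq_norm_sq,
    Real.sqrt_sq (norm_nonneg _)]

/-- Functions of the RKHS vanish where the diagonal of the kernel does. -/
theorem rkhs_apply_eq_zero {X : Type*} {k : X → X → ℝ} [Fact (kernelMatrix k).PosSemidef]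
    (h : RKHS.OfKernel (kernelMatrix k)) {x : X} (hx : k x x = 0) : h x = 0 := by
  have := rkhs_abs_apply_le h x
  rw [hx, Real.sqrt_zero, zero_mul] at this
  exact abs_nonpos_iff.1 this

end Pointwise

/-! ### Extension of the Brownian space to `ℝ^d` -/

section BrownianToRestrict

variable {d : ℕ} (I₀ I₁ : Finset (Fin d))

instance : Fact (kernelMatrix (brownianKernel I₀ I₁)).PosSemidef :=
  ⟨brownianKernel_posSemidef I₀ I₁⟩

theorem continuous_brownianKernel :
    Continuous fun p : Cube d × Cube d => brownianKernel I₀ I₁ p.1 p.2 := by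
  unfold brownianKernel brownian1
  refine continuous_finsetProd _ fun j _ => ?_
  split_ifs <;> fun_prop

theorem brownianKernel_self_mem (x : Cube d) :
    0 ≤ brownianKernel I₀ I₁ x x ∧ brownianKernel I₀ I₁ x x ≤ 1 :=
  ⟨Finset.prod_nonneg fun j _ => (brownian1_self_mem I₀ I₁ j (x j)).1,
    Finset.prod_le_one (fun j _ => (brownian1_self_mem I₀ I₁ j (x j)).1)
      fun j _ => (brownian1_self_mem I₀ I₁ j (x j)).2⟩

/-- The product retraction of `ℝ^d` onto the cube. -/
def foldCube (x : Fin d → ℝ) : Cube d := fun j => fold I₀ I₁ j (x j)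

theorem continuous_foldCube : Continuous (foldCube I₀ I₁) :=
  continuous_pi fun j => (continuous_fold I₀ I₁ j).comp (continuous_apply j)

/-- The mixed derivative `∂^S` of the extended section `k(·, y) ∘ foldCube` of the Brownian
kernel. -/
def extMixed (S : Finset (Fin d)) (y : Cube d) (x : Fin d → ℝ) : ℝ :=
  ∏ i, (if i ∈ S then extSlope I₀ I₁ i (y i) else extSection I₀ I₁ i (y i)) (x i)

theorem memLp_fintype_prod {a : Fin d → ℝ → ℝ} (ha : ∀ i, MemLp (a i) 2) :
    MemLp (fun x : Fin d → ℝ => ∏ i, a i (x i)) 2 := by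
  have hm : AEStronglyMeasurable (fun x : Fin d → ℝ => ∏ i, a i (x i)) volume := by
    refine Finset.aestronglyMeasurable_fun_prod _ fun i _ => ?_
    exact (ha i).1.comp_quasiMeasurePreserving (Measure.quasiMeasurePreserving_eval _ i)
  rw [memLp_two_iff_integrable_sq hm]
  simp_rw [← Finset.prod_pow]
  exact Integrable.fintype_prod fun i => (ha i).integrable_sq

theorem memLp_extMixed (S : Finset (Fin d)) (y : Cube d) : MemLp (extMixed I₀ I₁ S y) 2 :=
  memLp_fintype_prod fun i => by
    split_ifs
    exacts [memLp_extSlope I₀ I₁ i _, memLp_extSection I₀ I₁ i _]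

/-- The map `k(·, y) ↦ ∂^S (k(·, y) ∘ foldCube)` is bounded from the Brownian space to `L²(ℝ^d)`,
because it is so in each variable. -/
theorem kernelForm_extMixed_le (S : Finset (Fin d)) (v : Cube d →₀ ℝ) :
    kernelForm (fun y z => ∫ x, extMixed I₀ I₁ S y x * extMixed I₀ I₁ S z x) v v
      ≤ 3 ^ d * kernelForm (brownianKernel I₀ I₁) v v := by
  let a : Fin d → unitInterval → ℝ → ℝ := fun i y =>
    if i ∈ S then extSlope I₀ I₁ i y else extSection I₀ I₁ i y
  have h := kernelForm_prod_le (A := fun i y z => ∫ t, a i y t * a i z t)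
    (B := fun i y z => brownian1 I₀ I₁ i (y : ℝ) (z : ℝ)) (C := fun _ => 3)
    (fun i => isPSD_integral fun y => by
      simp only [a]
      split_ifs
      exacts [memLp_extSlope I₀ I₁ i y, memLp_extSection I₀ I₁ i y])
    (fun i => isPSD_brownian1 I₀ I₁ i)
    (fun i => by
      simp only [a]
      split_ifs
      exacts [isPSD_sub_integral_extSlope I₀ I₁ i, isPSD_sub_integral_extSection I₀ I₁ i]) v
  simp only [Finset.prod_const, Finset.card_univ, Fintype.card_fin] at h
  refine le_trans (le_of_eq ?_) h
  congr 1
  funext y z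
  rw [← integral_fintype_prod_volume_eq_prod]
  simp only [extMixed, Finset.prod_mul_distrib, a]

theorem exists_abs_extSection_le (j : Fin d) (y : unitInterval) :
    ∃ C, ∀ x, |extSection I₀ I₁ j y x| ≤ C := by
  obtain ⟨C, hC⟩ := (continuous_extSection I₀ I₁ j y).bounded_above_of_compact_support
    (hasCompactSupport_extSection I₀ I₁ j y)
  exact ⟨C, hC⟩

theorem integral_extMixed_mul_mixedPartial (S : Finset (Fin d)) (y : Cube d)
    {φ : (Fin d → ℝ) → ℝ} (hφ : ContDiff ℝ ∞ φ) (hc : HasCompactSupport φ) :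
    ∫ x, brownianKernel I₀ I₁ (foldCube I₀ I₁ x) y * mixedPartial S φ x
      = (-1) ^ S.card * ∫ x, extMixed I₀ I₁ S y x * φ x := by
  have h := integral_prod_mul_mixedPartial (u := fun i => extSection I₀ I₁ i (y i))
    (w := fun i => extSlope I₀ I₁ i (y i)) S (fun i => continuous_extSection I₀ I₁ i _)
    (fun i => exists_abs_extSection_le I₀ I₁ i _) (fun i => measurable_extSlope I₀ I₁ i _)
    (fun i => ⟨1, abs_extSlope_le I₀ I₁ i _⟩)
    (fun i => hasDerivWithinAt_extSection I₀ I₁ i _)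
    (fun i x hx => extSection_eq_zero I₀ I₁ i _ hx)
    (fun i x hx => extSlope_eq_zero I₀ I₁ i _ fun h => hx ⟨h.1, h.2.le⟩) hφ hc
  exact h

/-- The `L²` function `∑ v y ∂^S (k(·, y) ∘ foldCube)`. -/
def mixedSum (S : Finset (Fin d)) :
    (Cube d →₀ ℝ) →ₗ[ℝ] Lp ℝ 2 (volume : Measure (Fin d → ℝ)) :=
  Finsupp.linearCombination ℝ fun y => (memLp_extMixed I₀ I₁ S y).toLp

theorem inner_toLp {α : Type*} [MeasurableSpace α] {μ : Measure α} {f g : α → ℝ}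
    (hf : MemLp f 2 μ) (hg : MemLp g 2 μ) : ⟪hf.toLp, hg.toLp⟫ = ∫ x, f x * g x ∂μ := by
  rw [L2.inner_def]
  refine integral_congr_ae ?_
  filter_upwards [hf.coeFn_toLp, hg.coeFn_toLp] with x h1 h2
  rw [h1, h2]
  simp [mul_comm]

theorem norm_mixedSum_le (S : Finset (Fin d)) (v : Cube d →₀ ℝ) :
    ‖mixedSum I₀ I₁ S v‖ ≤ √(3 ^ d) * ‖kerSum (brownianKernel I₀ I₁) v‖ := by
  refine le_of_sq_le_sq ?_ (by positivity)
  rw [mul_pow, Real.sq_sqrt (by positivity), norm_kerSum_sq]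
  refine le_trans (le_of_eq ?_) (kernelForm_extMixed_le I₀ I₁ S v)
  rw [← real_inner_self_eq_norm_sq, mixedSum, Finsupp.linearCombination_apply, Finsupp.sum_inner,
    kernelForm]
  refine Finset.sum_congr rfl fun y _ => ?_
  beta_reduce
  rw [Finsupp.inner_sum]
  refine Finset.sum_congr rfl fun z _ => ?_
  simp only [inner_smul_left, inner_smul_right, inner_toLp, RCLike.conj_to_real]
  ring

/-- The weak derivative `∂^S (h ∘ foldCube)` of an element `h` of the Brownian space, as the
continuous extension of `mixedSum`. -/
def mixedExt (S : Finset (Fin d)) : RKHS.OfKernel (kernelMatrix (brownianKernel I₀ I₁)) →L[ℝ]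
    Lp ℝ 2 (volume : Measure (Fin d → ℝ)) :=
  (mixedSum I₀ I₁ S).extendOfNorm (kerSum (brownianKernel I₀ I₁))

theorem mixedExt_kerSum (S : Finset (Fin d)) (v : Cube d →₀ ℝ) :
    mixedExt I₀ I₁ S (kerSum (brownianKernel I₀ I₁) v) = mixedSum I₀ I₁ S v :=
  LinearMap.extendOfNorm_eq denseRange_kerSum ⟨_, norm_mixedSum_le I₀ I₁ S⟩ v

theorem norm_mixedExt_le (S : Finset (Fin d))
    (h : RKHS.OfKernel (kernelMatrix (brownianKernel I₀ I₁))) :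
    ‖mixedExt I₀ I₁ S h‖ ≤ √(3 ^ d) * ‖h‖ :=
  LinearMap.norm_extendOfNorm_apply_le denseRange_kerSum _ (norm_mixedSum_le I₀ I₁ S) h

/-- Both sides of the defining identity of the weak derivative are continuous in `h`, and for a
kernel section it is the integration by parts `integral_extMixed_mul_mixedPartial`. -/
theorem isWeakMixedDeriv_mixedExt (S : Finset (Fin d))
    (h : RKHS.OfKernel (kernelMatrix (brownianKernel I₀ I₁))) :
    IsWeakMixedDeriv Set.univ S (fun x => h (foldCube I₀ I₁ x)) (mixedExt I₀ I₁ S h) := by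
  refine ⟨(Lp.memLp _).restrict _, fun φ hφ hc _ => ?_⟩
  rw [Measure.restrict_univ]
  set ψ := mixedPartial S φ with hψ
  have hψc : Continuous ψ := (contDiff_mixedPartial S hφ).continuous
  have hψs : HasCompactSupport ψ := hasCompactSupport_mixedPartial S hφ hc
  have hφL : MemLp φ 2 := hφ.continuous.memLp_of_hasCompactSupport hc
  have hcont : ∀ h : RKHS.OfKernel (kernelMatrix (brownianKernel I₀ I₁)),
      Continuous fun x => h (foldCube I₀ I₁ x) := fun h =>
    (rkhs_continuous (continuous_brownianKernel I₀ I₁) h).comp (continuous_foldCube I₀ I₁)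
  have hint : ∀ h : RKHS.OfKernel (kernelMatrix (brownianKernel I₀ I₁)),
      Integrable fun x => h (foldCube I₀ I₁ x) * ψ x := fun h =>
    ((hcont h).mul hψc).integrable_of_hasCompactSupport hψs.mul_left
  have hbd : ∀ h : RKHS.OfKernel (kernelMatrix (brownianKernel I₀ I₁)), ∀ x,
      |h (foldCube I₀ I₁ x)| ≤ ‖h‖ := fun h x => by
    refine (rkhs_abs_apply_le h _).trans (mul_le_of_le_one_left (norm_nonneg _) ?_)
    rw [Real.sqrt_le_one]
    exact (brownianKernel_self_mem I₀ I₁ _).2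
  let L : RKHS.OfKernel (kernelMatrix (brownianKernel I₀ I₁)) →ₗ[ℝ] ℝ :=
    { toFun := fun h => ∫ x, h (foldCube I₀ I₁ x) * ψ x
      map_add' := fun h h' => by
        rw [← integral_add (hint h) (hint h')]
        simp [add_mul]
      map_smul' := fun c h => by
        simp [mul_assoc, integral_const_mul] }
  have hL : Continuous L := by
    refine AddMonoidHomClass.continuous_of_bound L (∫ x, |ψ x|) fun h => ?_
    calc ‖L h‖ ≤ ∫ x, |h (foldCube I₀ I₁ x) * ψ x| := abs_integral_le_integral_abs
      _ ≤ ∫ x, |ψ x| * ‖h‖ := by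
          refine integral_mono (hint h).abs
            ((hψc.integrable_of_hasCompactSupport hψs).abs.mul_const _) fun x => ?_
          simp only [abs_mul]
          rw [mul_comm]
          exact mul_le_mul_of_nonneg_left (hbd h x) (abs_nonneg _)
      _ = (∫ x, |ψ x|) * ‖h‖ := integral_mul_const _ _
  have hR : ∀ g : Lp ℝ 2 (volume : Measure (Fin d → ℝ)), ∫ x, g x * φ x = ⟪g, hφL.toLp⟫ := by
    intro g
    rw [← inner_toLp (Lp.memLp g) hφL, Lp.toLp_coeFn]
  rw [hR]
  change L h = (-1) ^ S.card * ⟪mixedExt I₀ I₁ S h, hφL.toLp⟫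
  refine denseRange_kerSum.induction_on (p := fun h =>
    L h = (-1) ^ S.card * ⟪mixedExt I₀ I₁ S h, hφL.toLp⟫) h
    (isClosed_eq hL (by fun_prop)) fun v => ?_
  rw [mixedExt_kerSum, mixedSum, Finsupp.linearCombination_apply, Finsupp.sum_inner,
    Finsupp.mul_sum]
  change ∫ x, kerSum (brownianKernel I₀ I₁) v (foldCube I₀ I₁ x) * ψ x = _
  simp only [kerSum_apply, Finsupp.sum, Finset.sum_mul]
  rw [integral_finsetSum]
  · refine Finset.sum_congr rfl fun y _ => ?_
    simp only [inner_smul_left, inner_toLp, RCLike.conj_to_real, mul_assoc, integral_const_mul]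
    rw [integral_extMixed_mul_mixedPartial I₀ I₁ S y hφ hc]
    ring
  · intro y _
    simp only [mul_assoc]
    refine Integrable.const_mul ?_ _
    refine (Continuous.mul ?_ hψc).integrable_of_hasCompactSupport hψs.mul_left
    exact (continuous_brownianKernel I₀ I₁).comp
      ((continuous_foldCube I₀ I₁).prodMk continuous_const)

theorem h1mixNorm_nonneg (Ω : Set (Fin d → ℝ)) (F : (Fin d → ℝ) → ℝ) : 0 ≤ h1mixNorm Ω F :=
  Real.sqrt_nonneg _

/-- The extension of `h` is `h ∘ foldCube`: it vanishes where the diagonal of the kernel does, and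
each of its `2 ^ d` weak mixed derivatives is bounded in `L²` by `3 ^ d ‖h‖²`. -/
theorem brownianSpace_embeds_sobolevRestrict :
    (brownianSpace I₀ I₁).Embeds (sobolevRestrict I₀ I₁) := by
  refine ⟨√(2 ^ d * 3 ^ d), by positivity, ?_⟩
  rintro _ ⟨h, rfl⟩
  set F : (Fin d → ℝ) → ℝ := fun x => h (foldCube I₀ I₁ x) with hF
  have hFc : Continuous F :=
    (rkhs_continuous (continuous_brownianKernel I₀ I₁) h).comp (continuous_foldCube I₀ I₁)
  have hzero : ∀ (x : Fin d → ℝ) (j : Fin d),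
      brownian1 I₀ I₁ j (fold I₀ I₁ j (x j)) (fold I₀ I₁ j (x j)) = 0 → F x = 0 := by
    intro x j hj
    exact rkhs_apply_eq_zero h (Finset.prod_eq_zero (Finset.mem_univ j) hj)
  have hFs : HasCompactSupport F := by
    refine HasCompactSupport.intro (isCompact_univ_pi fun _ => isCompact_Icc (a := (-1 : ℝ))
      (b := 2)) fun x hx => ?_
    simp only [Set.mem_univ_pi, not_forall] at hx
    obtain ⟨j, hj⟩ := hx
    exact hzero x j (extSection_eq_zero I₀ I₁ j (fold I₀ I₁ j (x j)) hj)
  have hmem : MemConstrained I₀ I₁ F := by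
    refine ⟨hFc, ⟨(hFc.memLp_of_hasCompactSupport hFs).restrict _, fun S =>
      ⟨_, isWeakMixedDeriv_mixedExt I₀ I₁ S h⟩⟩, ?_⟩
    rintro x (⟨i, hi, hx⟩ | ⟨i, hi, hx⟩)
    · refine hzero x i ?_
      rw [fold_eq_zero _ _ _ hi hx]
      exact brownian1_zero I₀ I₁ i hi le_rfl
    · refine hzero x i ?_
      rw [fold_eq_one _ _ _ hi hx]
      exact brownian1_one I₀ I₁ i hi le_rfl
  have hres : ∀ x : Cube d, F (fun j => (x j : ℝ)) = h x := fun x =>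
    congrArg h (funext fun j => fold_coe I₀ I₁ j (x j))
  refine ⟨⟨F, hmem, hres⟩, ?_⟩
  have hn : (brownianSpace I₀ I₁).norm ⇑h = ‖h‖ := rkhs_norm_coe _ h
  change _ ≤ _ * (brownianSpace I₀ I₁).norm ⇑h
  rw [hn]
  have hbdd : BddBelow {r | ∃ F, MemConstrained I₀ I₁ F ∧
      (∀ x : Cube d, F (fun j => (x j : ℝ)) = h x) ∧ h1mixNorm Set.univ F = r} :=
    ⟨0, by rintro _ ⟨F, -, -, rfl⟩; exact h1mixNorm_nonneg _ _⟩
  refine (csInf_le hbdd ⟨F, hmem, hres, rfl⟩).trans ?_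
  refine Real.sqrt_le_iff.2 ⟨by positivity, ?_⟩
  rw [mul_pow, Real.sq_sqrt (by positivity)]
  have hS : ∀ S : Finset (Fin d), ∫ x in Set.univ, weakMixedDeriv Set.univ S F x ^ 2
      ≤ 3 ^ d * ‖h‖ ^ 2 := by
    intro S
    rw [integral_weakMixedDeriv_sq isOpen_univ (isWeakMixedDeriv_mixedExt I₀ I₁ S h),
      Measure.restrict_univ]
    have e : ∫ x, mixedExt I₀ I₁ S h x ^ 2 = ‖mixedExt I₀ I₁ S h‖ ^ 2 := by
      rw [← real_inner_self_eq_norm_sq, L2.inner_def]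
      simp [sq]
    rw [e]
    have h1 := norm_mixedExt_le I₀ I₁ S h
    have h2 : (√(3 ^ d) * ‖h‖) ^ 2 = 3 ^ d * ‖h‖ ^ 2 := by
      rw [mul_pow, Real.sq_sqrt (by positivity)]
    rw [← h2]
    exact pow_le_pow_left₀ (norm_nonneg _) h1 2
  refine (Finset.sum_le_sum fun S _ => hS S).trans_eq ?_
  simp [mul_assoc]

end BrownianToRestrict

/-! ### Restriction to the cube -/

section Restriction

variable {d : ℕ}

theorem isOpen_openCube : IsOpen (openCube d) :=
  isOpen_set_pi Set.finite_univ fun _ _ => isOpen_Ioo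

theorem extendCube_of_mem {f : Cube d → ℝ} {F : (Fin d → ℝ) → ℝ}
    (h : ∀ x : Cube d, F (fun j => (x j : ℝ)) = f x) {x : Fin d → ℝ} (hx : x ∈ openCube d) :
    extendCube f x = F x := by
  rw [extendCube, ← h]
  congr 1
  funext j
  have := hx j (Set.mem_univ j)
  simp [Set.coe_projIcc, this.1.le, this.2.le]

theorem IsWeakMixedDeriv.restrict_openCube {S : Finset (Fin d)} {f : Cube d → ℝ}
    {F g : (Fin d → ℝ) → ℝ} (h : ∀ x : Cube d, F (fun j => (x j : ℝ)) = f x)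
    (hg : IsWeakMixedDeriv Set.univ S F g) :
    IsWeakMixedDeriv (openCube d) S (extendCube f) g := by
  have hm := (isOpen_openCube (d := d)).measurableSet
  refine ⟨?_, fun φ hφ hc hs => ?_⟩
  · have := hg.1
    rw [Measure.restrict_univ] at this
    exact this.restrict _
  have h1 := hg.2 φ hφ hc (Set.subset_univ _)
  rw [Measure.restrict_univ] at h1
  have hs' := (tsupport_mixedPartial_subset S hφ).trans hs
  rw [setIntegral_congr_fun hm (g := fun x => F x * mixedPartial S φ x)
      fun x hx => by simp only [extendCube_of_mem h hx],
    setIntegral_eq_integral_of_forall_compl_eq_zero, h1,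
    setIntegral_eq_integral_of_forall_compl_eq_zero]
  · intro x hx
    rw [image_eq_zero_of_notMem_tsupport fun hx' => hx (hs hx'), mul_zero]
  · intro x hx
    rw [image_eq_zero_of_notMem_tsupport fun hx' => hx (hs' hx'), mul_zero]

/-- Weak derivatives on `ℝ^d` restrict to weak derivatives on the open cube. -/
theorem sobolevRestrict_embeds_sobolevCube (I₀ I₁ : Finset (Fin d)) :
    (sobolevRestrict I₀ I₁).Embeds (sobolevCube I₀ I₁) := by
  refine ⟨1, one_pos, ?_⟩
  intro f hf
  have hm := (isOpen_openCube (d := d)).measurableSet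
  rw [one_mul]
  constructor
  · obtain ⟨F, ⟨hc, ⟨hL, hw⟩, hb⟩, hF⟩ := hf
    refine ⟨?_, ⟨?_, fun S => ?_⟩, fun x hx => ?_⟩
    · rw [show f = fun x : Cube d => F fun j => (x j : ℝ) from funext fun x => (hF x).symm]
      fun_prop
    · rw [Measure.restrict_univ] at hL
      refine (memLp_congr_ae ?_).2 (hL.restrict (openCube d))
      filter_upwards [ae_restrict_mem hm] with x hx using extendCube_of_mem hF hx
    · obtain ⟨g, hg⟩ := hw S
      exact ⟨g, hg.restrict_openCube hF⟩
    · rw [← hF]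
      refine hb _ ?_
      rcases hx with ⟨i, hi, hx⟩ | ⟨i, hi, hx⟩
      · exact Or.inl ⟨i, hi, by simp [hx]⟩
      · exact Or.inr ⟨i, hi, by simp [hx]⟩
  · refine le_csInf ?_ ?_
    · obtain ⟨F, h1, h2⟩ := hf
      exact ⟨_, F, h1, h2, rfl⟩
    · rintro _ ⟨F, ⟨hc, ⟨hL, hw⟩, hb⟩, hF, rfl⟩
      refine Real.sqrt_le_sqrt (Finset.sum_le_sum fun S _ => ?_)
      have hg := isWeakMixedDeriv_weakMixedDeriv (hw S)
      rw [integral_weakMixedDeriv_sq isOpen_openCube (hg.restrict_openCube hF)]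
      have h1 := hg.1
      rw [Measure.restrict_univ] at h1 ⊢
      exact setIntegral_le_integral h1.integrable_sq (Eventually.of_forall fun x => sq_nonneg _)

end Restriction

/-! ### The integral representation of constrained Sobolev functions -/

section Bump

/-- The distance of the supports of the bump densities from the boundary of `[0,1]`. -/
def bumpWidth (n : ℕ) : ℝ := 1 / ((n : ℝ) + 3)

theorem bumpWidth_pos (n : ℕ) : 0 < bumpWidth n := by unfold bumpWidth; positivity

theorem bumpWidth_le (n : ℕ) : bumpWidth n ≤ 1 / 3 := by
  unfold bumpWidth
  exact one_div_le_one_div_of_le (by norm_num) (by have := n.cast_nonneg (α := ℝ); linarith)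

theorem tendsto_bumpWidth : Tendsto bumpWidth atTop (𝓝 0) := by
  unfold bumpWidth
  exact tendsto_const_nhds.div_atTop (tendsto_atTop_add_const_right _ _ tendsto_natCast_atTop_atTop)

/-- A smooth bump supported in the interior of `[0,1]` within `2 * bumpWidth n` of `z ∈ [0,1]`. The
centre `z + (1 - 2 z) * bumpWidth n` is the image of `z` under the affine map of `[0,1]` onto
`[bumpWidth n, 1 - bumpWidth n]`. -/
def bumpAt (z : unitInterval) (n : ℕ) : ContDiffBump ((z : ℝ) + (1 - 2 * z) * bumpWidth n) where
  rIn := bumpWidth n / 4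
  rOut := bumpWidth n / 2
  rIn_pos := by have := bumpWidth_pos n; positivity
  rIn_lt_rOut := by have := bumpWidth_pos n; linarith

/-- The probability density with the profile `bumpAt z n`; it approximates the point mass at `z`. -/
def bumpDensity (z : unitInterval) (n : ℕ) : ℝ → ℝ := (bumpAt z n).normed volume

variable (z : unitInterval) (n : ℕ)

theorem contDiff_bumpDensity : ContDiff ℝ ∞ (bumpDensity z n) := (bumpAt z n).contDiff_normed

theorem continuous_bumpDensity : Continuous (bumpDensity z n) := (bumpAt z n).continuous_normed

theorem bumpDensity_nonneg (t : ℝ) : 0 ≤ bumpDensity z n t := (bumpAt z n).nonneg_normed t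

theorem integral_bumpDensity : ∫ t, bumpDensity z n t = 1 := (bumpAt z n).integral_normed

theorem integrable_bumpDensity : Integrable (bumpDensity z n) := (bumpAt z n).integrable_normed

theorem mem_of_bumpDensity_ne_zero {t : ℝ} (h : bumpDensity z n t ≠ 0) :
    (bumpWidth n / 2 < t ∧ t < 1 - bumpWidth n / 2) ∧ |t - z| < 2 * bumpWidth n := by
  have hs : t ∈ Function.support ((bumpAt z n).normed volume) := h
  rw [(bumpAt z n).support_normed_eq, Metric.mem_ball, Real.dist_eq, abs_lt] at hs
  have h0 := z.2.1
  have h1 := z.2.2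
  have hw := bumpWidth_pos n
  have hw' := bumpWidth_le n
  change -(bumpWidth n / 2) < _ ∧ _ < bumpWidth n / 2 at hs
  obtain ⟨ha, hb⟩ := hs
  refine ⟨⟨?_, ?_⟩, abs_lt.2 ⟨?_, ?_⟩⟩ <;> nlinarith

/-- The distribution function of `bumpDensity z n`. -/
def bumpCdf (t : ℝ) : ℝ := ∫ s in (0 : ℝ)..t, bumpDensity z n s

theorem hasDerivAt_bumpCdf (t : ℝ) : HasDerivAt (bumpCdf z n) (bumpDensity z n t) t :=
  (continuous_bumpDensity z n).integral_hasStrictDerivAt 0 t |>.hasDerivAt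

theorem deriv_bumpCdf : deriv (bumpCdf z n) = bumpDensity z n :=
  funext fun t => (hasDerivAt_bumpCdf z n t).deriv

theorem contDiff_bumpCdf : ContDiff ℝ ∞ (bumpCdf z n) := by
  rw [contDiff_infty_iff_deriv, deriv_bumpCdf]
  exact ⟨fun t => (hasDerivAt_bumpCdf z n t).differentiableAt, contDiff_bumpDensity z n⟩

theorem bumpCdf_eq_zero {t : ℝ} (h : ∀ s ≤ t, bumpDensity z n s = 0) : bumpCdf z n t = 0 := by
  unfold bumpCdf
  have h0 : ∀ s ≤ (0 : ℝ), bumpDensity z n s = 0 := fun s hs => by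
    by_contra hne
    have := (mem_of_bumpDensity_ne_zero z n hne).1.1
    linarith [bumpWidth_pos n]
  rw [intervalIntegral.integral_congr (g := fun _ => 0), intervalIntegral.integral_zero]
  intro s hs
  rcases le_total t 0 with ht | ht
  · exact h0 s ((Set.mem_uIcc.1 hs).elim (fun hs => by linarith [hs.2]) fun hs => hs.2)
  · exact h s ((Set.mem_uIcc.1 hs).elim (fun hs => hs.2) fun hs => by linarith [hs.2])

theorem bumpCdf_eq_one {t : ℝ} (h : ∀ s ≥ t, bumpDensity z n s = 0) : bumpCdf z n t = 1 := by
  have h0 : ∀ s ≤ (0 : ℝ), bumpDensity z n s = 0 := fun s hs => by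
    by_contra hne
    have := (mem_of_bumpDensity_ne_zero z n hne).1.1
    linarith [bumpWidth_pos n]
  have ht : 0 ≤ t := by
    by_contra! ht
    have : ∫ s, bumpDensity z n s = 0 := by
      rw [← integral_zero ℝ ℝ (μ := volume)]
      congr 1
      funext s
      rcases le_total s 0 with hs | hs
      · exact h0 s hs
      · exact h s (by linarith)
    rw [integral_bumpDensity] at this
    exact one_ne_zero this
  rw [bumpCdf, intervalIntegral.integral_of_le ht, ← integral_bumpDensity z n]
  refine setIntegral_eq_integral_of_forall_compl_eq_zero fun s hs => ?_
  by_cases hs0 : s ≤ 0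
  · exact h0 s hs0
  · exact h s (le_of_not_ge fun hst => hs ⟨not_le.1 hs0, hst⟩)

theorem bumpCdf_mem (t : ℝ) : 0 ≤ bumpCdf z n t ∧ bumpCdf z n t ≤ 1 := by
  rcases le_total t 0 with ht | ht
  · rw [bumpCdf_eq_zero z n fun s hs => ?_]
    · norm_num
    · by_contra hne
      have := (mem_of_bumpDensity_ne_zero z n hne).1.1
      linarith [bumpWidth_pos n]
  · rw [bumpCdf, intervalIntegral.integral_of_le ht]
    refine ⟨integral_nonneg fun s => bumpDensity_nonneg z n s, ?_⟩
    rw [← integral_bumpDensity z n]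
    exact setIntegral_le_integral (integrable_bumpDensity z n)
      (Eventually.of_forall fun s => bumpDensity_nonneg z n s)

theorem bumpCdf_eq_zero_of_le {t : ℝ} (ht : t ≤ bumpWidth n / 2) : bumpCdf z n t = 0 :=
  bumpCdf_eq_zero z n fun s hs => by
    by_contra hne
    have := (mem_of_bumpDensity_ne_zero z n hne).1.1
    linarith

theorem bumpCdf_eq_one_of_ge {t : ℝ} (ht : 1 - bumpWidth n / 2 ≤ t) : bumpCdf z n t = 1 :=
  bumpCdf_eq_one z n fun s hs => by
    by_contra hne
    have := (mem_of_bumpDensity_ne_zero z n hne).1.2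
    linarith

theorem tendsto_bumpCdf {t : ℝ} (ht : t ≠ z) :
    Tendsto (fun n => bumpCdf z n t) atTop (𝓝 (if (z : ℝ) < t then 1 else 0)) := by
  have hpos : 0 < |t - z| / 2 := by have := abs_pos.2 (sub_ne_zero.2 ht); positivity
  have hev : ∀ᶠ n in atTop, bumpWidth n < |t - z| / 2 := tendsto_bumpWidth.eventually_lt_const hpos
  refine tendsto_const_nhds.congr' ?_
  filter_upwards [hev] with n hn
  split_ifs with h
  · rw [abs_of_pos (by linarith)] at hn
    refine (bumpCdf_eq_one z n fun s hs => ?_).symm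
    by_contra hne
    have := (abs_lt.1 (mem_of_bumpDensity_ne_zero z n hne).2).2
    linarith
  · have h' : t < z := lt_of_le_of_ne (not_lt.1 h) ht
    rw [abs_of_neg (by linarith)] at hn
    refine (bumpCdf_eq_zero z n fun s hs => ?_).symm
    by_contra hne
    have := (abs_lt.1 (mem_of_bumpDensity_ne_zero z n hne).2).1
    linarith

end Bump

section Representation

variable {d : ℕ}

theorem continuous_extendCube {f : Cube d → ℝ} (hf : Continuous f) : Continuous (extendCube f) :=
  hf.comp (continuous_pi fun j => continuous_projIcc.comp (continuous_apply j))

theorem extendCube_coe (f : Cube d → ℝ) (z : Cube d) : extendCube f (fun j => (z j : ℝ)) = f z := by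
  rw [extendCube]
  congr 1
  funext j
  exact Set.projIcc_val _ (z j)

/-- The products of the bump densities are an approximate identity at `z`. -/
theorem tendsto_integral_prod_bumpDensity {f : Cube d → ℝ} (hf : Continuous f) (z : Cube d) :
    Tendsto (fun n => ∫ t in openCube d, extendCube f t * ∏ j, bumpDensity (z j) n (t j))
      atTop (𝓝 (f z)) := by
  have hc := continuous_extendCube hf
  rw [Metric.tendsto_atTop]
  intro δ hδ
  obtain ⟨r, hr, hfr⟩ := Metric.continuousAt_iff.1
    (hc.continuousAt (x := fun j => (z j : ℝ))) (δ / 2) (by positivity)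
  obtain ⟨N, hN⟩ := eventually_atTop.1
    (tendsto_bumpWidth.eventually_lt_const (show 0 < r / 2 by positivity))
  refine ⟨N, fun n hn => ?_⟩
  set ρ : (Fin d → ℝ) → ℝ := fun t => ∏ j, bumpDensity (z j) n (t j) with hρ
  have hρ0 : ∀ t, 0 ≤ ρ t := fun t => Finset.prod_nonneg fun j _ => bumpDensity_nonneg _ _ _
  have hρi : Integrable ρ := Integrable.fintype_prod fun j => integrable_bumpDensity (z j) n
  have hρ1 : ∫ t, ρ t = 1 := by
    rw [integral_fintype_prod_volume_eq_prod]
    simp [integral_bumpDensity]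
  have hne : ∀ t, ρ t ≠ 0 → t ∈ openCube d ∧ dist t (fun j => (z j : ℝ)) < r := by
    intro t ht
    have h : ∀ j, bumpDensity (z j) n (t j) ≠ 0 := fun j =>
      Finset.prod_ne_zero_iff.1 ht j (Finset.mem_univ j)
    have hw := bumpWidth_pos n
    refine ⟨fun j _ => ?_, (dist_pi_lt_iff hr).2 fun j => ?_⟩
    · have := (mem_of_bumpDensity_ne_zero _ n (h j)).1
      exact ⟨by linarith [this.1], by linarith [this.2]⟩
    · have := (mem_of_bumpDensity_ne_zero _ n (h j)).2
      rw [Real.dist_eq]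
      linarith [hN n hn]
  have hbd : ∀ t, |(extendCube f t - f z) * ρ t| ≤ δ / 2 * ρ t := by
    intro t
    rw [abs_mul, abs_of_nonneg (hρ0 t)]
    by_cases ht : ρ t = 0
    · simp [ht]
    · have := hfr (hne t ht).2
      rw [extendCube_coe, Real.dist_eq] at this
      exact mul_le_mul_of_nonneg_right this.le (hρ0 t)
  have hi : Integrable fun t => (extendCube f t - f z) * ρ t := by
    refine (hρi.const_mul (δ / 2)).mono ((hc.sub continuous_const).aestronglyMeasurable.mul hρi.1)
      (Eventually.of_forall fun t => ?_)
    rw [Real.norm_eq_abs, Real.norm_eq_abs]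
    exact (hbd t).trans (le_abs_self _)
  have hset : ∫ t in openCube d, extendCube f t * ρ t = ∫ t, extendCube f t * ρ t :=
    setIntegral_eq_integral_of_forall_compl_eq_zero fun t ht => by
      by_cases h : ρ t = 0
      · rw [h, mul_zero]
      · exact absurd (hne t h).1 ht
  have hsplit : ∀ t, extendCube f t * ρ t = (extendCube f t - f z) * ρ t + f z * ρ t :=
    fun t => by ring
  rw [Real.dist_eq, hset]
  simp_rw [hsplit]
  rw [integral_add hi (hρi.const_mul _), integral_const_mul, hρ1, mul_one, add_sub_cancel_right]
  calc |∫ t, (extendCube f t - f z) * ρ t| ≤ ∫ t, |(extendCube f t - f z) * ρ t| :=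
        abs_integral_le_integral_abs
    _ ≤ ∫ t, δ / 2 * ρ t := integral_mono hi.abs (hρi.const_mul _) hbd
    _ = δ / 2 := by rw [integral_const_mul, hρ1, mul_one]
    _ < δ := by linarith

variable (I₀ I₁ : Finset (Fin d))

/-- The weights of the bumps near `0`, near `1` and near the evaluation point `x` in the derivative
of the test function. They add up to zero, and the first two are the masses that a function on
`[0,1]` vanishing at the known boundary points does not see. -/
def bumpWeight (j : Fin d) (x : unitInterval) : Fin 3 → ℝ :=
  if j ∈ I₀ ∧ j ∈ I₁ then ![1 - x, x, -1] else if j ∈ I₀ then ![1, 0, -1] else ![0, 1, -1]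

/-- The centres of the three bumps. -/
def bumpNode (x : unitInterval) : Fin 3 → unitInterval := ![0, 1, x]

/-- One factor of the test functions approximating the product of the slopes `extSlope`. -/
def testFactor (j : Fin d) (x : unitInterval) (n : ℕ) (t : ℝ) : ℝ :=
  ∑ i, bumpWeight I₀ I₁ j x i * bumpCdf (bumpNode x i) n t

theorem bumpWeight_eq (j : Fin d) (x : unitInterval) :
    0 ≤ bumpWeight I₀ I₁ j x 0 ∧ 0 ≤ bumpWeight I₀ I₁ j x 1 ∧
      bumpWeight I₀ I₁ j x 0 + bumpWeight I₀ I₁ j x 1 = 1 ∧ bumpWeight I₀ I₁ j x 2 = -1 := by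
  have h0 := x.2.1
  have h1 := x.2.2
  unfold bumpWeight
  split_ifs <;> simp [h0, h1]

theorem contDiff_testFactor (j : Fin d) (x : unitInterval) (n : ℕ) :
    ContDiff ℝ ∞ (testFactor I₀ I₁ j x n) :=
  ContDiff.sum fun i _ => contDiff_const.mul (contDiff_bumpCdf (bumpNode x i) n)

theorem deriv_testFactor (j : Fin d) (x : unitInterval) (n : ℕ) (t : ℝ) :
    deriv (testFactor I₀ I₁ j x n) t
      = ∑ i, bumpWeight I₀ I₁ j x i * bumpDensity (bumpNode x i) n t :=
  (HasDerivAt.fun_sum fun i _ => (hasDerivAt_bumpCdf (bumpNode x i) n t).const_mul _).deriv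

theorem testFactor_eq_zero (j : Fin d) (x : unitInterval) (n : ℕ) {t : ℝ}
    (ht : t ∉ Set.Icc (bumpWidth n / 2) (1 - bumpWidth n / 2)) : testFactor I₀ I₁ j x n t = 0 := by
  obtain ⟨-, -, h, h2⟩ := bumpWeight_eq I₀ I₁ j x
  unfold testFactor
  rw [Fin.sum_univ_three, h2]
  rcases lt_or_ge t (bumpWidth n / 2) with h' | h'
  · simp only [bumpCdf_eq_zero_of_le _ n h'.le]
    ring
  · have h'' : 1 - bumpWidth n / 2 ≤ t := le_of_not_ge fun hh => ht ⟨h', hh⟩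
    simp only [bumpCdf_eq_one_of_ge _ n h'']
    linarith

theorem abs_testFactor_le (j : Fin d) (x : unitInterval) (n : ℕ) (t : ℝ) :
    |testFactor I₀ I₁ j x n t| ≤ 2 := by
  obtain ⟨h0, h1, h, h2⟩ := bumpWeight_eq I₀ I₁ j x
  unfold testFactor
  rw [Fin.sum_univ_three, h2]
  have a := bumpCdf_mem (bumpNode x 0) n t
  have b := bumpCdf_mem (bumpNode x 1) n t
  have c := bumpCdf_mem (bumpNode x 2) n t
  rw [abs_le]
  constructor <;> nlinarith

theorem tendsto_testFactor (j : Fin d) (x : unitInterval) {t : ℝ} (ht : t ∈ Set.Ioo (0 : ℝ) 1)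
    (htx : t ≠ x) : Tendsto (fun n => testFactor I₀ I₁ j x n t) atTop
      (𝓝 (extSlope I₀ I₁ j x t)) := by
  have h0 := x.2.1
  have h1 := x.2.2
  have hlim : Tendsto (fun n => testFactor I₀ I₁ j x n t) atTop
      (𝓝 (∑ i, bumpWeight I₀ I₁ j x i * if (bumpNode x i : ℝ) < t then 1 else 0)) := by
    refine tendsto_finsetSum _ fun i _ => (tendsto_bumpCdf _ ?_).const_mul _
    fin_cases i
    · exact ht.1.ne'
    · exact ht.2.ne
    · exact htx
  convert hlim using 2
  rw [Fin.sum_univ_three]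
  have e0 : (bumpNode x 0 : ℝ) = 0 := rfl
  have e1 : (bumpNode x 1 : ℝ) = 1 := rfl
  have e2 : (bumpNode x 2 : ℝ) = x := rfl
  rw [e0, e1, e2, if_pos ht.1, if_neg (not_lt.2 ht.2.le)]
  have hx : t < x ∨ x < t := lt_or_gt_of_ne htx
  have ht0 := ht.1
  have ht1 := ht.2
  unfold extSlope bumpWeight
  split_ifs with hb hxt h0' hxt hxt <;>
    simp only [Set.indicator, Set.mem_Ico, Pi.one_apply, Matrix.cons_val]
  · rw [if_neg (by intro h; linarith [h.2]), if_pos ⟨ht0.le, ht1⟩]; ring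
  · rw [if_pos ⟨ht0.le, hx.resolve_right hxt⟩, if_pos ⟨ht0.le, ht1⟩]; ring
  · rw [if_neg (by intro h; linarith [h.2]), if_neg (by intro h; linarith [h.1])]; ring
  · rw [if_pos ⟨ht0.le, hx.resolve_right hxt⟩, if_neg (by intro h; linarith [h.1])]; ring
  · rw [if_neg (by intro h; linarith [h.2]), if_pos ⟨hxt.le, ht1⟩]; ring
  · rw [if_neg (by intro h; linarith [h.2]),
      if_neg (by intro h; linarith [h.1, hx.resolve_right hxt])]; ring

/-- The test functions whose top mixed derivatives approximate the evaluation at `x`. -/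
def testFunction (x : Cube d) (n : ℕ) (t : Fin d → ℝ) : ℝ :=
  ∏ j, testFactor I₀ I₁ j (x j) n (t j)

theorem contDiff_testFunction (x : Cube d) (n : ℕ) : ContDiff ℝ ∞ (testFunction I₀ I₁ x n) :=
  contDiff_prod fun j _ => (contDiff_testFactor I₀ I₁ j (x j) n).comp (contDiff_apply ℝ ℝ j)

theorem tsupport_testFunction (x : Cube d) (n : ℕ) :
    tsupport (testFunction I₀ I₁ x n)
      ⊆ Set.univ.pi fun _ => Set.Icc (bumpWidth n / 2) (1 - bumpWidth n / 2) := by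
  refine closure_minimal (fun t ht j _ => ?_) (isClosed_set_pi fun _ _ => isClosed_Icc)
  by_contra hj
  exact ht (Finset.prod_eq_zero (Finset.mem_univ j) (testFactor_eq_zero I₀ I₁ j _ n hj))

theorem hasCompactSupport_testFunction (x : Cube d) (n : ℕ) :
    HasCompactSupport (testFunction I₀ I₁ x n) :=
  (isCompact_univ_pi fun _ => isCompact_Icc).of_isClosed_subset (isClosed_tsupport _)
    (tsupport_testFunction I₀ I₁ x n)

theorem tsupport_testFunction_subset (x : Cube d) (n : ℕ) :
    tsupport (testFunction I₀ I₁ x n) ⊆ openCube d := by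
  refine (tsupport_testFunction I₀ I₁ x n).trans (Set.pi_mono fun j _ t ht => ?_)
  have := bumpWidth_pos n
  exact ⟨by linarith [ht.1], by linarith [ht.2]⟩

theorem mixedPartial_testFunction (x : Cube d) (n : ℕ) (t : Fin d → ℝ) :
    mixedPartial Finset.univ (testFunction I₀ I₁ x n) t
      = ∑ p : Fin d → Fin 3, (∏ j, bumpWeight I₀ I₁ j (x j) (p j))
        * ∏ j, bumpDensity (bumpNode (x j) (p j)) n (t j) := by
  unfold testFunction
  rw [mixedPartial_prod _ fun j => contDiff_testFactor I₀ I₁ j (x j) n]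
  simp only [Finset.mem_univ, if_true, deriv_testFactor]
  rw [Finset.prod_univ_sum]
  simp only [Fintype.piFinset_univ, Finset.prod_mul_distrib]

/-- A constrained function annihilates all the terms of the expanded mixed derivative of the test
function in which some bump sits at the boundary. -/
theorem sum_bumpWeight_mul (hI : I₀ ∪ I₁ = Finset.univ) {f : Cube d → ℝ}
    (hf : ∀ x : Cube d, ((∃ i ∈ I₀, x i = 0) ∨ ∃ i ∈ I₁, x i = 1) → f x = 0) (x : Cube d) :
    ∑ p : Fin d → Fin 3, (∏ j, bumpWeight I₀ I₁ j (x j) (p j)) * f (fun j => bumpNode (x j) (p j))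
      = (-1) ^ d * f x := by
  rw [Finset.sum_eq_single (fun _ => (2 : Fin 3))]
  · have e : (∏ j, bumpWeight I₀ I₁ j (x j) 2) = (-1) ^ d := by
      simp [fun j => (bumpWeight_eq I₀ I₁ j (x j)).2.2.2]
    rw [e]
    rfl
  · intro p _ hp
    obtain ⟨j, hj⟩ : ∃ j, p j ≠ 2 := by
      by_contra! h
      exact hp (funext h)
    by_cases hw : bumpWeight I₀ I₁ j (x j) (p j) = 0
    · rw [Finset.prod_eq_zero (Finset.mem_univ j) hw, zero_mul]
    rw [hf, mul_zero]
    have hjI : j ∈ I₀ ∨ j ∈ I₁ := Finset.mem_union.1 (hI ▸ Finset.mem_univ j)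
    obtain h | h : p j = 0 ∨ p j = 1 := by
      revert hj
      generalize p j = q
      revert q
      decide
    · refine Or.inl ⟨j, ?_, by rw [h]; rfl⟩
      by_contra h0
      rw [h, bumpWeight, if_neg (fun h' => h0 h'.1), if_neg h0] at hw
      exact hw rfl
    · refine Or.inr ⟨j, ?_, by rw [h]; rfl⟩
      by_contra h1
      have h0 := hjI.resolve_right h1
      rw [h, bumpWeight, if_neg (fun h' => h1 h'.2), if_pos h0] at hw
      exact hw rfl
  · intro h
    exact absurd (Finset.mem_univ _) h

/-- The product of the slopes: the features of the Brownian kernel on the open cube. -/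
def cubeFeature (x : Cube d) (s : Fin d → ℝ) : ℝ := ∏ j, extSlope I₀ I₁ j (x j) (s j)

theorem memLp_cubeFeature (x : Cube d) :
    MemLp (cubeFeature I₀ I₁ x) 2 (volume.restrict (openCube d)) :=
  (memLp_fintype_prod fun j => memLp_extSlope I₀ I₁ j (x j)).restrict _

theorem setIntegral_cubeFeature_mul (x y : Cube d) :
    ∫ s in openCube d, cubeFeature I₀ I₁ x s * cubeFeature I₀ I₁ y s
      = brownianKernel I₀ I₁ x y := by
  simp only [cubeFeature, ← Finset.prod_mul_distrib]
  rw [openCube, volume_pi, Measure.restrict_pi_pi,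
    integral_fintype_prod_eq_prod (μ := fun _ => volume.restrict (Set.Ioo 0 1))
      (fun j t => extSlope I₀ I₁ j (x j) t * extSlope I₀ I₁ j (y j) t)]
  exact Finset.prod_congr rfl fun j _ => setIntegral_extSlope_mul I₀ I₁ j (x j) (y j)

/-- A constrained continuous function is represented by its top weak mixed derivative: test it
against `testFunction`, which tends to `cubeFeature` while its mixed derivative tends to
`(-1) ^ d` times the evaluation at `x` plus evaluations at which `f` vanishes. -/
theorem eq_setIntegral_mul_cubeFeature (hI : I₀ ∪ I₁ = Finset.univ) {f : Cube d → ℝ}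
    (hc : Continuous f) (hf : ∀ x : Cube d, ((∃ i ∈ I₀, x i = 0) ∨ ∃ i ∈ I₁, x i = 1) → f x = 0)
    {g : (Fin d → ℝ) → ℝ} (hg : IsWeakMixedDeriv (openCube d) Finset.univ (extendCube f) g)
    (x : Cube d) : f x = ∫ s in openCube d, g s * cubeFeature I₀ I₁ x s := by
  have hm := (isOpen_openCube (d := d)).measurableSet
  have : IsFiniteMeasure ((volume : Measure (Fin d → ℝ)).restrict (openCube d)) := by
    rw [openCube, volume_pi, Measure.restrict_pi_pi]
    infer_instance
  have hgi : Integrable g (volume.restrict (openCube d)) := hg.1.integrable (by norm_num)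
  have hright : Tendsto (fun n => ∫ s in openCube d, g s * testFunction I₀ I₁ x n s) atTop
      (𝓝 (∫ s in openCube d, g s * cubeFeature I₀ I₁ x s)) := by
    refine tendsto_integral_of_dominated_convergence (fun s => |g s| * 2 ^ d)
      (fun n => hgi.1.mul (contDiff_testFunction I₀ I₁ x n).continuous.aestronglyMeasurable)
      (hgi.abs.mul_const _) (fun n => Eventually.of_forall fun s => ?_) ?_
    · rw [norm_mul, Real.norm_eq_abs, Real.norm_eq_abs, testFunction, Finset.abs_prod]
      refine mul_le_mul_of_nonneg_left ?_ (abs_nonneg _)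
      refine (Finset.prod_le_prod (fun _ _ => abs_nonneg _) fun j _ =>
        abs_testFactor_le I₀ I₁ j (x j) n (s j)).trans_eq ?_
      simp
    · have hne : ∀ᵐ s ∂(volume.restrict (openCube d)), ∀ j, s j ≠ (x j : ℝ) := by
        refine ae_restrict_of_ae (ae_all_iff.2 fun j => ?_)
        exact Measure.ae_eval_ne _ j _
      filter_upwards [hne, ae_restrict_mem hm] with s hs hs'
      exact (tendsto_finsetProd _ fun j _ =>
        tendsto_testFactor I₀ I₁ j (x j) (hs' j (Set.mem_univ j)) (hs j)).const_mul _
  have hleft : Tendsto (fun n => ∫ s in openCube d,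
      extendCube f s * mixedPartial Finset.univ (testFunction I₀ I₁ x n) s) atTop
      (𝓝 ((-1) ^ d * f x)) := by
    rw [← sum_bumpWeight_mul I₀ I₁ hI hf x]
    have hbd : ∀ s, ‖extendCube f s‖ ≤ (‖(⟨f, hc⟩ : C(Cube d, ℝ))‖) := fun s =>
      ContinuousMap.norm_coe_le_norm (⟨f, hc⟩ : C(Cube d, ℝ)) _
    have e : ∀ n, ∫ s in openCube d,
        extendCube f s * mixedPartial Finset.univ (testFunction I₀ I₁ x n) s
        = ∑ p : Fin d → Fin 3, (∏ j, bumpWeight I₀ I₁ j (x j) (p j)) *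
          ∫ s in openCube d, extendCube f s *
            ∏ j, bumpDensity (bumpNode (x j) (p j)) n (s j) := by
      intro n
      simp_rw [mixedPartial_testFunction, Finset.mul_sum]
      rw [integral_finsetSum]
      · refine Finset.sum_congr rfl fun p _ => ?_
        rw [← integral_const_mul]
        congr 1
        funext s
        ring
      · intro p _
        refine Integrable.bdd_mul (c := ‖(⟨f, hc⟩ : C(Cube d, ℝ))‖) ?_
          (continuous_extendCube hc).aestronglyMeasurable (Eventually.of_forall hbd)
        refine Integrable.const_mul (Integrable.integrableOn ?_) _
        exact Integrable.fintype_prod fun j => integrable_bumpDensity (bumpNode (x j) (p j)) n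
    simp_rw [e]
    exact tendsto_finsetSum _ fun p _ =>
      (tendsto_integral_prod_bumpDensity hc fun j => bumpNode (x j) (p j)).const_mul _
  have heq : ∀ n, ∫ s in openCube d,
      extendCube f s * mixedPartial Finset.univ (testFunction I₀ I₁ x n) s
      = (-1) ^ d * ∫ s in openCube d, g s * testFunction I₀ I₁ x n s := fun n => by
    rw [hg.2 _ (contDiff_testFunction I₀ I₁ x n) (hasCompactSupport_testFunction I₀ I₁ x n)
      (tsupport_testFunction_subset I₀ I₁ x n)]
    simp
  simp_rw [heq] at hleft
  have h := tendsto_nhds_unique hleft (hright.const_mul _)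
  exact mul_left_cancel₀ (pow_ne_zero _ (by norm_num)) h

theorem integral_mul_sq_le {α : Type*} [MeasurableSpace α] {μ : Measure α} {f g : α → ℝ}
    (hf : MemLp f 2 μ) (hg : MemLp g 2 μ) :
    (∫ x, f x * g x ∂μ) ^ 2 ≤ (∫ x, f x ^ 2 ∂μ) * ∫ x, g x ^ 2 ∂μ := by
  have h : ∀ {f : α → ℝ} (hf : MemLp f 2 μ), ∫ x, f x ^ 2 ∂μ = ‖hf.toLp‖ ^ 2 := fun hf => by
    rw [← real_inner_self_eq_norm_sq, inner_toLp]
    simp only [sq]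
  rw [h hf, h hg, ← inner_toLp hf hg, ← mul_pow]
  exact sq_le_sq' (neg_le_of_abs_le (abs_real_inner_le_norm _ _)) (real_inner_le_norm _ _)

/-- `L²((0,1)^d)` with the features `cubeFeature` is a feature space of the Brownian kernel, so that
a function represented by `g ∈ L²` has norm at most `‖g‖`. -/
theorem sobolevCube_embeds_brownianSpace (hI : I₀ ∪ I₁ = Finset.univ) :
    (sobolevCube I₀ I₁).Embeds (brownianSpace I₀ I₁) := by
  refine ⟨1, one_pos, ?_⟩
  rintro f ⟨hc, ⟨-, hw⟩, hf⟩
  rw [one_mul]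
  have hg := isWeakMixedDeriv_weakMixedDeriv (hw Finset.univ)
  set g := weakMixedDeriv (openCube d) Finset.univ (extendCube f)
  have hrep := eq_setIntegral_mul_cubeFeature I₀ I₁ hI hc hf hg
  have hM : ∫ s in openCube d, g s ^ 2 ≤ h1mixNorm (openCube d) (extendCube f) ^ 2 := by
    rw [h1mixNorm, Real.sq_sqrt (Finset.sum_nonneg fun S _ => integral_nonneg fun s => sq_nonneg _)]
    exact Finset.single_le_sum (f := fun S => ∫ s in openCube d,
      weakMixedDeriv (openCube d) S (extendCube f) s ^ 2)
      (fun S _ => integral_nonneg fun s => sq_nonneg _) (Finset.mem_univ Finset.univ)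
  refine mem_rkhs_of_sum_mul_sq_le _ (h1mixNorm_nonneg _ _) fun v => ?_
  have hL : MemLp (fun s => v.sum fun x a => a * cubeFeature I₀ I₁ x s) 2
      (volume.restrict (openCube d)) :=
    memLp_finsetSum _ fun x _ => (memLp_cubeFeature I₀ I₁ x).const_mul (v x)
  have e1 : (v.sum fun x a => a * f x)
      = ∫ s in openCube d, g s * v.sum fun x a => a * cubeFeature I₀ I₁ x s := by
    simp only [Finsupp.sum, Finset.mul_sum]
    rw [integral_finsetSum]
    · refine Finset.sum_congr rfl fun x _ => ?_
      rw [hrep x, ← integral_const_mul]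
      congr 1
      funext s
      ring
    · intro x _
      exact hg.1.integrable_mul ((memLp_cubeFeature I₀ I₁ x).const_mul (v x))
  have e2 : kernelForm (brownianKernel I₀ I₁) v v
      = ∫ s in openCube d, (v.sum fun x a => a * cubeFeature I₀ I₁ x s) ^ 2 := by
    rw [← kernelForm_integral (memLp_cubeFeature I₀ I₁)]
    simp only [setIntegral_cubeFeature_mul]
  rw [e1, e2]
  exact (integral_mul_sq_le hg.1 hL).trans
    (mul_le_mul_of_nonneg_right hM (integral_nonneg fun s => sq_nonneg _))

end Representation

/-! ### The space `H¹(0,1)` -/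

section H1

variable {f h : unitInterval → ℝ} {g g' : ℝ → ℝ}

theorem isDeriv1_deriv1 (hf : MemH1 f) : IsDeriv1 f (deriv1 f) := by
  rw [deriv1, dif_pos hf]
  exact hf.choose_spec

theorem intervalIntegrable_of_memLp (hg : MemLp g 2 (volume.restrict (Set.Ioo 0 1))) {a b : ℝ}
    (ha : a ∈ Set.Icc (0 : ℝ) 1) (hb : b ∈ Set.Icc (0 : ℝ) 1) :
    IntervalIntegrable g volume a b := by
  have hi : IntegrableOn g (Set.Ioo 0 1) := hg.integrable (by norm_num)
  rw [← integrableOn_Icc_iff_integrableOn_Ioo] at hi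
  rw [intervalIntegrable_iff]
  refine hi.mono_set (Set.uIoc_subset_uIcc.trans ?_)
  exact Set.uIcc_subset_Icc ha hb

theorem IsDeriv1.continuous (hf : IsDeriv1 f g) : Continuous f := by
  have hgi : IntegrableOn g (Set.Ioo 0 1) volume := hf.1.integrable (by norm_num)
  have hi := hgi.integrable_indicator measurableSet_Ioo
  have hc := intervalIntegral.continuous_primitive
    (fun a b => hi.intervalIntegrable (a := a) (b := b)) 0
  have e : f = fun x : unitInterval =>
      f 0 + ∫ t in (0 : ℝ)..x, (Set.Ioo (0 : ℝ) 1).indicator g t := by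
    funext x
    conv_lhs => rw [hf.2 x]
    congr 1
    rw [intervalIntegral.integral_of_le x.2.1, intervalIntegral.integral_of_le x.2.1,
      integral_Ioc_eq_integral_Ioo, integral_Ioc_eq_integral_Ioo,
      setIntegral_indicator measurableSet_Ioo, Set.Ioo_inter_Ioo]
    simp [x.2.2]
  rw [e]
  exact continuous_const.add (hc.comp continuous_subtype_val)

theorem memLp_of_continuous (hf : Continuous f) : MemLp f 2 :=
  hf.memLp_of_hasCompactSupport (HasCompactSupport.of_compactSpace f)

theorem IsDeriv1.memLp (hf : IsDeriv1 f g) : MemLp f 2 := memLp_of_continuous hf.continuous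

/-- The derivative is unique almost everywhere, by Lebesgue's differentiation theorem. -/
theorem IsDeriv1.ae_unique (hf : IsDeriv1 f g) (hf' : IsDeriv1 f g') :
    g =ᵐ[volume.restrict (Set.Ioo 0 1)] g' := by
  have h01 : (0 : ℝ) ∈ Set.Icc (0 : ℝ) 1 := ⟨le_rfl, zero_le_one⟩
  have h11 : (1 : ℝ) ∈ Set.Icc (0 : ℝ) 1 := ⟨zero_le_one, le_rfl⟩
  have h1 := (intervalIntegrable_of_memLp hf.1 h01 h11).ae_hasDerivAt_integral
  have h2 := (intervalIntegrable_of_memLp hf'.1 h01 h11).ae_hasDerivAt_integral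
  rw [Filter.EventuallyEq, ae_restrict_iff' measurableSet_Ioo]
  rw [Set.uIcc_of_le zero_le_one] at h1 h2
  filter_upwards [h1, h2] with x hx hx' hmem
  have d1 := hx ⟨hmem.1.le, hmem.2.le⟩ 0 h01
  have d2 := hx' ⟨hmem.1.le, hmem.2.le⟩ 0 h01
  refine d1.unique (d2.congr_of_eventuallyEq ?_)
  filter_upwards [Ioo_mem_nhds hmem.1 hmem.2] with t ht
  have e1 := hf.2 ⟨t, ht.1.le, ht.2.le⟩
  rw [hf'.2 ⟨t, ht.1.le, ht.2.le⟩] at e1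
  exact (add_left_cancel e1).symm

theorem IsDeriv1.add (hf : IsDeriv1 f g) (hh : IsDeriv1 h g') :
    IsDeriv1 (f + h) fun t => g t + g' t := by
  refine ⟨hf.1.add hh.1, fun x => ?_⟩
  rw [intervalIntegral.integral_add (intervalIntegrable_of_memLp hf.1 (by simp) x.2)
    (intervalIntegrable_of_memLp hh.1 (by simp) x.2), Pi.add_apply, Pi.add_apply, hf.2 x, hh.2 x]
  ring

theorem IsDeriv1.smul (hf : IsDeriv1 f g) (c : ℝ) : IsDeriv1 (c • f) fun t => c * g t := by
  refine ⟨hf.1.const_mul c, fun x => ?_⟩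
  rw [intervalIntegral.integral_const_mul, Pi.smul_apply, Pi.smul_apply, hf.2 x]
  simp [mul_add]

theorem MemH1.add (hf : MemH1 f) (hh : MemH1 h) : MemH1 (f + h) := by
  obtain ⟨g, hg⟩ := hf
  obtain ⟨g', hg'⟩ := hh
  exact ⟨_, hg.add hg'⟩

theorem MemH1.smul (hf : MemH1 f) (c : ℝ) : MemH1 (c • f) := by
  obtain ⟨g, hg⟩ := hf
  exact ⟨_, hg.smul c⟩

theorem memH1_zero : MemH1 0 := ⟨0, MemLp.zero, fun x => by simp⟩

theorem MemH1.sub (hf : MemH1 f) (hh : MemH1 h) : MemH1 (f - h) := by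
  rw [sub_eq_add_neg, ← neg_one_smul ℝ h]
  exact hf.add (hh.smul _)

theorem isDeriv1_of_hasDerivWithinAt {u w : ℝ → ℝ} (hu : Continuous u) (hw : Measurable w)
    (hb : ∃ C, ∀ x, |w x| ≤ C) (hd : ∀ x, HasDerivWithinAt u (w x) (Set.Ioi x) x) :
    IsDeriv1 (fun x => u x) w := by
  obtain ⟨C, hC⟩ := hb
  have hL : MemLp w 2 (volume.restrict (Set.Ioo 0 1)) :=
    MemLp.of_bound hw.aestronglyMeasurable C (Eventually.of_forall hC)
  refine ⟨hL, fun x => ?_⟩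
  rw [intervalIntegral.integral_eq_sub_of_hasDeriv_right hu.continuousOn (fun t _ => hd t)
    (intervalIntegrable_of_memLp hL (by simp) x.2)]
  simp

theorem h1Inner_eq (hf : IsDeriv1 f g) (hh : IsDeriv1 h g') :
    h1Inner f h = (∫ x, f x * h x) + ∫ t in Set.Ioo 0 1, g t * g' t := by
  rw [h1Inner, intervalIntegral.integral_of_le zero_le_one, integral_Ioc_eq_integral_Ioo]
  congr 1
  refine integral_congr_ae ?_
  filter_upwards [(isDeriv1_deriv1 ⟨g, hf⟩).ae_unique hf,
    (isDeriv1_deriv1 ⟨g', hh⟩).ae_unique hh] with t h1 h2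
  rw [h1, h2]

/-- The embedding of `H¹(0,1)` into the bounded functions. -/
theorem sq_le_two_mul_h1Inner (hf : MemH1 f) (x : unitInterval) : f x ^ 2 ≤ 2 * h1Inner f f := by
  obtain ⟨g, hg⟩ := hf
  have h01 : (0 : ℝ) ∈ Set.Icc (0 : ℝ) 1 := ⟨le_rfl, zero_le_one⟩
  have : IsProbabilityMeasure ((volume : Measure ℝ).restrict (Set.Ioo 0 1)) := ⟨by simp⟩
  have hgi : IntegrableOn g (Set.Ioo 0 1) := hg.1.integrable (by norm_num)
  set b := ∫ t in Set.Ioo 0 1, |g t| with hb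
  have hosc : ∀ y, |f x - f y| ≤ b := by
    intro y
    have e : f x - f y = ∫ t in (y : ℝ)..x, g t := by
      rw [hg.2 x, hg.2 y, add_sub_add_left_eq_sub, intervalIntegral.integral_interval_sub_left
        (intervalIntegrable_of_memLp hg.1 h01 x.2) (intervalIntegrable_of_memLp hg.1 h01 y.2)]
    rw [e]
    refine (intervalIntegral.norm_integral_le_integral_norm_uIoc (f := g) (a := y) (b := x)
      (μ := volume)).trans ?_
    rw [hb, ← integral_Icc_eq_integral_Ioo]
    rw [← integrableOn_Icc_iff_integrableOn_Ioo] at hgi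
    exact setIntegral_mono_set hgi.norm (Eventually.of_forall fun t => norm_nonneg _)
      (Set.uIoc_subset_uIcc.trans (Set.uIcc_subset_Icc y.2 x.2)).eventuallyLE
  have hb2 : b ^ 2 ≤ ∫ t in Set.Ioo 0 1, g t * g t := by
    have h1 := integral_mul_sq_le (f := fun t => |g t|) (g := fun _ => (1 : ℝ))
      (μ := volume.restrict (Set.Ioo 0 1)) hg.1.abs (memLp_const 1)
    simp only [mul_one, sq_abs, one_pow, integral_const, probReal_univ, smul_eq_mul] at h1
    simpa only [← sq] using h1
  -- this bound is then integrated over `y`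
  have hsq : ∀ y, f x ^ 2 ≤ 2 * (f y * f y) + 2 * b ^ 2 := by
    intro y
    have h1 : (f x - f y) ^ 2 ≤ b ^ 2 := sq_le_sq' (neg_le_of_abs_le (hosc y))
      (le_of_abs_le (hosc y))
    nlinarith [sq_nonneg (f x - 2 * f y)]
  have hfi : Integrable (fun y => f y * f y) := hg.memLp.integrable_mul hg.memLp
  have h2 : f x ^ 2 ≤ ∫ y, (2 * (f y * f y) + 2 * b ^ 2) := by
    have h3 := integral_mono (integrable_const (f x ^ 2))
      ((hfi.const_mul 2).add (integrable_const (2 * b ^ 2))) hsq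
    simpa using h3
  rw [integral_add (hfi.const_mul 2) (integrable_const _), integral_const_mul] at h2
  rw [h1Inner_eq hg hg]
  simp only [integral_const, probReal_univ, smul_eq_mul, one_mul] at h2
  linarith

end H1

/-! ### The one-dimensional FEM spaces -/

section Fem

variable {d : ℕ} (I₀ I₁ : Finset (Fin d)) (j : Fin d)

theorem hat_eq (α β : ℕ) (x : unitInterval) : hat α β x = max (1 - |(x : ℝ) * 2 ^ α - β|) 0 := by
  unfold hat
  congr 2
  have h2 : (0 : ℝ) < 2 ^ α := by positivity
  rw [div_inv_eq_mul, ← abs_of_pos h2, ← abs_mul, abs_of_pos h2, sub_mul, mul_assoc,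
    inv_mul_cancel₀ h2.ne', mul_one]

theorem memH1_hat (α β : ℕ) : MemH1 (hat α β) := by
  have h2 : (0 : ℝ) < 2 ^ α := by positivity
  set N : ℝ := 2 ^ α with hN
  have hramp : ∀ a : ℝ, MemH1 fun x : unitInterval => ramp (a / N) ((a + 1) / N) x := fun a =>
    ⟨_, isDeriv1_of_hasDerivWithinAt (by unfold ramp; fun_prop)
      (measurable_one.indicator measurableSet_Ico) ⟨1, fun x => by
        by_cases hx : x ∈ Set.Ico (a / N) ((a + 1) / N) <;> simp [hx]⟩
      (hasDerivWithinAt_ramp (by gcongr; linarith))⟩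
  have hconst : MemH1 fun _ => (1 : ℝ) := ⟨fun _ => 0, MemLp.zero, fun x => by simp⟩
  -- the hat rises with slope `N` before `β / N`, falls with slope `-N` after it, and `1` corrects
  -- the values `(β - 1) / N` and `β / N` of the two ramps on their left
  have e : hat α β = (N • (fun x : unitInterval => ramp (((β : ℝ) - 1) / N) ((β - 1 + 1) / N) x)
      - N • fun x : unitInterval => ramp ((β : ℝ) / N) ((β + 1) / N) x)
      + (1 : ℝ) • fun _ => (1 : ℝ) := by
    funext x
    rw [hat_eq]
    simp only [Pi.add_apply, Pi.sub_apply, Pi.smul_apply, smul_eq_mul, ramp, mul_one]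
    rw [mul_max_of_nonneg _ _ h2.le, mul_max_of_nonneg _ _ h2.le, mul_min_of_nonneg _ _ h2.le,
      mul_min_of_nonneg _ _ h2.le, mul_div_cancel₀ _ h2.ne', mul_div_cancel₀ _ h2.ne',
      mul_div_cancel₀ _ h2.ne', mul_div_cancel₀ _ h2.ne', ← hN, mul_comm (x : ℝ) N]
    generalize N * (x : ℝ) = s
    rw [sub_add_cancel]
    rcases le_total s β with h | h
    · rw [abs_of_nonpos (by linarith), min_eq_right h, min_eq_right (by linarith : s ≤ β + 1),
        max_eq_left h]
      rcases le_total s (β - 1) with h' | h'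
      · rw [max_eq_left h', max_eq_right (by linarith)]; ring
      · rw [max_eq_right h', max_eq_left (by linarith)]; ring
    · rw [abs_of_nonneg (by linarith), min_eq_left h, max_eq_right (by linarith : (β : ℝ) - 1 ≤ β)]
      rcases le_total s (β + 1) with h' | h'
      · rw [min_eq_right h', max_eq_right h, max_eq_left (by linarith)]; ring
      · rw [min_eq_left h', max_eq_right (by linarith), max_eq_right (by linarith)]; ring
  rw [e]
  exact (((hramp _).smul _).sub ((hramp _).smul _)).add (hconst.smul _)

theorem memH1_of_mem_femLevel {α : ℕ} {f : unitInterval → ℝ} (hf : f ∈ femLevel I₀ I₁ j α) :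
    MemH1 f := by
  induction hf using Submodule.span_induction with
  | mem f hf =>
    obtain ⟨β, -, rfl⟩ := hf
    exact memH1_hat α β
  | zero => exact memH1_zero
  | add f g _ _ hf hg => exact hf.add hg
  | smul c f _ hf => exact hf.smul c

theorem femLevel_boundary {α : ℕ} {f : unitInterval → ℝ} (hf : f ∈ femLevel I₀ I₁ j α) :
    (j ∈ I₀ → f 0 = 0) ∧ (j ∈ I₁ → f 1 = 0) := by
  induction hf using Submodule.span_induction with
  | mem f hf =>
    obtain ⟨β, hβ, rfl⟩ := hf
    rw [Finset.mem_Icc] at hβ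
    constructor
    · intro h
      rw [if_pos h] at hβ
      have h1 : (1 : ℝ) ≤ β := by exact_mod_cast hβ.1
      rw [hat_eq]
      refine max_eq_right ?_
      simp only [Set.Icc.coe_zero, zero_mul, zero_sub, abs_neg]
      linarith [le_abs_self (β : ℝ)]
    · intro h
      rw [if_pos h] at hβ
      have h1 : (β : ℝ) + 1 ≤ 2 ^ α := by
        have : β + 1 ≤ 2 ^ α := by have := Nat.one_le_two_pow (n := α); omega
        exact_mod_cast this
      rw [hat_eq]
      refine max_eq_right ?_
      simp only [Set.Icc.coe_one, one_mul]
      linarith [le_abs_self ((2 : ℝ) ^ α - β)]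
  | zero => simp
  | add f g _ _ hf hg =>
    exact ⟨fun h => by simp [hf.1 h, hg.1 h], fun h => by simp [hf.2 h, hg.2 h]⟩
  | smul c f _ hf => exact ⟨fun h => by simp [hf.1 h], fun h => by simp [hf.2 h]⟩

theorem femLimit_boundary {f : unitInterval → ℝ} (hf : f ∈ femLimit I₀ I₁ j) :
    (j ∈ I₀ → f 0 = 0) ∧ (j ∈ I₁ → f 1 = 0) := by
  -- point evaluations are continuous on `H¹(0,1)`
  have key : ∀ x : unitInterval,
      (∀ α, ∀ g ∈ femLevel I₀ I₁ j α, g x = 0) → f x = 0 := by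
    intro x hx
    by_contra hne
    obtain ⟨α, g, hg, hlt⟩ := hf.2 (|f x| / 2) (by have := abs_pos.2 hne; positivity)
    have h1 := sq_le_two_mul_h1Inner (hf.1.sub (memH1_of_mem_femLevel I₀ I₁ j hg)) x
    rw [Pi.sub_apply, hx α g hg, sub_zero] at h1
    have h2 := (Real.sqrt_lt' (by have := abs_pos.2 hne; positivity)).1 hlt
    rw [div_pow, sq_abs] at h2
    nlinarith [sq_nonneg (f x), sq_pos_of_ne_zero hne]
  exact ⟨fun h => key 0 fun α g hg => (femLevel_boundary I₀ I₁ j hg).1 h,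
    fun h => key 1 fun α g hg => (femLevel_boundary I₀ I₁ j hg).2 h⟩

/-- Functions vanishing at the known boundary points are represented by their derivatives. -/
theorem setIntegral_deriv_mul_extSlope (hj : j ∈ I₀ ∨ j ∈ I₁) {f : unitInterval → ℝ} {g : ℝ → ℝ}
    (hf : IsDeriv1 f g) (hb : (j ∈ I₀ → f 0 = 0) ∧ (j ∈ I₁ → f 1 = 0)) (y : unitInterval) :
    ∫ t in Set.Ioo 0 1, g t * extSlope I₀ I₁ j y t = f y := by
  have h01 : (0 : ℝ) ∈ Set.Icc (0 : ℝ) 1 := ⟨le_rfl, zero_le_one⟩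
  have h11 : (1 : ℝ) ∈ Set.Icc (0 : ℝ) 1 := ⟨zero_le_one, le_rfl⟩
  have hgi : IntegrableOn g (Set.Ioo 0 1) := hf.1.integrable (by norm_num)
  have h1 := hf.2 1
  have hy := hf.2 y
  have hadj := intervalIntegral.integral_add_adjacent_intervals
    (intervalIntegrable_of_memLp hf.1 h01 y.2) (intervalIntegrable_of_memLp hf.1 y.2 h11)
  have ind : ∀ a b : ℝ, ∫ t in Set.Ioo 0 1, g t * (Set.Ico a b).indicator 1 t
      = ∫ t in Set.Ioo 0 1 ∩ Set.Ico a b, g t := by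
    intro a b
    rw [← setIntegral_indicator measurableSet_Ico]
    congr 1
    funext t
    simp [Set.indicator]
  have indi : ∀ a b : ℝ, Integrable (fun t => g t * (Set.Ico a b).indicator 1 t)
      (volume.restrict (Set.Ioo 0 1)) := fun a b =>
    hf.1.integrable_mul ((memLp_indicator_const 2 measurableSet_Ico (1 : ℝ)
      (Or.inr (by simp))).restrict _)
  have e0 : ∫ t in Set.Ioo 0 1, g t * (Set.Ico 0 (y : ℝ)).indicator 1 t
      = ∫ t in (0 : ℝ)..y, g t := by
    rw [ind, intervalIntegral.integral_of_le y.2.1, integral_Ioc_eq_integral_Ioo]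
    congr 2
    ext t
    simp only [Set.mem_inter_iff, Set.mem_Ioo, Set.mem_Ico]
    exact ⟨fun h => ⟨h.1.1, h.2.2⟩, fun h => ⟨⟨h.1, h.2.trans_le y.2.2⟩, h.1.le, h.2⟩⟩
  have e1 : ∫ t in Set.Ioo 0 1, g t * (Set.Ico 0 1).indicator 1 t = ∫ t in (0 : ℝ)..1, g t := by
    rw [ind, intervalIntegral.integral_of_le zero_le_one, integral_Ioc_eq_integral_Ioo]
    congr 2
    exact Set.inter_eq_left.2 fun t ht => ⟨ht.1.le, ht.2⟩
  have e2 : ∫ t in Set.Ioo 0 1, g t * (Set.Ico (2 - (y : ℝ)) 2).indicator 1 t = 0 := by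
    rw [ind]
    have : Set.Ioo 0 1 ∩ Set.Ico (2 - (y : ℝ)) 2 = ∅ := by
      ext t
      simp only [Set.mem_inter_iff, Set.mem_Ioo, Set.mem_Ico, Set.mem_empty_iff_false, iff_false]
      intro h
      linarith [h.1.2, h.2.1, y.2.2]
    rw [this]
    simp
  have e3 : ∫ t in Set.Ioo 0 1, g t * (Set.Ico (-1) (-(y : ℝ))).indicator 1 t = 0 := by
    rw [ind]
    have : Set.Ioo 0 1 ∩ Set.Ico (-1) (-(y : ℝ)) = ∅ := by
      ext t
      simp only [Set.mem_inter_iff, Set.mem_Ioo, Set.mem_Ico, Set.mem_empty_iff_false, iff_false]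
      intro h
      linarith [h.1.1, h.2.2, y.2.1]
    rw [this]
    simp
  have e4 : ∫ t in Set.Ioo 0 1, g t * (Set.Ico (y : ℝ) 1).indicator 1 t
      = ∫ t in (y : ℝ)..1, g t := by
    rw [ind, intervalIntegral.integral_of_le y.2.2, integral_Ioc_eq_integral_Ioo,
      ← integral_Ico_eq_integral_Ioo]
    refine (setIntegral_congr_set ((Ioo_ae_eq_Ico (a := (0 : ℝ)) (b := 1)).inter
      (ae_eq_refl (Set.Ico (y : ℝ) 1)))).trans ?_
    rw [Set.Ico_inter_Ico, max_eq_right y.2.1, min_self]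
  unfold extSlope
  split_ifs with hb' h0
  · simp only [mul_sub, mul_left_comm _ (y : ℝ)]
    rw [integral_sub (indi _ _) ((indi _ _).const_mul _), integral_const_mul, e0, e1]
    have a0 := hb.1 hb'.1
    have a1 := hb.2 hb'.2
    rw [a0] at h1 hy
    rw [a1] at h1
    simp only [Set.Icc.coe_one] at h1
    rw [hy, show ∫ t in (0 : ℝ)..1, g t = 0 by linarith]
    ring
  · simp only [mul_sub]
    rw [integral_sub (indi _ _) (indi _ _), e0, e2, hy, hb.1 h0]
    ring
  · simp only [mul_sub]
    rw [integral_sub (indi _ _) (indi _ _), e3, e4]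
    have a1 := hb.2 (hj.resolve_left h0)
    rw [a1] at h1
    simp only [Set.Icc.coe_one] at h1
    linarith

end Fem

/-! ### The sections of the Brownian kernels are limits of finite elements -/

section Sections

variable {d : ℕ} (I₀ I₁ : Finset (Fin d)) (j : Fin d)

/-- The section `k(·, y)` of the one-dimensional Brownian kernel, as a function on `[0,1]`. -/
def brownianSection (y x : unitInterval) : ℝ := brownian1 I₀ I₁ j x y

theorem isDeriv1_brownianSection (y : unitInterval) :
    IsDeriv1 (brownianSection I₀ I₁ j y) (extSlope I₀ I₁ j y) := by
  have h := isDeriv1_of_hasDerivWithinAt (continuous_extSection I₀ I₁ j y)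
    (measurable_extSlope I₀ I₁ j y) ⟨1, abs_extSlope_le I₀ I₁ j y⟩
    (hasDerivWithinAt_extSection I₀ I₁ j y)
  have e : brownianSection I₀ I₁ j y = fun x : unitInterval => extSection I₀ I₁ j y x :=
    funext fun x => (extSection_coe I₀ I₁ j x y).symm
  rwa [e]

theorem h1Inner_brownianSection (y z : unitInterval) :
    h1Inner (brownianSection I₀ I₁ j y) (brownianSection I₀ I₁ j z)
      = (∫ x, brownianSection I₀ I₁ j y x * brownianSection I₀ I₁ j z x)
        + brownian1 I₀ I₁ j y z := by
  rw [h1Inner_eq (isDeriv1_brownianSection I₀ I₁ j y) (isDeriv1_brownianSection I₀ I₁ j z),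
    setIntegral_extSlope_mul]

theorem isPSD_integral_brownianSection : IsPSD fun y z =>
    ∫ x, brownianSection I₀ I₁ j y x * brownianSection I₀ I₁ j z x :=
  isPSD_integral fun y => (isDeriv1_brownianSection I₀ I₁ j y).memLp

theorem isPSD_sub_integral_brownianSection : IsPSD fun y z : unitInterval =>
    brownian1 I₀ I₁ j y z
    - ∫ x, brownianSection I₀ I₁ j y x * brownianSection I₀ I₁ j z x := by
  have h := isPSD_sub_integral_sections (isPSD_brownian1 I₀ I₁ j) (μ := volume)
    (fun s : unitInterval => s) (fun s => (brownian1_self_mem I₀ I₁ j s).2)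
    (fun y => (isDeriv1_brownianSection I₀ I₁ j y).memLp)
  simpa [brownianSection] using h

theorem isPSD_h1Inner_brownianSection : IsPSD fun y z =>
    h1Inner (brownianSection I₀ I₁ j y) (brownianSection I₀ I₁ j z) := by
  simp only [h1Inner_brownianSection]
  exact (isPSD_integral_brownianSection I₀ I₁ j).add (isPSD_brownian1 I₀ I₁ j)

/-- The summand `∫ f h` of the inner product costs at most one more copy of the Brownian kernel. -/
theorem isPSD_sub_h1Inner_brownianSection : IsPSD fun y z : unitInterval =>
    2 * brownian1 I₀ I₁ j y z
      - h1Inner (brownianSection I₀ I₁ j y) (brownianSection I₀ I₁ j z) := by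
  refine (isPSD_congr fun y z => ?_).1 (isPSD_sub_integral_brownianSection I₀ I₁ j)
  rw [h1Inner_brownianSection]
  ring

theorem kernelForm_single_sub_single {X : Type*} {k : X → X → ℝ} (hk : ∀ x y, k x y = k y x)
    (y z : X) : kernelForm k (Finsupp.single y 1 - Finsupp.single z 1)
      (Finsupp.single y 1 - Finsupp.single z 1) = k y y - 2 * k y z + k z z := by
  have h : ∀ u : X → ℝ, (Finsupp.single y (1 : ℝ) - Finsupp.single z 1).sum (fun x a => a * u x)
      = u y - u z := fun u => by
    rw [Finsupp.sum_sub_index fun _ _ _ => sub_mul _ _ _]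
    simp
  simp only [kernelForm, mul_assoc, ← Finsupp.mul_sum, h]
  rw [hk z y]
  ring

theorem brownian1_dist_le (y z : unitInterval) :
    brownian1 I₀ I₁ j y y - 2 * brownian1 I₀ I₁ j y z + brownian1 I₀ I₁ j z z
      ≤ |(y : ℝ) - z| := by
  unfold brownian1
  rcases le_total (y : ℝ) z with h | h
  · rw [abs_of_nonpos (by linarith), min_eq_left h, max_eq_right h]
    split_ifs <;> simp only [min_self, max_self] <;> nlinarith [sq_nonneg ((y : ℝ) - z)]
  · rw [abs_of_nonneg (by linarith), min_eq_right h, max_eq_left h]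
    split_ifs <;> simp only [min_self, max_self] <;> nlinarith [sq_nonneg ((y : ℝ) - z)]

/-- The sections depend `1/2`-Hölder continuously on the point, in the norm of `H¹(0,1)`. -/
theorem h1Inner_brownianSection_sub_le (y z : unitInterval) :
    h1Inner (brownianSection I₀ I₁ j y - brownianSection I₀ I₁ j z)
      (brownianSection I₀ I₁ j y - brownianSection I₀ I₁ j z) ≤ 2 * |(y : ℝ) - z| := by
  set v : unitInterval →₀ ℝ := Finsupp.single y 1 - Finsupp.single z 1 with hv
  have hsum : ∀ u : unitInterval → ℝ, (v.sum fun x a => a * u x) = u y - u z := fun u => by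
    rw [hv, Finsupp.sum_sub_index fun _ _ _ => sub_mul _ _ _]
    simp
  have hd : IsDeriv1 (brownianSection I₀ I₁ j y - brownianSection I₀ I₁ j z)
      fun t => extSlope I₀ I₁ j y t + -1 * extSlope I₀ I₁ j z t := by
    rw [sub_eq_add_neg, ← neg_one_smul ℝ (brownianSection I₀ I₁ j z)]
    exact (isDeriv1_brownianSection I₀ I₁ j y).add ((isDeriv1_brownianSection I₀ I₁ j z).smul _)
  have h1 := kernelForm_integral (fun y => (isDeriv1_brownianSection I₀ I₁ j y).memLp) v
  have h2 := kernelForm_integral (fun y => (isDeriv1_brownianSection I₀ I₁ j y).1) v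
  simp only [hsum, setIntegral_extSlope_mul] at h1 h2
  have h3 := (isPSD_sub_integral_brownianSection I₀ I₁ j).nonneg v
  rw [kernelForm_sub_kernel, h1] at h3
  have h4 := brownian1_dist_le I₀ I₁ j y z
  rw [← kernelForm_single_sub_single (k := fun s t : unitInterval => brownian1 I₀ I₁ j s t)
    (isPSD_brownian1 I₀ I₁ j).symm, ← hv] at h4
  rw [h1Inner_eq hd hd]
  simp only [Pi.sub_apply, ← sq, neg_one_mul, ← sub_eq_add_neg]
  linarith

theorem brownian1_affine {a b θ y : ℝ} (hab : a ≤ b) (h0 : 0 ≤ θ) (h1 : θ ≤ 1)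
    (hy : y ≤ a ∨ b ≤ y) :
    brownian1 I₀ I₁ j a y * (1 - θ) + brownian1 I₀ I₁ j b y * θ
      = brownian1 I₀ I₁ j (a + θ * (b - a)) y := by
  have h2 : a ≤ a + θ * (b - a) := by nlinarith
  have h3 : a + θ * (b - a) ≤ b := by nlinarith
  unfold brownian1
  rcases hy with hy | hy
  · rw [min_eq_right hy, max_eq_left hy, min_eq_right (hy.trans hab), max_eq_left (hy.trans hab),
      min_eq_right (hy.trans h2), max_eq_left (hy.trans h2)]
    split_ifs <;> ring
  · rw [min_eq_left (hab.trans hy), max_eq_right (hab.trans hy), min_eq_left hy, max_eq_right hy,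
      min_eq_left (h3.trans hy), max_eq_right (h3.trans hy)]
    split_ifs <;> ring

/-- The value at a point of a cell of the grid of a combination of hat functions. -/
theorem sum_mul_hat (u : ℕ → ℝ) {α i : ℕ} (hi : i + 1 ≤ 2 ^ α) {x : unitInterval}
    (h0 : (i : ℝ) ≤ x * 2 ^ α) (h1 : (x : ℝ) * 2 ^ α ≤ i + 1) :
    ∑ β ∈ Finset.range (2 ^ α + 1), u β * hat α β x
      = u i * (1 - (x * 2 ^ α - i)) + u (i + 1) * (x * 2 ^ α - i) := by
  rw [Finset.sum_eq_add i (i + 1) (by simp)]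
  · rw [hat_eq, hat_eq]
    congr 2
    · rw [abs_of_nonneg (by linarith), max_eq_left (by linarith)]
    · push_cast
      rw [abs_of_nonpos (by linarith), max_eq_left (by linarith)]
      ring
  · intro β _ hβ
    rw [hat_eq, max_eq_right, mul_zero]
    rcases lt_or_gt_of_ne hβ.1 with h | h
    · have : (β : ℝ) + 1 ≤ i := by exact_mod_cast h
      linarith [le_abs_self ((x : ℝ) * 2 ^ α - β)]
    · have : (i : ℝ) + 1 + 1 ≤ β := by
        have : i + 1 + 1 ≤ β := by omega
        exact_mod_cast this
      linarith [neg_le_abs ((x : ℝ) * 2 ^ α - β)]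
  · intro h
    exact absurd (Finset.mem_range.2 (by omega)) h
  · intro h
    exact absurd (Finset.mem_range.2 (by omega)) h

/-- At a grid point the section of the Brownian kernel is a finite element: it is affine on the
cells of the grid and vanishes at the known boundary points. -/
theorem brownianSection_mem_femLevel {α m : ℕ} {y : unitInterval} (hy : (y : ℝ) * 2 ^ α = m) :
    brownianSection I₀ I₁ j y ∈ femLevel I₀ I₁ j α := by
  have hN : (0 : ℝ) < 2 ^ α := by positivity
  have e : brownianSection I₀ I₁ j y = ∑ β ∈ Finset.range (2 ^ α + 1),
      brownian1 I₀ I₁ j ((β : ℝ) / 2 ^ α) y • hat α β := by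
    funext x
    rw [Finset.sum_apply]
    simp only [Pi.smul_apply, smul_eq_mul]
    obtain ⟨i, hi, h0, h1⟩ : ∃ i : ℕ, i + 1 ≤ 2 ^ α ∧ (i : ℝ) ≤ x * 2 ^ α
        ∧ (x : ℝ) * 2 ^ α ≤ i + 1 := by
      have hx0 : 0 ≤ (x : ℝ) * 2 ^ α := mul_nonneg x.2.1 hN.le
      rcases eq_or_lt_of_le x.2.2 with h | h
      -- the right end point belongs to the last cell
      · refine ⟨2 ^ α - 1, by have := Nat.one_le_two_pow (n := α); omega, ?_, ?_⟩ <;>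
          rw [h, Nat.cast_sub Nat.one_le_two_pow] <;> push_cast <;> linarith
      · refine ⟨⌊(x : ℝ) * 2 ^ α⌋₊, ?_, Nat.floor_le hx0, (Nat.lt_floor_add_one _).le⟩
        rw [Nat.succ_le_iff, Nat.floor_lt hx0]
        push_cast
        nlinarith
    rw [sum_mul_hat (fun β => brownian1 I₀ I₁ j ((β : ℝ) / 2 ^ α) y) hi h0 h1]
    have hm : (y : ℝ) = m / 2 ^ α := by rw [← hy, mul_div_cancel_right₀ _ hN.ne']
    rw [brownian1_affine I₀ I₁ j (by push_cast; gcongr; linarith) (by linarith) (by linarith)]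
    · rw [brownianSection]
      congr 1
      push_cast
      field_simp
      ring
    · rw [hm]
      rcases le_or_gt m i with h | h
      · left; gcongr
      · right
        have : i + 1 ≤ m := h
        gcongr
  rw [e]
  refine Submodule.sum_mem _ fun β hβ => ?_
  rw [Finset.mem_range] at hβ
  by_cases hmem : β ∈ Finset.Icc (if j ∈ I₀ then 1 else 0) (2 ^ α - if j ∈ I₁ then 1 else 0)
  · exact Submodule.smul_mem _ _ (Submodule.subset_span ⟨β, hmem, rfl⟩)
  · have : (β = 0 ∧ j ∈ I₀) ∨ (β = 2 ^ α ∧ j ∈ I₁) := by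
      rw [Finset.mem_Icc] at hmem
      by_cases h0 : j ∈ I₀ <;> by_cases h1 : j ∈ I₁ <;> simp only [h0, h1, if_true, if_false,
        and_true, and_false, or_false, false_or] at hmem ⊢ <;> omega
    have h0 : brownian1 I₀ I₁ j ((β : ℝ) / 2 ^ α) y = 0 := by
      rcases this with ⟨rfl, h⟩ | ⟨rfl, h⟩
      · rw [Nat.cast_zero, zero_div]
        exact brownian1_zero I₀ I₁ j h y.2.1
      · rw [Nat.cast_pow, Nat.cast_ofNat, div_self hN.ne']
        exact brownian1_one I₀ I₁ j h y.2.2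
    rw [h0, zero_smul]
    exact Submodule.zero_mem _

theorem brownianSection_mem_femLimit (y : unitInterval) :
    brownianSection I₀ I₁ j y ∈ femLimit I₀ I₁ j := by
  refine ⟨⟨_, isDeriv1_brownianSection I₀ I₁ j y⟩, fun ε hε => ?_⟩
  obtain ⟨α, hα⟩ := exists_pow_lt_of_lt_one (by positivity : 0 < ε ^ 2 / 2)
    (by norm_num : (1 / 2 : ℝ) < 1)
  have hN : (0 : ℝ) < 2 ^ α := by positivity
  have h0 : 0 ≤ (y : ℝ) * 2 ^ α := mul_nonneg y.2.1 hN.le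
  have hle : (⌊(y : ℝ) * 2 ^ α⌋₊ : ℝ) / 2 ^ α ≤ y := (div_le_iff₀ hN).2 (Nat.floor_le h0)
  -- `y` is rounded down to the grid of level `α`
  let z : unitInterval := ⟨⌊(y : ℝ) * 2 ^ α⌋₊ / 2 ^ α, by positivity, hle.trans y.2.2⟩
  have hz : (z : ℝ) * 2 ^ α = ⌊(y : ℝ) * 2 ^ α⌋₊ := div_mul_cancel₀ _ hN.ne'
  refine ⟨α, brownianSection I₀ I₁ j z, brownianSection_mem_femLevel I₀ I₁ j hz, ?_⟩
  rw [Real.sqrt_lt' hε]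
  refine (h1Inner_brownianSection_sub_le I₀ I₁ j y z).trans_lt ?_
  have h1 : (y : ℝ) - z < (1 / 2) ^ α := by
    have h2 := Nat.lt_floor_add_one ((y : ℝ) * 2 ^ α)
    rw [← hz] at h2
    rw [one_div, inv_pow, ← one_div, lt_div_iff₀ hN, sub_mul]
    linarith
  have h3 : 0 ≤ (y : ℝ) - z := sub_nonneg.2 hle
  rw [abs_of_nonneg h3]
  linarith

end Sections

/-! ### The limiting tensor FEM space -/

section FemSpace

variable {d : ℕ} (I₀ I₁ : Finset (Fin d))

/-- The features of the one-dimensional kernel `mixedKernel`: the functions themselves, and no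
function for a point evaluation. -/
def featureVal : (unitInterval → ℝ) ⊕ unitInterval → unitInterval → ℝ
  | Sum.inl a, x => (open Classical in if MemH1 a then a x else 0)
  | Sum.inr _, _ => 0

/-- The derivative features of `mixedKernel`: the derivative of a function, and the derivative of
the section of the Brownian kernel for a point evaluation. -/
def featureDeriv (j : Fin d) : (unitInterval → ℝ) ⊕ unitInterval → ℝ → ℝ
  | Sum.inl a => deriv1 a
  | Sum.inr y => extSlope I₀ I₁ j y

/-- A kernel on the disjoint union of the functions and the points, which joins the inner product of
`H¹(0,1)`, the Brownian kernel, and the pairing `(a, y) ↦ a y`. -/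
def mixedKernel (j : Fin d) (p q : (unitInterval → ℝ) ⊕ unitInterval) : ℝ :=
  (∫ x, featureVal p x * featureVal q x)
    + ∫ t in Set.Ioo 0 1, featureDeriv I₀ I₁ j p t * featureDeriv I₀ I₁ j q t

theorem isPSD_mixedKernel (j : Fin d) : IsPSD (mixedKernel I₀ I₁ j) := by
  refine (isPSD_integral fun p => ?_).add (isPSD_integral fun p => ?_)
  · rcases p with a | y
    · by_cases h : MemH1 a
      · have e : featureVal (Sum.inl a) = a := funext fun x => if_pos h
        rw [e]
        exact (isDeriv1_deriv1 h).memLp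
      · have e : featureVal (Sum.inl a) = 0 := funext fun x => if_neg h
        rw [e]
        exact MemLp.zero
    · exact MemLp.zero
  · rcases p with a | y
    · by_cases h : MemH1 a
      · exact (isDeriv1_deriv1 h).1
      · have e : featureDeriv I₀ I₁ j (Sum.inl a) = 0 := dif_neg h
        rw [e]
        exact MemLp.zero
    · exact (memLp_extSlope I₀ I₁ j y).restrict _

variable {I₀ I₁}

theorem mixedKernel_inl_inl {j : Fin d} {a b : unitInterval → ℝ} (ha : MemH1 a) (hb : MemH1 b) :
    mixedKernel I₀ I₁ j (Sum.inl a) (Sum.inl b) = h1Inner a b := by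
  rw [mixedKernel, h1Inner, intervalIntegral.integral_of_le zero_le_one,
    integral_Ioc_eq_integral_Ioo]
  simp only [featureVal, featureDeriv, if_pos ha, if_pos hb]

theorem mixedKernel_inl_inr {j : Fin d} (hj : j ∈ I₀ ∨ j ∈ I₁) {a : unitInterval → ℝ}
    (ha : a ∈ femLimit I₀ I₁ j) (y : unitInterval) :
    mixedKernel I₀ I₁ j (Sum.inl a) (Sum.inr y) = a y := by
  simp only [mixedKernel, featureVal, featureDeriv, mul_zero, integral_zero, zero_add]
  exact setIntegral_deriv_mul_extSlope I₀ I₁ j hj (isDeriv1_deriv1 ha.1)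
    (femLimit_boundary I₀ I₁ j ha) y

theorem mixedKernel_inr_inr {j : Fin d} (y z : unitInterval) :
    mixedKernel I₀ I₁ j (Sum.inr y) (Sum.inr z) = brownian1 I₀ I₁ j y z := by
  simp only [mixedKernel, featureVal, featureDeriv, mul_zero, integral_zero, zero_add]
  exact setIntegral_extSlope_mul I₀ I₁ j y z

theorem kernelForm_mapDomain {X Y Z : Type*} (k : Z → Z → ℝ) (f : X → Z) (g : Y → Z) (v : X →₀ ℝ)
    (w : Y →₀ ℝ) : kernelForm k (v.mapDomain f) (w.mapDomain g)
      = v.sum fun x a => w.sum fun y b => a * b * k (f x) (g y) := by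
  unfold kernelForm
  rw [Finsupp.sum_mapDomain_index (by simp) (by simp [add_mul, Finsupp.sum_add])]
  refine Finset.sum_congr rfl fun x _ => ?_
  beta_reduce
  rw [Finsupp.sum_mapDomain_index (by simp) (by simp [mul_add, add_mul])]

/-- Cauchy–Schwarz for the product of the kernels `mixedKernel`: a finite combination of elementary
tensors is bounded, as a functional on the span of the Brownian kernel sections, by its tensor
norm. -/
theorem sum_mul_tensorEval_sq_le (hI : ∀ j, j ∈ I₀ ∨ j ∈ I₁)
    {c : (Fin d → unitInterval → ℝ) →₀ ℝ} (hc : ∀ a ∈ c.support, ∀ j, a j ∈ femLimit I₀ I₁ j)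
    (v : Cube d →₀ ℝ) :
    0 ≤ tensorInner c c ∧ (v.sum fun x a => a * tensorEval c x) ^ 2
      ≤ tensorInner c c * kernelForm (brownianKernel I₀ I₁) v v := by
  have hpsd := isPSD_prod (isPSD_mixedKernel I₀ I₁)
  let f : (Fin d → unitInterval → ℝ) → Fin d → (unitInterval → ℝ) ⊕ unitInterval :=
    fun a j => Sum.inl (a j)
  let g : Cube d → Fin d → (unitInterval → ℝ) ⊕ unitInterval := fun y j => Sum.inr (y j)
  have h1 := kernelForm_sq_le hpsd (c.mapDomain f) (v.mapDomain g)
  have h0 := hpsd.nonneg (c.mapDomain f)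
  simp only [kernelForm_mapDomain] at h1 h0
  have e1 : (c.sum fun a z => c.sum fun b w => z * w *
      ∏ j, mixedKernel I₀ I₁ j (f a j) (f b j)) = tensorInner c c :=
    Finset.sum_congr rfl fun a ha => Finset.sum_congr rfl fun b hb => by
      beta_reduce
      congr 1
      exact Finset.prod_congr rfl fun j _ =>
        mixedKernel_inl_inl (hc a ha j).1 (hc b hb j).1
  have e2 : (v.sum fun x a => v.sum fun y b => a * b *
      ∏ j, mixedKernel I₀ I₁ j (g x j) (g y j)) = kernelForm (brownianKernel I₀ I₁) v v :=
    Finset.sum_congr rfl fun x _ => Finset.sum_congr rfl fun y _ => by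
      beta_reduce
      congr 1
      exact Finset.prod_congr rfl fun j _ => mixedKernel_inr_inr (x j) (y j)
  have e3 : (c.sum fun a z => v.sum fun y b => z * b *
      ∏ j, mixedKernel I₀ I₁ j (f a j) (g y j)) = v.sum fun x a => a * tensorEval c x := by
    simp only [tensorEval, Finsupp.mul_sum]
    rw [Finsupp.sum_comm]
    refine Finset.sum_congr rfl fun y _ => Finset.sum_congr rfl fun a ha => ?_
    beta_reduce
    rw [Finset.prod_congr rfl fun j _ => mixedKernel_inl_inr (hI j) (hc a ha j) (y j)]
    ring
  rw [e1] at h0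
  rw [e1, e2, e3] at h1
  exact ⟨h0, h1⟩

theorem IsTensorLimit.nonneg {E : Fin d → Set (unitInterval → ℝ)} {f : Cube d → ℝ} {r : ℝ}
    (h : IsTensorLimit E f r) : 0 ≤ r := by
  obtain ⟨c, -, -, -, hr⟩ := h
  exact ge_of_tendsto' hr fun n => Real.sqrt_nonneg _

theorem IsTensorLimit.mem_brownianSpace (hI : ∀ j, j ∈ I₀ ∨ j ∈ I₁) {f : Cube d → ℝ} {r : ℝ}
    (h : IsTensorLimit (femLimit I₀ I₁) f r) :
    f ∈ (brownianSpace I₀ I₁).carrier ∧ (brownianSpace I₀ I₁).norm f ≤ r := by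
  refine mem_rkhs_of_sum_mul_sq_le _ h.nonneg fun v => ?_
  obtain ⟨c, hc, -, hf, hr⟩ := h
  have h1 : Tendsto (fun n => (v.sum fun x a => a * tensorEval (c n) x) ^ 2) atTop
      (𝓝 ((v.sum fun x a => a * f x) ^ 2)) :=
    (tendsto_finsetSum _ fun x _ => (hf x).const_mul _).pow 2
  have h2 := (hr.pow 2).mul_const (kernelForm (brownianKernel I₀ I₁) v v)
  refine le_of_tendsto_of_tendsto' h1 h2 fun n => ?_
  have h3 := sum_mul_tensorEval_sq_le hI (hc n) v
  rw [Real.sq_sqrt h3.1]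
  exact h3.2

theorem femSpace_embeds_brownianSpace (hI : ∀ j, j ∈ I₀ ∨ j ∈ I₁) :
    (femSpace I₀ I₁).Embeds (brownianSpace I₀ I₁) := by
  refine ⟨1, one_pos, fun f hf => ?_⟩
  obtain ⟨r, hr⟩ := hf
  refine ⟨(hr.mem_brownianSpace hI).1, ?_⟩
  rw [one_mul]
  exact le_csInf ⟨r, hr⟩ fun s hs => (hs.mem_brownianSpace hI).2

variable (I₀ I₁)

/-- The Gram kernel, for the tensor inner product, of the tensors `⊗ k_j(·, y_j)`. -/
def sectionKernel (y z : Cube d) : ℝ :=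
  ∏ j, h1Inner (brownianSection I₀ I₁ j (y j)) (brownianSection I₀ I₁ j (z j))

instance : Fact (kernelMatrix (sectionKernel I₀ I₁)).PosSemidef :=
  ⟨(isPSD_prod (isPSD_h1Inner_brownianSection I₀ I₁)).posSemidef⟩

theorem norm_kerSum_sectionKernel_le (v : Cube d →₀ ℝ) :
    ‖kerSum (sectionKernel I₀ I₁) v‖ ≤ √(2 ^ d) * ‖kerSum (brownianKernel I₀ I₁) v‖ := by
  refine le_of_sq_le_sq ?_ (by positivity)
  rw [mul_pow, Real.sq_sqrt (by positivity), norm_kerSum_sq, norm_kerSum_sq]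
  have h := kernelForm_prod_le (isPSD_h1Inner_brownianSection I₀ I₁) (isPSD_brownian1 I₀ I₁)
    (isPSD_sub_h1Inner_brownianSection I₀ I₁) v
  rwa [Finset.prod_const, Finset.card_univ, Fintype.card_fin] at h

/-- The combination `∑ v y ⊗ k_j(·, y_j)` of elementary tensors. -/
def sectionTensor (v : Cube d →₀ ℝ) : (Fin d → unitInterval → ℝ) →₀ ℝ :=
  v.mapDomain fun y j => brownianSection I₀ I₁ j (y j)

theorem tensorInner_sectionTensor (v : Cube d →₀ ℝ) :
    tensorInner (sectionTensor I₀ I₁ v) (sectionTensor I₀ I₁ v)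
      = ‖kerSum (sectionKernel I₀ I₁) v‖ ^ 2 := by
  rw [norm_kerSum_sq]
  have h := kernelForm_mapDomain
    (fun a b : Fin d → unitInterval → ℝ => ∏ j, h1Inner (a j) (b j))
    (fun (y : Cube d) j => brownianSection I₀ I₁ j (y j))
    (fun (y : Cube d) j => brownianSection I₀ I₁ j (y j)) v v
  unfold kernelForm at h ⊢
  exact h

theorem tensorEval_sectionTensor (v : Cube d →₀ ℝ) (x : Cube d) :
    tensorEval (sectionTensor I₀ I₁ v) x = kerSum (brownianKernel I₀ I₁) v x := by
  rw [tensorEval, sectionTensor, Finsupp.sum_mapDomain_index (by simp) (by simp [add_mul]),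
    kerSum_apply]
  rfl

/-- Combinations of kernel sections converging in the Brownian space give combinations of elementary
tensors converging in the tensor norm, by `norm_kerSum_sectionKernel_le`. -/
theorem brownianSpace_embeds_femSpace : (brownianSpace I₀ I₁).Embeds (femSpace I₀ I₁) := by
  refine ⟨√(2 ^ d), by positivity, ?_⟩
  rintro _ ⟨h, rfl⟩
  obtain ⟨w, hw, hlim⟩ := mem_closure_iff_seq_limit.1 (denseRange_kerSum h)
  choose v hv using hw
  obtain rfl : (fun n => kerSum (brownianKernel I₀ I₁) (v n)) = w := funext hv
  let P : RKHS.OfKernel (kernelMatrix (brownianKernel I₀ I₁)) →L[ℝ]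
      RKHS.OfKernel (kernelMatrix (sectionKernel I₀ I₁)) :=
    (kerSum (sectionKernel I₀ I₁)).extendOfNorm (kerSum (brownianKernel I₀ I₁))
  have hP : ∀ u, P (kerSum (brownianKernel I₀ I₁) u) = kerSum (sectionKernel I₀ I₁) u :=
    LinearMap.extendOfNorm_eq denseRange_kerSum ⟨_, norm_kerSum_sectionKernel_le I₀ I₁⟩
  have hPh : ‖P h‖ ≤ √(2 ^ d) * ‖h‖ :=
    LinearMap.norm_extendOfNorm_apply_le denseRange_kerSum _
      (norm_kerSum_sectionKernel_le I₀ I₁) h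
  have hPlim : Tendsto (fun n => kerSum (sectionKernel I₀ I₁) (v n)) atTop (𝓝 (P h)) := by
    have h1 := (P.continuous.tendsto h).comp hlim
    simpa only [Function.comp_def, hP] using h1
  have hsqrt : ∀ u, √(tensorInner (sectionTensor I₀ I₁ u) (sectionTensor I₀ I₁ u))
      = ‖kerSum (sectionKernel I₀ I₁) u‖ := fun u => by
    rw [tensorInner_sectionTensor, Real.sqrt_sq (norm_nonneg _)]
  have hT : IsTensorLimit (femLimit I₀ I₁) (⇑h) ‖P h‖ := by
    refine ⟨fun n => sectionTensor I₀ I₁ (v n), fun n a ha j => ?_, fun ε hε => ?_, fun x => ?_, ?_⟩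
    · classical
      obtain ⟨y, -, rfl⟩ := Finset.mem_image.1 (Finsupp.mapDomain_support ha)
      exact brownianSection_mem_femLimit I₀ I₁ j (y j)
    · obtain ⟨N, hN⟩ := Metric.cauchySeq_iff.1 hPlim.cauchySeq ε hε
      refine ⟨N, fun m hm n hn => ?_⟩
      have e : sectionTensor I₀ I₁ (v m) - sectionTensor I₀ I₁ (v n)
          = sectionTensor I₀ I₁ (v m - v n) :=
        ((Finsupp.lmapDomain ℝ ℝ _).map_sub (v m) (v n)).symm
      rw [e, hsqrt, map_sub, ← dist_eq_norm]
      exact hN m hm n hn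
    · simp only [tensorEval_sectionTensor, ← inner_kerSection]
      exact tendsto_const_nhds.inner hlim
    · simp only [hsqrt]
      exact hPlim.norm
  refine ⟨⟨_, hT⟩, ?_⟩
  have hn : (brownianSpace I₀ I₁).norm ⇑h = ‖h‖ := rkhs_norm_coe _ h
  rw [hn]
  have hle : sInf {r | IsTensorLimit (femLimit I₀ I₁) (⇑h) r} ≤ ‖P h‖ :=
    csInf_le ⟨0, fun r hr => IsTensorLimit.nonneg hr⟩ hT
  exact hle.trans hPh

end FemSpace

end BdryGP

end

theorem theorem4 (d : ℕ) (I₀ I₁ : Finset (Fin d)) (hI : I₀ ∪ I₁ = Finset.univ)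
    (ω : Fin d → ℝ) (hω : ∀ j, 0 < ω j) (σ : ℝ) (hσ : 0 < σ) :
    ∀ A ∈ ({BdryGP.brownianSpace I₀ I₁, BdryGP.bdryMaternSpace I₀ I₁ ω hω σ,
        BdryGP.sobolevCube I₀ I₁, BdryGP.sobolevRestrict I₀ I₁,
        BdryGP.femSpace I₀ I₁} : Set (BdryGP.FnSpace (BdryGP.Cube d))),
    ∀ B ∈ ({BdryGP.brownianSpace I₀ I₁, BdryGP.bdryMaternSpace I₀ I₁ ω hω σ,
        BdryGP.sobolevCube I₀ I₁, BdryGP.sobolevRestrict I₀ I₁,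
        BdryGP.femSpace I₀ I₁} : Set (BdryGP.FnSpace (BdryGP.Cube d))),
      A.Equivalent B := by
  have hj : ∀ j, j ∈ I₀ ∨ j ∈ I₁ := fun j => by
    rw [← Finset.mem_union, hI]
    exact Finset.mem_univ j
  have hBM := BdryGP.bdryMaternSpace_brownianSpace_embeds I₀ I₁ hI ω hω σ hσ
  have h1 := BdryGP.brownianSpace_embeds_sobolevRestrict I₀ I₁
  have h2 := BdryGP.sobolevRestrict_embeds_sobolevCube I₀ I₁
  have h3 := BdryGP.sobolevCube_embeds_brownianSpace I₀ I₁ hI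
  have h4 := BdryGP.brownianSpace_embeds_femSpace I₀ I₁
  have h5 := BdryGP.femSpace_embeds_brownianSpace hj
  suffices h : ∀ A ∈ ({BdryGP.brownianSpace I₀ I₁, BdryGP.bdryMaternSpace I₀ I₁ ω hω σ,
      BdryGP.sobolevCube I₀ I₁, BdryGP.sobolevRestrict I₀ I₁,
      BdryGP.femSpace I₀ I₁} : Set (BdryGP.FnSpace (BdryGP.Cube d))),
      A.Embeds (BdryGP.brownianSpace I₀ I₁) ∧ (BdryGP.brownianSpace I₀ I₁).Embeds A from
    fun A hA B hB => ((h A hA).1.trans (h B hB).2).equivalent ((h B hB).1.trans (h A hA).2)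
  rintro A (rfl | rfl | rfl | rfl | rfl)
  · exact ⟨h4.trans h5, h4.trans h5⟩
  · exact hBM
  · exact ⟨h3, h1.trans h2⟩
  · exact ⟨h2.trans h3, h1⟩
  · exact ⟨h5, h4⟩
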